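/- Let $N\ge 1$ and $d\ge 2$ be integers. For $A\in\operatorname{SL}_N(\overline{\mathbb{Q}})$ and $\mathbf b\in\overline{\mathbb{Q}}^N$ let $f=f_{A,\mathbf b}:\mathbb{P}^N\to\mathbb{P}^N$ be the extension to $\mathbb{P}^N$ of the map $f(\mathbf X)=A\mathbf X^d+\mathbf b$ of $\mathbb{A}^N$, where $\mathbf X^d=(X_1^d,\dots,X_N^d)$, and let $f|_H:\mathbb{P}^{N-1}\to\mathbb{P}^{N-1}$, $\mathbf X\mapsto A\mathbf X^d$, be its restriction to the hyperplane $H$ at infinity. Heights are absolute logarithmic Weil heights: $h(\mathbf b)$ is the height of the point $[b_1:\dots:b_N:1]$; $h(A)$ is the height of the tuple of entries of $A$ as a point of projective space; the height $h(g)$ of an endomorphism $g$ of $\mathbb{P}^n$ is that of the tuple of coefficients of the forms defining $g$; and the height $h(D)$ of an effective divisor $D$ is that of the tuple of coefficients of a form defining $D$. For an endomorphism $g$ of $\mathbb{P}^n$ of degree $d$ put $\hat h_g(D)=\lim_{k\to\infty}h(g^k_*D)/d^{kn}$, where $g_*$ is the push-forward of divisors, and let $\hat h_{\mathrm{crit}}(g)=\hat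 h_g(C_g)$ be the critical height, where $C_g$ is the divisor defined by the determinant of the Jacobian matrix of the forms defining $g$. On $\mathbb{P}^0$ all of these heights are $0$. The moduli height $h_{\mathsf M}(g)$ is the infimum of $h(M^{-1}\circ g\circ M)$ over $M\in\operatorname{GL}_{n+1}(\overline{\mathbb{Q}})$. Then there are constants $C_1,C_2$ depending only on $N$ and $d$ such that, for all $A\in\operatorname{SL}_N(\overline{\mathbb{Q}})$ and $\mathbf b\in\overline{\mathbb{Q}}^N$, the limits defining $\hat h_{\mathrm{crit}}(f)$ and $\hat h_{\mathrm{crit}}(f|_H)$ exist and $$\hat h_{\mathrm{crit}}(f)-\hat h_{\mathrm{crit}}(f|_H)\ \ge\ \frac{d-1}{d}\,h(\mathbf b)-\frac{N(dN+1)-1}{Nd}\,h(A)-C_1,$$ $$\hat h_{\mathrm{crit}}(f)-\hat h_{\mathrm{crit}}(f|_H)\ \le\ N(N+2)\,h(\mathbf b)+N(N+1)\,h(A)+C_2.$$ In particular, the critical height is a moduli height in families in which $A$ is fixed: for every $A\in\operatorname{SL}_N(\overline{\mathbb{Q}})$ there are constants $c_1,c_2>0$ and $C$ such that, for all $\mathbf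 b\in\overline{\mathbb{Q}}^N$ and $f=f_{A,\mathbf b}$, $$c_1h(\mathbf b)-C\le\hat h_{\mathrm{crit}}(f)\le c_2h(\mathbf b)+C\qquad\text{and}\qquad c_1h_{\mathsf M}(f)-C\le\hat h_{\mathrm{crit}}(f)\le c_2h_{\mathsf M}(f)+C.$$ -/

import Mathlib

open scoped LinearAlgebra.Projectivization
open Filter Topology

noncomputable section

namespace CritHeight

/-- The field of algebraic numbers. -/
abbrev Qbar : Type := AlgebraicClosure ℚ

instance Qbar.isAlgebraic : Algebra.IsAlgebraic ℚ Qbar := by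
  have h := AlgebraicClosure.isAlgebraic ℚ
  have e : (AlgebraicClosure.instAlgebra ℚ : Algebra ℚ Qbar) = DivisionRing.toRatAlgebra :=
    Subsingleton.elim _ _
  rw [← e]
  exact h

/-! ### Absolute logarithmic Weil heights -/

/-- The number field generated by the coordinates of a finite tuple of algebraic numbers. -/
abbrev coordField {ι : Type*} (x : ι → Qbar) : IntermediateField ℚ Qbar :=
  IntermediateField.adjoin ℚ (Set.range x)

instance coordField.finiteDimensional {ι : Type*} [Finite ι] (x : ι → Qbar) :
    FiniteDimensional ℚ (coordField x) :=
  IntermediateField.finiteDimensional_adjoin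
    (fun y _ => (Algebra.IsAlgebraic.isAlgebraic (R := ℚ) y).isIntegral)

instance coordField.numberField {ι : Type*} [Finite ι] (x : ι → Qbar) :
    NumberField (coordField x) where

/-- The absolute logarithmic height of the point of projective space with homogeneous coordinates
`x`, that is `∑ᵥ nᵥ log maxᵢ |xᵢ|ᵥ` with `nᵥ = [Kᵥ : ℚᵥ] / [K : ℚ]` and `K` the field generated by
the coordinates. Mathlib's `Height.logHeight` is the same sum with weights `[Kᵥ : ℚᵥ]`. -/
def absLogHeight {ι : Type*} [Finite ι] (x : ι → Qbar) : ℝ :=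
  Height.logHeight (K := coordField x)
      (fun i => ⟨x i, IntermediateField.subset_adjoin ℚ _ (Set.mem_range_self i)⟩) /
    (Module.finrank ℚ (coordField x) : ℝ)

/-- The height `h(𝐛)` of a vector, i.e. the height of the point `[b₁ : ⋯ : b_N : 1]`. -/
def vecHeight {N : ℕ} (b : Fin N → Qbar) : ℝ :=
  absLogHeight (Fin.snoc (α := fun _ => Qbar) b 1 : Fin (N + 1) → Qbar)

/-- The height `h(A)` of a matrix, i.e. the height of the tuple of its entries as a point of
projective space. -/
def matHeight {N : ℕ} (A : Matrix (Fin N) (Fin N) Qbar) : ℝ :=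
  absLogHeight (fun p : Fin N × Fin N => A p.1 p.2)

/-- The height of a form, i.e. of the tuple of its coefficients as a point of projective space. -/
def formHeight {m : ℕ} (F : MvPolynomial (Fin m) Qbar) : ℝ :=
  absLogHeight (fun s : F.support => F.coeff s)

/-! ### Endomorphisms of projective space

An endomorphism of the projective space of dimension `m - 1` is given by `m` forms of the same
degree in `m` variables without a common zero. -/

/-- A tuple of `m` forms in `m` variables. -/
abbrev FormTuple (m : ℕ) : Type := Fin m → MvPolynomial (Fin m) Qbar

/-- The projective space of dimension `m - 1` over the algebraic numbers. -/
abbrev PSpace (m : ℕ) : Type := ℙ Qbar (Fin m → Qbar)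

open Classical in
/-- The map `P ↦ [Φ₁(P) : ⋯ : Φ_m(P)]` (extended by the identity to the common zeros of the forms,
of which there are none when `Φ` defines a morphism). -/
def projMap {m : ℕ} (Φ : FormTuple m) (P : PSpace m) : PSpace m :=
  if h : (fun i => MvPolynomial.eval P.rep (Φ i)) ≠ 0 then Projectivization.mk Qbar _ h else P

/-- The height of an endomorphism, i.e. of the tuple of all coefficients of the forms defining it,
as a point of projective space. -/
def tupleHeight {m : ℕ} (Φ : FormTuple m) : ℝ :=
  absLogHeight (fun s : (Σ i : Fin m, (Φ i).support) => (Φ s.1).coeff s.2)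

/-- The conjugate `M⁻¹ ∘ Φ ∘ M` of an endomorphism by a linear change of coordinates. -/
def conjBy {m : ℕ} (M : GL (Fin m) Qbar) (Φ : FormTuple m) : FormTuple m := fun i =>
  ∑ j, MvPolynomial.C ((M⁻¹).1 i j) *
    MvPolynomial.aeval (fun l => ∑ r, MvPolynomial.C (M.1 l r) * MvPolynomial.X r) (Φ j)

/-- The moduli height of the conjugacy class of an endomorphism: the greatest lower bound of the
heights of its conjugates under linear changes of coordinates. -/
def moduliHeight {m : ℕ} (Φ : FormTuple m) : ℝ :=
  ⨅ M : GL (Fin m) Qbar, tupleHeight (conjBy M Φ)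

/-! ### Effective divisors and their push-forward -/

/-- The zero locus of a form in projective space. -/
def zeroLocus {m : ℕ} (F : MvPolynomial (Fin m) Qbar) : Set (PSpace m) :=
  {P | MvPolynomial.eval P.rep F = 0}

/-- Effective divisors on projective space, as multisets of irreducible hypersurfaces. -/
abbrev EffDivisor (m : ℕ) : Type := Multiset (Set (PSpace m))

/-- The divisor of a nonzero form: the zero loci of its irreducible factors, with multiplicity.
(In projective space of dimension zero these loci are empty; `mapDegree` below is zero on the empty
set, and the forms involved are monomials, so that they do not contribute to any height.) -/
def divisorOf {m : ℕ} (F : MvPolynomial (Fin m) Qbar) : EffDivisor m :=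
  (UniqueFactorizationMonoid.factors F).map zeroLocus

open Classical in
/-- An irreducible form defining an irreducible hypersurface (unique up to a constant factor). -/
def formOf {m : ℕ} (Z : Set (PSpace m)) : MvPolynomial (Fin m) Qbar :=
  if h : ∃ p : MvPolynomial (Fin m) Qbar,
      Irreducible p ∧ (∃ e, p.IsHomogeneous e) ∧ zeroLocus p = Z
  then h.choose else 1

/-- The height of an effective divisor: the height of a form defining it. -/
def divHeight {m : ℕ} (D : EffDivisor m) : ℝ := formHeight (D.map formOf).prod

/-- The degree of the map `Z → f(Z)` induced by `f` on a hypersurface `Z`: the number of points in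
the fibre over a general point of `f(Z)`. -/
def mapDegree {m : ℕ} (f : PSpace m → PSpace m) (Z : Set (PSpace m)) : ℕ :=
  sInf {n : ℕ | ∃ (s : MvPolynomial (Fin m) Qbar) (e : ℕ), s.IsHomogeneous e ∧
    (∃ Q ∈ f '' Z, Q ∉ zeroLocus s) ∧
    ∀ Q ∈ f '' Z, Q ∉ zeroLocus s → {P ∈ Z | f P = Q}.ncard = n}

/-- The push-forward of effective divisors: the additive map with
`f_*[Z] = deg(Z → f(Z)) · [f(Z)]`. -/
def pushforward {m : ℕ} (f : PSpace m → PSpace m) (D : EffDivisor m) : EffDivisor m :=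
  D.bind (fun Z => Multiset.replicate (mapDegree f Z) (f '' Z))

/-! ### Canonical heights and critical heights -/

/-- The terms `h(f_*^k D) / d^{k (m - 1)}` of the sequence defining the canonical height of a
divisor `D` on projective space of dimension `m - 1` for an endomorphism `f` of degree `d`. -/
def canonicalSeq {m : ℕ} (d : ℕ) (Φ : FormTuple m) (D : EffDivisor m) (k : ℕ) : ℝ :=
  divHeight ((pushforward (projMap Φ))^[k] D) / (d : ℝ) ^ (k * (m - 1))

/-- The canonical height of an effective divisor. -/
def canonicalHeight {m : ℕ} (d : ℕ) (Φ : FormTuple m) (D : EffDivisor m) : ℝ :=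
  limUnder atTop (canonicalSeq d Φ D)

/-- The critical divisor, defined by the vanishing of the Jacobian determinant. -/
def critDivisor {m : ℕ} (Φ : FormTuple m) : EffDivisor m :=
  divisorOf (Matrix.of fun i j => MvPolynomial.pderiv j (Φ i)).det

/-- The critical height of an endomorphism of degree `d`. -/
def critHeight {m : ℕ} (d : ℕ) (Φ : FormTuple m) : ℝ :=
  canonicalHeight d Φ (critDivisor Φ)

/-! ### The maps `𝐗 ↦ A 𝐗ᵈ + 𝐛` -/

/-- The extension to `ℙᴺ` of the map `𝐗 ↦ A 𝐗ᵈ + 𝐛` of affine space; the last coordinate is the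
homogenizing one, so that the hyperplane `H` at infinity is given by its vanishing. -/
def affinePowerMap {N : ℕ} (d : ℕ) (A : Matrix (Fin N) (Fin N) Qbar) (b : Fin N → Qbar) :
    FormTuple (N + 1) :=
  Fin.snoc (α := fun _ => MvPolynomial (Fin (N + 1)) Qbar)
    (fun i => (∑ j, MvPolynomial.C (A i j) * MvPolynomial.X j.castSucc ^ d) +
      MvPolynomial.C (b i) * MvPolynomial.X (Fin.last N) ^ d)
    (MvPolynomial.X (Fin.last N) ^ d)

/-- The restriction to the hyperplane `H`, where the last coordinate vanishes, of an endomorphism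
that maps `H` to itself. -/
def restrictH {N : ℕ} (Φ : FormTuple (N + 1)) : FormTuple N := fun i =>
  MvPolynomial.aeval (Fin.snoc (α := fun _ => MvPolynomial (Fin N) Qbar) MvPolynomial.X 0)
    (Φ i.castSucc)

end CritHeight

end

noncomputable section

namespace CritHeight

/-! ### Extension of the base field -/

section FieldExtension

open NumberField Height

variable (K L : Type*) [Field K] [NumberField K] [Field L] [NumberField L] [Algebra K L]

/-! In homogeneous coordinates f is the map 𝐗 ↦ L 𝐗ᵈ with L = `augMatrix A b`, and f|_H is 𝐗 ↦ A 𝐗ᵈ.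
For such a map the push-forward is explicit: multiply the conjugates F(ζ𝐗) over the tuples ζ of d-th
roots of unity with last entry 1, write the product as G(𝐗ᵈ), and substitute L⁻¹ into G
(`pushForm`). `IsFormOf.pushforward` shows that this form defines f_* of the divisor of F,
multiplicities included. A critical height is therefore a limit of normalised heights of iterated
forms, starting from the monomial ∏ Xᵢ^(d-1), which has height 0.

Every height inequality is proved one place at a time, with an error only at archimedean places, and
then summed by `setHeight_sum_le`. By Gauss's lemma and Gelfond's inequality (`le_lg_mul`) Gauss
norms are multiplicative up to an error linear in the degrees. On a projective space of dimension n,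
pushing forward a form of degree e multiplies its height by dⁿ up to d^(n-1)·e times h(L) or h(L⁻¹)
and a bounded multiple of e + 1. The normalised increments thus decay like d^(-k), which gives
convergence and explicit two-sided bounds (`canonicalSeq_bounds`). The upper bound of the theorem
combines the bound (N+1)h(L⁻¹) for f, the estimate h(L⁻¹) ≤ h(𝐛) + (N-1)h(A) + O(1), and the lower
bound -N·h(A) - O(1) for f|_H.

For the lower bound, the push-forwards of the critical form of f are compared with their
restrictions to H. Up to a constant, restricting a push-forward gives the d-th power of the
push-forward of the restriction (`associated_resH_pushForm`), so the restrictions account for the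
critical height of f|_H. At a given place let i be the coordinate where A⁻¹𝐛 is largest. If 𝐛 is
large compared with A, the iterated images of the hyperplane Xᵢ = 0 leave every bounded region at a
known rate (`escape`). A form without zeros in a large polydisc of the affine chart has coefficients
much larger than those of its restriction to H (`lg_resH_add_le`). The gain, summed over all places,
is (d-1)/d · h(𝐛) minus a multiple of h(A) (`local_lower`).

For fixed A, comparison with the moduli height needs a bound for h(𝐛) by the height of an arbitrary
conjugate of f by M. Split M into a diagonal matrix D and a matrix M' with normalised rows. The
Jacobian determinant of the conjugate is a power of the product of the rows of M, which bounds h(M')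
(`matHeight_rows_le`). Undoing M' bounds the height of D⁻¹LDᵈ (`matHeight_scaledMatrix_le`), and a
nonvanishing term of the Leibniz expansion of det A eliminates D (`log_setSup_pointSet_le`). -/

lemma prod_infinitePlace_pow_mult (g : InfinitePlace K → ℝ) :
    ∏ v : InfinitePlace K, g v ^ v.mult = ∏ φ : K →+* ℂ, g (InfinitePlace.mk φ) := by
  classical
  rw [← Finset.prod_fiberwise_of_maps_to (s := Finset.univ) (t := Finset.univ)
    (g := fun φ : K →+* ℂ => InfinitePlace.mk φ) (fun _ _ => Finset.mem_univ _)]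
  refine Finset.prod_congr rfl fun v _ => ?_
  rw [Finset.prod_congr rfl (g := fun _ => g v)
    (fun φ hφ => by rw [(Finset.mem_filter.mp hφ).2]), Finset.prod_const,
    InfinitePlace.card_filter_mk_eq]

open Classical in
lemma card_embeddings_over (ψ : K →+* ℂ) :
    (Finset.univ.filter fun φ : L →+* ℂ => φ.comp (algebraMap K L) = ψ).card =
      Module.finrank K L := by
  classical
  let : Algebra K ℂ := ψ.toAlgebra
  rw [← AlgHom.card K L ℂ]
  symm
  refine Finset.card_bij (s := (Finset.univ : Finset (L →ₐ[K] ℂ))) (fun φ _ => φ.toRingHom) ?_ ?_ ?_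
  · intro φ _
    simp only [Finset.mem_filter, Finset.mem_univ, true_and]
    ext x
    exact φ.commutes x
  · intro φ _ φ' _ h
    ext x
    exact congrArg (fun f : L →+* ℂ => f x) h
  · intro φ hφ
    simp only [Finset.mem_filter, Finset.mem_univ, true_and] at hφ
    exact ⟨⟨φ, fun x => congrArg (fun f : K →+* ℂ => f x) hφ⟩, Finset.mem_univ _, rfl⟩

/-- Each embedding of K has exactly [L : K] extensions to L. -/
lemma prod_embeddings_comp (g : (K →+* ℂ) → ℝ) :
    ∏ φ : L →+* ℂ, g (φ.comp (algebraMap K L)) = (∏ ψ : K →+* ℂ, g ψ) ^ Module.finrank K L := by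
  classical
  rw [← Finset.prod_fiberwise_of_maps_to (s := Finset.univ) (t := Finset.univ)
    (g := fun φ : L →+* ℂ => φ.comp (algebraMap K L)) (fun _ _ => Finset.mem_univ _),
    ← Finset.prod_pow]
  refine Finset.prod_congr rfl fun ψ _ => ?_
  rw [Finset.prod_congr rfl (g := fun _ => g ψ)
    (fun φ hφ => by rw [(Finset.mem_filter.mp hφ).2]), Finset.prod_const, card_embeddings_over]

variable {K}

/-- Scale the coordinates to be integral. The archimedean factor is then a product over embeddings,
and the finite factor is the inverse of the absolute norm of the ideal generated by the coordinates.
Both are raised to the power [L : K] on passing to L. -/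
lemma mulHeight_algebraMap {ι : Type*} [Finite ι] (x : ι → K) :
    mulHeight (fun i => algebraMap K L (x i)) = mulHeight x ^ Module.finrank K L := by
  by_cases hx : x = 0
  · subst hx
    have : (fun i => algebraMap K L ((0 : ι → K) i)) = 0 := by ext; simp
    rw [this]; simp
  obtain ⟨a, ha⟩ := IsLocalization.exist_integer_multiples_of_finite (nonZeroDivisors (𝓞 K)) x
  choose y hy using ha
  have ha0 : (algebraMap (𝓞 K) K (a : 𝓞 K)) ≠ 0 := by
    simp
  have hxy : (fun i => (y i : K)) = (algebraMap (𝓞 K) K (a : 𝓞 K)) • x := by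
    ext i
    simpa [Algebra.smul_def] using hy i
  have hy0 : y ≠ 0 := by
    rintro rfl
    apply hx
    have : (algebraMap (𝓞 K) K (a : 𝓞 K)) • x = 0 := by rw [← hxy]; ext; simp
    exact (smul_eq_zero.mp this).resolve_left ha0
  have hK : mulHeight x = mulHeight (fun i => (y i : K)) := by
    rw [hxy, mulHeight_smul_eq_mulHeight x ha0]
  have hL : mulHeight (fun i => algebraMap K L (x i)) =
      mulHeight (fun i => algebraMap K L (y i : K)) := by
    have : (fun i => algebraMap K L (y i : K)) =
        (algebraMap K L (algebraMap (𝓞 K) K (a : 𝓞 K))) • (fun i => algebraMap K L (x i)) := by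
      ext i
      have := congrFun hxy i
      simp only [Pi.smul_apply, smul_eq_mul] at this ⊢
      rw [this, map_mul]
    rw [this, mulHeight_smul_eq_mulHeight]
    simp
  rw [hK, hL]
  let z : ι → 𝓞 L := fun i => algebraMap (𝓞 K) (𝓞 L) (y i)
  have hz : (fun i => algebraMap K L (y i : K)) = fun i => (z i : L) := by
    ext i
    exact (IsScalarTower.algebraMap_apply (𝓞 K) K L (y i)).symm.trans
      (IsScalarTower.algebraMap_apply (𝓞 K) (𝓞 L) L (y i))
  have hz0 : z ≠ 0 := by
    intro h
    apply hy0
    ext i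
    have := congrFun h i
    simp only [z, Pi.zero_apply] at this ⊢
    rw [(FaithfulSMul.algebraMap_injective (𝓞 K) (𝓞 L)) (this.trans (map_zero _).symm)]
  have hyK : (fun i => (y i : K)) ≠ 0 := by
    intro h
    apply hy0
    ext i
    simpa using congrFun h i
  have hzL : (fun i => (z i : L)) ≠ 0 := by
    intro h
    apply hz0
    ext i
    simpa using congrFun h i
  have fK := absNorm_mul_finprod_finitePlace_eq_one (K := K) hy0
  have fL := absNorm_mul_finprod_finitePlace_eq_one (K := L) hz0
  have hspan : Ideal.span (Set.range z) =
      (Ideal.span (Set.range y)).map (algebraMap (𝓞 K) (𝓞 L)) := by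
    rw [Ideal.map_span, ← Set.range_comp]; rfl
  have hnorm : (Ideal.span (Set.range z)).absNorm =
      (Ideal.span (Set.range y)).absNorm ^ Module.finrank K L := by
    rw [hspan, Ideal.absNorm_algebraMap, IsFractionRing.finrank_eq (𝓞 K) K (𝓞 L) L]
  rw [hz, NumberField.mulHeight_eq hyK, NumberField.mulHeight_eq hzL, mul_pow]
  congr 1
  · rw [prod_infinitePlace_pow_mult L (fun w => ⨆ i, w (z i : L)),
      prod_infinitePlace_pow_mult K (fun w => ⨆ i, w (y i : K)), ← prod_embeddings_comp]
    refine Finset.prod_congr rfl fun φ _ => ?_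
    refine congrArg iSup (funext fun i => ?_)
    rw [InfinitePlace.apply, InfinitePlace.apply, ← congrFun hz i]
    rfl
  · rw [hnorm] at fL
    have h1 : ((Ideal.span (Set.range y)).absNorm : ℝ) ≠ 0 := left_ne_zero_of_mul (by rw [fK]; simp)
    have h2 := congrArg (· ^ Module.finrank K L) fK
    simp only [mul_pow, one_pow] at h2
    push_cast at fL
    exact mul_left_cancel₀ (pow_ne_zero _ h1) (fL.trans h2.symm)

lemma logHeight_algebraMap {ι : Type*} [Finite ι] (x : ι → K) :
    logHeight (fun i => algebraMap K L (x i)) = Module.finrank K L * logHeight x := by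
  rw [logHeight, logHeight, mulHeight_algebraMap, Real.log_pow]

end FieldExtension

/-! ### Extension of nonarchimedean absolute values -/

section Extend

variable {K : Type*} [Field K]

/-- A nonarchimedean absolute value extends to an algebraic extension field. -/
lemma exists_extension_of_isNonarchimedean {F : Type*} [Field F] [Algebra K F]
    [Algebra.IsAlgebraic K F] (v : AbsoluteValue K ℝ) (hv : IsNonarchimedean v) :
    ∃ w : AbsoluteValue F ℝ, IsNonarchimedean w ∧ ∀ x, w (algebraMap K F x) = v x := by
  classical
  -- The spectral norm is taken over a nontrivially normed field, so the trivial absolute value is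
  -- extended by hand.
  by_cases hv' : v.IsNontrivial
  swap
  · refine ⟨AbsoluteValue.trivial, fun x y => ?_, fun x => ?_⟩
    · change (if x + y = 0 then (0 : ℝ) else 1) ≤
        max (if x = 0 then (0 : ℝ) else 1) (if y = 0 then (0 : ℝ) else 1)
      split_ifs <;> simp_all
    · change (if algebraMap K F x = 0 then (0 : ℝ) else 1) = v x
      by_cases hx : x = 0
      · simp [hx]
      · simp [hx, AbsoluteValue.not_isNontrivial_apply hv' hx]
  have hu : IsUltrametricDist (WithAbs v) :=
    IsUltrametricDist.isUltrametricDist_of_forall_norm_add_le_max_norm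
      (fun x y => hv x.ofAbs y.ofAbs)
  -- Over the complete field Ω the spectral norm on an algebraic closure is a multiplicative
  -- ultrametric norm extending the given one. It is pulled back along an embedding of F.
  let Ω := v.Completion
  let ι : K →+* Ω := (UniformSpace.Completion.coeRingHom).comp (WithAbs.equiv v).symm.toRingHom
  have hι : ∀ x, ‖ι x‖ = v x := fun x =>
    (UniformSpace.Completion.norm_coe _).trans (WithAbs.norm_toAbs_eq v x)
  have hΩ : IsUltrametricDist Ω := by
    refine IsUltrametricDist.isUltrametricDist_of_forall_norm_add_le_max_norm fun x y => ?_
    refine UniformSpace.Completion.induction_on₂ x y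
      (isClosed_le (by fun_prop) (by fun_prop)) fun a b => ?_
    rw [← UniformSpace.Completion.coe_add]
    refine (UniformSpace.Completion.norm_coe _).trans_le
      (le_trans ?_ (le_of_eq (congrArg₂ max (UniformSpace.Completion.norm_coe a).symm
        (UniformSpace.Completion.norm_coe b).symm)))
    exact IsUltrametricDist.norm_add_le_max a b
  let nn : NontriviallyNormedField Ω :=
    { (inferInstance : NormedField Ω) with
      non_trivial := by
        obtain ⟨x, hx⟩ := hv'.exists_abv_gt_one
        exact ⟨ι x, by rw [hι]; exact hx⟩ }
  let A := AlgebraicClosure Ω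
  let : Algebra K A := ((algebraMap Ω A).comp ι).toAlgebra
  let σ : F →ₐ[K] A := IsAlgClosed.lift
  let nA : NormedField A := spectralNorm.normedField Ω A
  have hnA : ∀ x : A, ‖x‖ = spectralNorm Ω A x := fun _ => rfl
  refine ⟨⟨⟨fun x => ‖σ x‖, fun x y => ?_⟩, fun x => norm_nonneg _, fun x => ?_, fun x y => ?_⟩,
    fun x y => ?_, fun x => ?_⟩
  · rw [map_mul, norm_mul]
  · change ‖σ x‖ = 0 ↔ x = 0
    rw [norm_eq_zero, map_eq_zero]
  · change ‖σ (x + y)‖ ≤ ‖σ x‖ + ‖σ y‖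
    rw [map_add]; exact norm_add_le _ _
  · change ‖σ (x + y)‖ ≤ max ‖σ x‖ ‖σ y‖
    rw [map_add]
    exact isNonarchimedean_spectralNorm (K := Ω) (L := A) (σ x) (σ y)
  · change ‖σ (algebraMap K F x)‖ = v x
    rw [σ.commutes, hnA]
    exact (spectralNorm_extends (ι x)).trans (hι x)

end Extend

/-! ### From local to global inequalities -/

section LocalGlobal

open NumberField Height AdmissibleAbsValues

lemma hasFiniteMulSupport_iSup {K : Type*} [Field K] [AdmissibleAbsValues K] {ι : Type*} [Finite ι]
    {x : ι → K} (hx : x ≠ 0) :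
    (fun v : nonarchAbsVal (K := K) ↦ ⨆ i, v.val (x i)).HasFiniteMulSupport := by
  have : Nonempty {j // x j ≠ 0} := nonempty_subtype.mpr <| Function.ne_iff.mp hx
  suffices (fun v : nonarchAbsVal (K := K) ↦
      ⨆ i : {j // x j ≠ 0}, v.val (x i)).HasFiniteMulSupport by
    convert! this with v
    obtain ⟨i, hi⟩ : ∃ j, x j ≠ 0 := Function.ne_iff.mp hx
    have : Nonempty ι := .intro i
    refine le_antisymm (ciSup_le fun j ↦ ?_) (ciSup_le fun ⟨j, hj⟩ ↦ Finite.le_ciSup_of_le j le_rfl)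
    rcases eq_or_ne (x j) 0 with h | h
    · rw [h, v.val.map_zero]
      exact Real.iSup_nonneg' ⟨⟨i, hi⟩, v.val.nonneg ..⟩
    · exact Finite.le_ciSup_of_le ⟨j, h⟩ le_rfl
  fun_prop (disch := grind)

lemma iSup_absoluteValue_pos {K : Type*} [Field K] {ι : Type*} [Finite ι]
    (v : AbsoluteValue K ℝ) {x : ι → K} (hx : x ≠ 0) : 0 < ⨆ i, v (x i) := by
  obtain ⟨i, hi⟩ := Function.ne_iff.mp hx
  exact (v.pos hi).trans_le (Finite.le_ciSup (fun i => v (x i)) i)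

lemma logHeight_eq_sum {K : Type*} [Field K] [AdmissibleAbsValues K] {ι : Type*} [Finite ι]
    {x : ι → K} (hx : x ≠ 0) :
    logHeight x = (archAbsVal.map fun v => Real.log (⨆ i, v (x i))).sum +
      ∑ᶠ v : nonarchAbsVal (K := K), Real.log (⨆ i, v.val (x i)) := by
  have H : mulHeight x ≠ 0 := mulHeight_ne_zero x
  rw [logHeight_eq_log_mulHeight]
  rw [mulHeight_eq hx] at H ⊢
  have h1 : Real.log (∏ᶠ v : nonarchAbsVal (K := K), ⨆ i, v.val (x i)) =
      ∑ᶠ v : nonarchAbsVal (K := K), Real.log (⨆ i, v.val (x i)) :=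
    Real.log_finprod (fun v => iSup_absoluteValue_pos v.val hx)
  rw [Real.log_mul (left_ne_zero_of_mul H) (right_ne_zero_of_mul H),
    Real.log_multiset_prod, Multiset.map_map, h1]
  · rfl
  · intro a ha
    obtain ⟨v, -, rfl⟩ := Multiset.mem_map.mp ha
    exact (iSup_absoluteValue_pos v hx).ne'

lemma finite_support_log_iSup {K : Type*} [Field K] [AdmissibleAbsValues K] {ι : Type*} [Finite ι]
    {x : ι → K} (hx : x ≠ 0) :
    (Function.support fun v : nonarchAbsVal (K := K) ↦ Real.log (⨆ i, v.val (x i))).Finite := by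
  refine (hasFiniteMulSupport_iSup hx).subset fun v hv h => hv ?_
  simp only at h ⊢
  rw [h, Real.log_one]

lemma finrank_tower_numberField (K L : Type*) [Field K] [NumberField K] [Field L] [NumberField L]
    [Algebra K L] : Module.finrank ℚ L = Module.finrank ℚ K * Module.finrank K L :=
  (Module.finrank_mul_finrank ℚ K L).symm

/-- The absolute height may be computed in any number field containing the coordinates. -/
lemma absLogHeight_eq {ι : Type*} [Finite ι] (x : ι → Qbar) (K : IntermediateField ℚ Qbar)
    [NumberField K] (hx : ∀ i, x i ∈ K) :
    absLogHeight x = logHeight (K := K) (fun i => ⟨x i, hx i⟩) / (Module.finrank ℚ K : ℝ) := by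
  have hle : coordField x ≤ K := by
    rw [IntermediateField.adjoin_le_iff]
    rintro _ ⟨i, rfl⟩
    exact hx i
  let : Algebra (coordField x) K := (IntermediateField.inclusion hle).toRingHom.toAlgebra
  have h1 := logHeight_algebraMap (K := coordField x) K
    (fun i => ⟨x i, IntermediateField.subset_adjoin ℚ _ (Set.mem_range_self i)⟩)
  have h2 : (fun i => algebraMap (coordField x) K
      ⟨x i, IntermediateField.subset_adjoin ℚ _ (Set.mem_range_self i)⟩) =
      fun i => (⟨x i, hx i⟩ : K) := rfl
  rw [h2] at h1
  rw [h1, absLogHeight, finrank_tower_numberField (coordField x) K]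
  have h3 : (Module.finrank (coordField x) K : ℝ) ≠ 0 := by
    intro h
    have h5 := finrank_tower_numberField (coordField x) K
    rw [Nat.cast_eq_zero.mp h, mul_zero] at h5
    exact (Module.finrank_pos (R := ℚ) (M := K)).ne' h5
  have h4 : (Module.finrank ℚ (coordField x) : ℝ) ≠ 0 := by
    exact_mod_cast Module.finrank_pos.ne'
  push_cast
  field_simp

/-- The absolute values of the algebraic numbers that extend places of number fields, with
`ε = 0` for nonarchimedean ones and `ε = 1` for archimedean ones. -/
def LocalPlace (w : AbsoluteValue Qbar ℝ) (ε : ℕ) : Prop :=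
  (ε = 0 ∧ IsNonarchimedean w) ∨ (ε = 1 ∧ ∃ τ : Qbar →+* ℂ, ∀ x, w x = ‖τ x‖)

/-- The height of the projective point whose coordinates are the elements of a finite set. -/
def setHeight (s : Finset Qbar) : ℝ := absLogHeight fun i : s => i.1

/-- The maximal absolute value of the elements of a finite set. -/
def setSup (w : AbsoluteValue Qbar ℝ) (s : Finset Qbar) : ℝ := ⨆ i : s, w i.1

/-- Take a number field K containing all the sets. Each of its absolute values extends to the
algebraic numbers, so the local hypothesis applies there, and the results are added up. The error
occurs only at archimedean places, whose total weight [K : ℚ] is cancelled by the normalisation. The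
coefficients `c` may have either sign, so that upper and lower bounds are treated alike. -/
theorem setHeight_sum_le {r : ℕ} (s : Fin r → Finset Qbar) (hs : ∀ j, ∃ a ∈ s j, a ≠ 0)
    (c : Fin r → ℝ) (C : ℝ)
    (h : ∀ w ε, LocalPlace w ε → ∑ j, c j * Real.log (setSup w (s j)) ≤ ε * C) :
    ∑ j, c j * setHeight (s j) ≤ C := by
  classical
  let all : Finset Qbar := Finset.univ.biUnion s
  let K : IntermediateField ℚ Qbar := coordField fun i : all => i.1
  have hK : ∀ j, ∀ i : s j, i.1 ∈ K := fun j i =>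
    IntermediateField.subset_adjoin ℚ _ ⟨⟨i.1, Finset.mem_biUnion.mpr ⟨j, Finset.mem_univ _, i.2⟩⟩, rfl⟩
  have : NumberField K := coordField.numberField _
  let x : ∀ j, s j → K := fun j i => ⟨i.1, hK j i⟩
  have hx : ∀ j, x j ≠ 0 := by
    intro j hj
    obtain ⟨a, ha, ha0⟩ := hs j
    exact ha0 (congrArg Subtype.val (congrFun hj ⟨a, ha⟩))
  have hd : (0 : ℝ) < Module.finrank ℚ K := by exact_mod_cast Module.finrank_pos
  have key : ∀ v : AbsoluteValue K ℝ, ∀ (w : AbsoluteValue Qbar ℝ), (∀ y : K, w y = v y) →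
      ∀ j, (⨆ i, v (x j i)) = setSup w (s j) := by
    intro v w hvw j
    exact congrArg iSup (funext fun i => (hvw (x j i)).symm)
  have harch : ∀ v ∈ archAbsVal (K := K), ∑ j, c j * Real.log (⨆ i, v (x j i)) ≤ C := by
    intro v hv
    obtain ⟨φ, hφ⟩ : ∃ φ : K →+* ℂ, ∀ y, v y = ‖φ y‖ := by
      obtain ⟨φ, hφ⟩ := mem_multisetInfinitePlace.mp hv
      exact ⟨φ, fun y => by rw [← hφ]; rfl⟩
    let : Algebra K ℂ := φ.toAlgebra
    let τ : Qbar →ₐ[K] ℂ := IsAlgClosed.lift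
    let w : AbsoluteValue Qbar ℝ := NormedField.toAbsoluteValue ℂ |>.comp τ.toRingHom.injective
    have hw : ∀ y, w y = ‖τ y‖ := fun y => rfl
    have := h w 1 (Or.inr ⟨rfl, τ.toRingHom, fun y => rfl⟩)
    simp only [Nat.cast_one, one_mul] at this
    refine le_trans (le_of_eq (Finset.sum_congr rfl fun j _ => ?_)) this
    rw [key v w]
    intro y
    rw [hw, hφ]
    exact congrArg norm (τ.commutes y)
  have hnon : ∀ v : nonarchAbsVal (K := K), ∑ j, c j * Real.log (⨆ i, v.val (x j i)) ≤ 0 := by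
    intro v
    obtain ⟨w, hw, hwv⟩ := exists_extension_of_isNonarchimedean (F := Qbar) v.val
      (isNonarchimedean v.val v.2)
    have := h w 0 (Or.inl ⟨rfl, hw⟩)
    simp only [Nat.cast_zero, zero_mul] at this
    refine le_trans (le_of_eq (Finset.sum_congr rfl fun j _ => ?_)) this
    rw [key v.val w hwv]
  have e1 : ∀ j, setHeight (s j) = logHeight (x j) / (Module.finrank ℚ K : ℝ) := fun j =>
    absLogHeight_eq _ K (hK j)
  have e2 : ∑ j, c j * setHeight (s j) = (∑ j, c j * logHeight (x j)) / Module.finrank ℚ K := by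
    rw [Finset.sum_div]
    exact Finset.sum_congr rfl fun j _ => by rw [e1, mul_div_assoc]
  rw [e2, div_le_iff₀ hd]
  have e3 : ∑ j, c j * logHeight (x j) =
      (archAbsVal.map fun v => ∑ j, c j * Real.log (⨆ i, v (x j i))).sum +
      ∑ᶠ v : nonarchAbsVal (K := K), ∑ j, c j * Real.log (⨆ i, v.val (x j i)) := by
    have e0 := Multiset.sum_map_sum_map (archAbsVal (K := K)) (Finset.univ : Finset (Fin r)).val
      (f := fun v j => c j * Real.log (⨆ i, v (x j i)))
    change (archAbsVal.map fun v : AbsoluteValue K ℝ =>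
      ∑ j, c j * Real.log (⨆ i, v (x j i))).sum = ∑ j, (archAbsVal.map fun v : AbsoluteValue K ℝ =>
        c j * Real.log (⨆ i, v (x j i))).sum at e0
    rw [finsum_sum_comm Finset.univ, e0, ← Finset.sum_add_distrib]
    · refine Finset.sum_congr rfl fun j _ => ?_
      rw [logHeight_eq_sum (hx j), mul_add, Multiset.sum_map_mul_left, mul_finsum]
    · intro j _
      exact (finite_support_log_iSup (hx j)).subset fun v hv h0 => hv (by simp only at h0 ⊢; rw [h0, mul_zero])
  rw [e3]
  have e4 : (archAbsVal.map fun v : AbsoluteValue K ℝ =>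
      ∑ j, c j * Real.log (⨆ i, v (x j i))).sum ≤ (archAbsVal (K := K)).card • C := by
    refine (Multiset.sum_le_card_nsmul _ C ?_).trans (by rw [Multiset.card_map])
    intro a ha
    obtain ⟨v, hv, rfl⟩ := Multiset.mem_map.mp ha
    exact harch v hv
  have e5 : ∑ᶠ v : nonarchAbsVal (K := K), ∑ j, c j * Real.log (⨆ i, v.val (x j i)) ≤ 0 :=
    by
      have := finsum_nonneg fun v => neg_nonneg.mpr (hnon v)
      rwa [finsum_neg_distrib, neg_nonneg] at this
  have e6 : (archAbsVal (K := K)).card = Module.finrank ℚ K := totalWeight_eq_finrank K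
  rw [e6, nsmul_eq_mul] at e4
  linarith [mul_comm C (Module.finrank ℚ K : ℝ)]

/-- Indexing and repetition do not affect a maximum. With sets in place of tuples, one inequality
can involve vectors, matrices and forms at the same time. -/
lemma absLogHeight_eq_setHeight {ι : Type*} [Fintype ι] [DecidableEq Qbar] (x : ι → Qbar) :
    absLogHeight x = setHeight (Finset.univ.image x) := by
  have : NumberField (coordField x) := coordField.numberField x
  have hm : ∀ i, x i ∈ coordField x := fun i =>
    IntermediateField.subset_adjoin ℚ _ (Set.mem_range_self i)
  have hm' : ∀ a : (Finset.univ.image x : Finset Qbar), a.1 ∈ coordField x := by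
    rintro ⟨a, ha⟩
    obtain ⟨i, -, rfl⟩ := Finset.mem_image.mp ha
    exact hm i
  rw [setHeight, absLogHeight_eq _ (coordField x) hm, absLogHeight_eq _ (coordField x) hm']
  congr 1
  have hc : ∀ a : (Finset.univ.image x : Finset Qbar), ∃ i, x i = a.1 := by
    rintro ⟨a, ha⟩
    obtain ⟨i, -, rfl⟩ := Finset.mem_image.mp ha
    exact ⟨i, rfl⟩
  choose g hg using hc
  apply le_antisymm
  · exact logHeight_comp_le (fun i => (⟨x i, Finset.mem_image_of_mem x (Finset.mem_univ i)⟩ :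
      (Finset.univ.image x : Finset Qbar))) (fun a => (⟨a.1, hm' a⟩ : coordField x))
  · have := logHeight_comp_le g (fun i => (⟨x i, hm i⟩ : coordField x))
    refine le_trans (le_of_eq (congrArg _ (funext fun a => Subtype.ext (hg a).symm))) this

lemma setHeight_nonneg (s : Finset Qbar) : 0 ≤ setHeight s :=
  div_nonneg (logHeight_nonneg _) (Nat.cast_nonneg _)

lemma le_setSup (w : AbsoluteValue Qbar ℝ) {s : Finset Qbar} {a : Qbar} (ha : a ∈ s) :
    w a ≤ setSup w s :=
  Finite.le_ciSup (fun i : s => w i.1) ⟨a, ha⟩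

lemma setSup_le (w : AbsoluteValue Qbar ℝ) {s : Finset Qbar} {B : ℝ} (hB : 0 ≤ B)
    (h : ∀ a ∈ s, w a ≤ B) : setSup w s ≤ B :=
  Real.iSup_le (fun i => h i.1 i.2) hB

lemma setSup_nonneg (w : AbsoluteValue Qbar ℝ) (s : Finset Qbar) : 0 ≤ setSup w s :=
  Real.iSup_nonneg fun i => w.nonneg i.1

lemma setSup_pos (w : AbsoluteValue Qbar ℝ) {s : Finset Qbar} (h : ∃ a ∈ s, a ≠ 0) :
    0 < setSup w s := by
  obtain ⟨a, ha, h0⟩ := h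
  exact (w.pos h0).trans_le (le_setSup w ha)

lemma exists_eq_setSup (w : AbsoluteValue Qbar ℝ) {s : Finset Qbar} (h : s.Nonempty) :
    ∃ a ∈ s, setSup w s = w a := by
  have : Nonempty s := h.to_subtype
  obtain ⟨i, hi⟩ := exists_eq_ciSup_of_finite (f := fun i : s => w i.1)
  exact ⟨i.1, i.2, hi.symm⟩

end LocalGlobal

/-! ### Gauss norms of forms -/

section GaussNorm

open MvPolynomial

variable {m : ℕ} {w : AbsoluteValue Qbar ℝ} {ε : ℕ}

/-- The exponent `ε` merges the ultrametric and the triangle inequality: the number of terms counts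
only at archimedean places. -/
lemma LocalPlace.sum_le (hw : LocalPlace w ε) {α : Type*} (s : Finset α) (f : α → Qbar) {B : ℝ}
    (hB : 0 ≤ B) (h : ∀ a ∈ s, w (f a) ≤ B) : w (∑ a ∈ s, f a) ≤ (s.card : ℝ) ^ ε * B := by
  classical
  rcases hw with ⟨rfl, hw⟩ | ⟨rfl, -⟩
  · rw [pow_zero, one_mul]
    induction s using Finset.induction_on with
    | empty => simpa using hB
    | insert a s ha ih =>
      rw [Finset.sum_insert ha]
      refine (hw _ _).trans (max_le (h a (Finset.mem_insert_self a s)) (ih fun b hb => ?_))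
      exact h b (Finset.mem_insert_of_mem hb)
  · rw [pow_one]
    refine (w.sum_le s f).trans ((Finset.sum_le_card_nsmul s _ B h).trans ?_)
    rw [nsmul_eq_mul]

lemma pow_le_pow_eps {a b : ℝ} (ha : 0 ≤ a) (hab : a ≤ b) (ε : ℕ) : a ^ ε ≤ b ^ ε :=
  pow_le_pow_left₀ ha hab ε

/-- The Gauss norm of a polynomial: the maximal absolute value of its coefficients. -/
def gauss (w : AbsoluteValue Qbar ℝ) (F : MvPolynomial (Fin m) Qbar) : ℝ := setSup w F.coeffs

lemma le_gauss (w : AbsoluteValue Qbar ℝ) (F : MvPolynomial (Fin m) Qbar) (s : Fin m →₀ ℕ) :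
    w (F.coeff s) ≤ gauss w F := by
  by_cases h : F.coeff s = 0
  · rw [h, map_zero]; exact setSup_nonneg _ _
  · exact le_setSup w (mem_coeffs_iff.mpr ⟨s, mem_support_iff.mpr h, rfl⟩)

lemma gauss_le {F : MvPolynomial (Fin m) Qbar} {B : ℝ} (hB : 0 ≤ B)
    (h : ∀ s, w (F.coeff s) ≤ B) : gauss w F ≤ B := by
  refine setSup_le w hB fun a ha => ?_
  obtain ⟨s, -, rfl⟩ := mem_coeffs_iff.mp ha
  exact h s

lemma gauss_nonneg (w : AbsoluteValue Qbar ℝ) (F : MvPolynomial (Fin m) Qbar) : 0 ≤ gauss w F :=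
  setSup_nonneg _ _

lemma exists_mem_coeffs_ne_zero {F : MvPolynomial (Fin m) Qbar} (hF : F ≠ 0) :
    ∃ a ∈ F.coeffs, a ≠ 0 := by
  obtain ⟨s, hs⟩ := ne_zero_iff.mp hF
  exact ⟨_, mem_coeffs_iff.mpr ⟨s, mem_support_iff.mpr hs, rfl⟩, hs⟩

lemma gauss_pos (w : AbsoluteValue Qbar ℝ) {F : MvPolynomial (Fin m) Qbar} (hF : F ≠ 0) :
    0 < gauss w F := setSup_pos w (exists_mem_coeffs_ne_zero hF)

lemma exists_eq_gauss (w : AbsoluteValue Qbar ℝ) {F : MvPolynomial (Fin m) Qbar} (hF : F ≠ 0) :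
    ∃ s, gauss w F = w (F.coeff s) := by
  obtain ⟨a, ha, -⟩ := exists_mem_coeffs_ne_zero hF
  obtain ⟨b, hb, h⟩ := exists_eq_setSup w ⟨a, ha⟩
  obtain ⟨s, -, rfl⟩ := mem_coeffs_iff.mp hb
  exact ⟨s, h⟩

lemma gauss_C_mul (w : AbsoluteValue Qbar ℝ) (c : Qbar) (F : MvPolynomial (Fin m) Qbar) :
    gauss w (C c * F) = w c * gauss w F := by
  by_cases hc : c = 0
  · subst hc
    rw [map_zero, zero_mul, map_zero, zero_mul]
    exact le_antisymm (gauss_le le_rfl fun s => by simp) (gauss_nonneg _ _)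
  have key : ∀ (c : Qbar) (F : MvPolynomial (Fin m) Qbar),
      gauss w (C c * F) ≤ w c * gauss w F := fun c F =>
    gauss_le (mul_nonneg (w.nonneg c) (gauss_nonneg w F)) fun s => by
      rw [coeff_C_mul, map_mul]
      exact mul_le_mul_of_nonneg_left (le_gauss w F s) (w.nonneg c)
  refine le_antisymm (key c F) ?_
  have h1 := key c⁻¹ (C c * F)
  rw [← mul_assoc, ← C_mul, inv_mul_cancel₀ hc, C_1, one_mul, map_inv₀] at h1
  have := mul_le_mul_of_nonneg_left h1 (w.nonneg c)
  rwa [← mul_assoc, mul_inv_cancel₀ (w.ne_zero hc), one_mul] at this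

lemma formHeight_eq (F : MvPolynomial (Fin m) Qbar) : formHeight F = setHeight F.coeffs := by
  classical
  rw [formHeight, absLogHeight_eq_setHeight]
  congr 1
  ext a
  simp only [Finset.mem_image, Finset.mem_univ, true_and, Subtype.exists, mem_coeffs_iff,
    exists_prop, eq_comm]

lemma exponent_le_of_isHomogeneous {R : Type*} [CommSemiring R] {F : MvPolynomial (Fin m) R} {e : ℕ}
    (hF : F.IsHomogeneous e) {s : Fin m →₀ ℕ} (hs : F.coeff s ≠ 0) (i : Fin m) : s i ≤ e := by
  have := hF hs
  rw [Finsupp.weight_apply, Finsupp.sum_fintype _ _ (by simp)] at this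
  rw [← this]
  simpa using Finset.single_le_sum (f := fun i => s i) (fun _ _ => Nat.zero_le _) (Finset.mem_univ i)

lemma sum_exponent_of_isHomogeneous {R : Type*} [CommSemiring R] {F : MvPolynomial (Fin m) R}
    {e : ℕ} (hF : F.IsHomogeneous e) {s : Fin m →₀ ℕ} (hs : F.coeff s ≠ 0) : ∑ i, s i = e := by
  have := hF hs
  rw [Finsupp.weight_apply, Finsupp.sum_fintype _ _ (by simp)] at this
  simpa using this

lemma card_support_le {R : Type*} [CommSemiring R] {F : MvPolynomial (Fin m) R} {e : ℕ}
    (hF : F.IsHomogeneous e) : F.support.card ≤ (e + 1) ^ m := by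
  classical
  have : F.support.card ≤ (Finset.univ : Finset (Fin m → Fin (e + 1))).card := by
    refine Finset.card_le_card_of_injOn
      (fun s i => (⟨min (s i) e, Nat.lt_succ_of_le (min_le_right _ _)⟩ : Fin (e + 1)))
      (fun _ _ => Finset.mem_coe.mpr (Finset.mem_univ _)) ?_
    intro s hs t ht h
    ext i
    have h1 := congrArg Fin.val (congrFun h i)
    simp only at h1
    rwa [min_eq_left (exponent_le_of_isHomogeneous hF (mem_support_iff.mp hs) i),
      min_eq_left (exponent_le_of_isHomogeneous hF (mem_support_iff.mp ht) i)] at h1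
  simpa using this

lemma eval_le (hw : LocalPlace w ε) {F : MvPolynomial (Fin m) Qbar} {e : ℕ}
    (hF : F.IsHomogeneous e) {x : Fin m → Qbar} {R : ℝ} (hR : 0 ≤ R) (hx : ∀ i, w (x i) ≤ R) :
    w (eval x F) ≤ (((e + 1 : ℕ) : ℝ) ^ m) ^ ε * (gauss w F * R ^ e) := by
  rw [eval_eq']
  have hB : 0 ≤ gauss w F * R ^ e := mul_nonneg (gauss_nonneg w F) (pow_nonneg hR e)
  refine (hw.sum_le F.support _ hB fun s hs => ?_).trans ?_
  · rw [map_mul, map_prod]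
    refine mul_le_mul (le_gauss w F s) ?_ (Finset.prod_nonneg fun i _ => w.nonneg _)
      (gauss_nonneg w F)
    rw [← sum_exponent_of_isHomogeneous hF (mem_support_iff.mp hs), ← Finset.prod_pow_eq_pow_sum]
    refine Finset.prod_le_prod (fun i _ => w.nonneg _) fun i _ => ?_
    rw [map_pow]
    exact pow_le_pow_left₀ (w.nonneg _) (hx i) _
  · refine mul_le_mul_of_nonneg_right (pow_le_pow_eps (Nat.cast_nonneg _) ?_ ε) hB
    exact_mod_cast card_support_le hF

lemma gauss_mul_le_card (hw : LocalPlace w ε) (F G : MvPolynomial (Fin m) Qbar) :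
    gauss w (F * G) ≤ (F.support.card : ℝ) ^ ε * (gauss w F * gauss w G) := by
  have hB : 0 ≤ gauss w F * gauss w G := mul_nonneg (gauss_nonneg w F) (gauss_nonneg w G)
  refine gauss_le (mul_nonneg (pow_nonneg (Nat.cast_nonneg _) _) hB) fun t => ?_
  have : (F * G).coeff t = ∑ s ∈ F.support, (monomial s (F.coeff s) * G).coeff t := by
    conv_lhs => rw [F.as_sum, Finset.sum_mul, coeff_sum]
  rw [this]
  refine hw.sum_le _ _ hB fun s _ => ?_
  rw [coeff_monomial_mul']
  split_ifs
  · rw [map_mul]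
    exact mul_le_mul (le_gauss w F _) (le_gauss w G _) (w.nonneg _) (gauss_nonneg w F)
  · rw [map_zero]; exact hB

lemma gauss_mul_le (hw : LocalPlace w ε) {F : MvPolynomial (Fin m) Qbar} {e : ℕ}
    (hF : F.IsHomogeneous e) (G : MvPolynomial (Fin m) Qbar) :
    gauss w (F * G) ≤ (((e + 1 : ℕ) : ℝ) ^ m) ^ ε * (gauss w F * gauss w G) := by
  refine (gauss_mul_le_card hw F G).trans (mul_le_mul_of_nonneg_right
    (pow_le_pow_eps (Nat.cast_nonneg _) ?_ ε) (mul_nonneg (gauss_nonneg w F) (gauss_nonneg w G)))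
  exact_mod_cast card_support_le hF

/-- Gauss's lemma. -/
lemma gauss_mul_of_isNonarchimedean (hw : IsNonarchimedean w) {F G : MvPolynomial (Fin m) Qbar}
    (hF : F ≠ 0) (hG : G ≠ 0) : gauss w F * gauss w G ≤ gauss w (F * G) := by
  classical
  let o : MonomialOrder (Fin m) := MonomialOrder.lex
  -- Among the monomials of maximal absolute value take the lexicographically largest. For these
  -- choices `i` and `j` in the two factors, the coefficient of the product at `i + j` has a single
  -- dominant term.
  have key : ∀ {F : MvPolynomial (Fin m) Qbar}, F ≠ 0 → ∃ i, w (F.coeff i) = gauss w F ∧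
      ∀ j, o.toSyn i < o.toSyn j → w (F.coeff j) < gauss w F := by
    intro F hF
    obtain ⟨s, hs⟩ := exists_eq_gauss w hF
    have hpos := gauss_pos w hF
    obtain ⟨i, hi, hmax⟩ := (F.support.filter fun t => w (F.coeff t) = gauss w F).exists_max_image
      o.toSyn ⟨s, Finset.mem_filter.mpr ⟨mem_support_iff.mpr fun h => by
        rw [hs, h, map_zero] at hpos; exact lt_irrefl _ hpos, hs.symm⟩⟩
    refine ⟨i, (Finset.mem_filter.mp hi).2, fun j hj => lt_of_le_of_ne (le_gauss w F j) fun h => ?_⟩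
    refine absurd (hmax j (Finset.mem_filter.mpr ⟨mem_support_iff.mpr fun h0 => ?_, h⟩))
      (not_le.mpr hj)
    rw [← h, h0, map_zero] at hpos
    exact lt_irrefl _ hpos
  obtain ⟨i, hi, hi'⟩ := key hF
  obtain ⟨j, hj, hj'⟩ := key hG
  have hdom : ∀ p ∈ Finset.HasAntidiagonal.antidiagonal (i + j), p ≠ (i, j) →
      w (F.coeff p.1 * G.coeff p.2) < w (F.coeff i * G.coeff j) := by
    rintro ⟨p, q⟩ hpq hne
    rw [Finset.HasAntidiagonal.mem_antidiagonal] at hpq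
    simp only at hpq
    rw [map_mul, map_mul, hi, hj]
    rcases lt_trichotomy (o.toSyn i) (o.toSyn p) with h | h | h
    · exact mul_lt_mul_of_lt_of_le_of_nonneg_of_pos (hi' p h) (le_gauss w G q) (w.nonneg _)
        (gauss_pos w hG)
    · have hip : i = p := o.toSyn.injective h
      subst hip
      exact (hne (Prod.ext rfl (add_left_cancel hpq))).elim
    · have : o.toSyn j < o.toSyn q := by
        by_contra hq
        have h1 := add_lt_add_of_lt_of_le h (not_lt.mp hq)
        rw [← map_add, ← map_add, hpq] at h1
        exact lt_irrefl _ h1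
      exact mul_lt_mul_of_le_of_lt_of_nonneg_of_pos (le_gauss w F p) (hj' q this) (w.nonneg _)
        (gauss_pos w hF)
  have h1 := IsNonarchimedean.apply_sum_eq_of_lt hw (fun a => (w.map_neg a).symm)
    (s := Finset.HasAntidiagonal.antidiagonal (i + j))
    (k := (i, j)) (l := fun p => F.coeff p.1 * G.coeff p.2)
    (Finset.HasAntidiagonal.mem_antidiagonal.mpr rfl) hdom
  rw [← coeff_mul, map_mul, hi, hj] at h1
  rw [← h1]
  exact le_gauss w _ _

/-- The coefficients of a form are bounded by its values at tuples of roots of unity. -/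
lemma exists_gauss_le_eval (hw : LocalPlace w ε) {F : MvPolynomial (Fin m) Qbar} {e : ℕ}
    (hF : F.IsHomogeneous e) (hF0 : F ≠ 0) :
    ∃ x : Fin m → Qbar, (∀ i, w (x i) ≤ 1) ∧
      gauss w F ≤ (((e + 2 : ℕ) : ℝ) ^ m) ^ ε * w (eval x F) := by
  classical
  -- The order `D` must exceed `e`, so that exponents are distinguished modulo `D`, and must not be
  -- small at `w`, since the inversion formula divides by its power. At an ultrametric place `e + 1`
  -- and `e + 2` cannot both be small, because they differ by 1.
  obtain ⟨D, hDe, hDe', hwD⟩ : ∃ D : ℕ, e < D ∧ D ≤ e + 2 ∧ 1 ≤ w (D : Qbar) := by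
    rcases hw with ⟨-, hw⟩ | ⟨-, τ, hτ⟩
    · by_contra! hcon
      have h1 := hcon (e + 1) (by omega) (by omega)
      have h2 := hcon (e + 2) (by omega) (by omega)
      have h3 := hw ((e + 2 : ℕ) : Qbar) (-((e + 1 : ℕ) : Qbar))
      rw [w.map_neg] at h3
      have h4 : ((e + 2 : ℕ) : Qbar) + (-((e + 1 : ℕ) : Qbar)) = 1 := by push_cast; ring
      rw [h4, map_one] at h3
      exact absurd (h3.trans_lt (max_lt h2 h1)) (lt_irrefl _)
    · refine ⟨e + 1, by omega, by omega, ?_⟩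
      rw [hτ, map_natCast, Complex.norm_natCast]
      exact_mod_cast Nat.le_add_left 1 e
  have hD0 : D ≠ 0 := by omega
  have : NeZero D := ⟨hD0⟩
  obtain ⟨ζ, hζ⟩ := HasEnoughRootsOfUnity.exists_primitiveRoot Qbar D
  have hζ0 : ζ ≠ 0 := hζ.ne_zero hD0
  have hwζ : w ζ = 1 := by
    have : w ζ ^ D = 1 := by rw [← map_pow, hζ.pow_eq_one, map_one]
    exact (pow_eq_one_iff_of_nonneg (w.nonneg _) hD0).mp this
  obtain ⟨t, ht⟩ := exists_eq_gauss w hF0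
  have ht0 : F.coeff t ≠ 0 := fun h => by
    have := gauss_pos w hF0
    rw [ht, h, map_zero] at this
    exact lt_irrefl _ this
  let pt : (Fin m → Fin D) → Fin m → Qbar := fun j i => ζ ^ (j i : ℕ)
  -- Discrete Fourier inversion: averaging the values of the form against a character isolates its
  -- coefficient at `t`.
  have hsum : ∑ j : Fin m → Fin D, eval (pt j) F * ∏ i, (ζ⁻¹) ^ ((j i : ℕ) * t i) =
      (D : Qbar) ^ m * F.coeff t := by
    have h1 : ∀ j : Fin m → Fin D, eval (pt j) F * ∏ i, (ζ⁻¹) ^ ((j i : ℕ) * t i) =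
        ∑ s ∈ F.support, F.coeff s * ∏ i, (ζ ^ s i * (ζ⁻¹) ^ t i) ^ (j i : ℕ) := by
      intro j
      rw [eval_eq', Finset.sum_mul]
      refine Finset.sum_congr rfl fun s _ => ?_
      rw [mul_assoc, ← Finset.prod_mul_distrib]
      congr 1
      refine Finset.prod_congr rfl fun i _ => ?_
      simp only [pt]
      rw [mul_pow, ← pow_mul, ← pow_mul, ← pow_mul, mul_comm (s i), mul_comm (t i)]
    rw [Finset.sum_congr rfl fun j _ => h1 j, Finset.sum_comm]
    have h2 : ∀ s ∈ F.support, ∑ j : Fin m → Fin D,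
        F.coeff s * ∏ i, (ζ ^ s i * (ζ⁻¹) ^ t i) ^ (j i : ℕ) =
        if s = t then (D : Qbar) ^ m * F.coeff t else 0 := by
      intro s hs
      rw [← Finset.mul_sum, ← Fintype.prod_sum (fun i (a : Fin D) =>
        (ζ ^ s i * (ζ⁻¹) ^ t i) ^ (a : ℕ))]
      split_ifs with hst
      · subst hst
        rw [Finset.prod_congr rfl (g := fun _ => (D : Qbar))]
        · rw [Finset.prod_const, Finset.card_univ, Fintype.card_fin, mul_comm]
        · intro i _
          rw [← mul_pow, mul_inv_cancel₀ hζ0]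
          simp
      · obtain ⟨i, hi⟩ : ∃ i, s i ≠ t i := by
          by_contra! hcon
          exact hst (Finsupp.ext hcon)
        rw [Finset.prod_eq_zero (Finset.mem_univ i), mul_zero]
        rw [Fin.sum_univ_eq_sum_range (fun a => (ζ ^ s i * (ζ⁻¹) ^ t i) ^ a) D]
        have hne : ζ ^ s i * (ζ⁻¹) ^ t i ≠ 1 := by
          intro h
          rw [inv_pow, mul_inv_eq_one₀ (pow_ne_zero _ hζ0)] at h
          exact hi (hζ.pow_inj
            ((exponent_le_of_isHomogeneous hF (mem_support_iff.mp hs) i).trans_lt hDe)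
            ((exponent_le_of_isHomogeneous hF ht0 i).trans_lt hDe) h)
        have h3 := mul_geom_sum (ζ ^ s i * (ζ⁻¹) ^ t i) D
        have h4 : (ζ ^ s i * (ζ⁻¹) ^ t i) ^ D = 1 := by
          rw [mul_pow, ← pow_mul, ← pow_mul, mul_comm (s i), mul_comm (t i), pow_mul, pow_mul,
            inv_pow, hζ.pow_eq_one]
          simp
        rw [h4, sub_self] at h3
        exact (mul_eq_zero.mp h3).resolve_left (sub_ne_zero.mpr hne)
    rw [Finset.sum_congr rfl h2, Finset.sum_ite_eq' F.support t, if_pos (mem_support_iff.mpr ht0)]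
  obtain ⟨j, -, hj⟩ := (Finset.univ : Finset (Fin m → Fin D)).exists_max_image
    (fun j => w (eval (pt j) F)) ⟨fun _ => ⟨0, Nat.pos_of_ne_zero hD0⟩, Finset.mem_univ _⟩
  refine ⟨pt j, fun i => ?_, ?_⟩
  · simp only [pt]
    rw [map_pow, hwζ, one_pow]
  · have h1 := hw.sum_le Finset.univ (fun j : Fin m → Fin D =>
      eval (pt j) F * ∏ i, (ζ⁻¹) ^ ((j i : ℕ) * t i)) (w.nonneg (eval (pt j) F)) (by
        intro j' hj'
        rw [map_mul, map_prod]
        simp only [map_pow, map_inv₀, hwζ, inv_one, one_pow, Finset.prod_const_one, mul_one]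
        exact hj j' hj')
    rw [hsum, map_mul, map_pow, ← ht] at h1
    have h2 : gauss w F ≤ w (D : Qbar) ^ m * gauss w F :=
      le_mul_of_one_le_left (gauss_nonneg _ _) (one_le_pow₀ hwD)
    refine (h2.trans h1).trans (mul_le_mul_of_nonneg_right
      (pow_le_pow_eps (Nat.cast_nonneg _) ?_ ε) (w.nonneg _))
    rw [Finset.card_univ, Fintype.card_fun, Fintype.card_fin, Fintype.card_fin]
    push_cast
    exact pow_le_pow_left₀ (Nat.cast_nonneg _) (by exact_mod_cast hDe') m

end GaussNorm

/-! ### Gelfond's inequality and logarithmic Gauss norms -/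

section Gelfond

open MvPolynomial

variable {m : ℕ} {w : AbsoluteValue Qbar ℝ} {ε : ℕ}

lemma mahlerMeasure_le_one {p : Polynomial ℂ} (h : ∀ z : ℂ, ‖z‖ = 1 → ‖p.eval z‖ ≤ 1) :
    p.mahlerMeasure ≤ 1 := by
  by_cases hp : p = 0
  · rw [hp, Polynomial.mahlerMeasure_zero]; exact zero_le_one
  rw [Polynomial.mahlerMeasure_def_of_ne_zero hp, Real.exp_le_one_iff]
  change Real.circleAverage (fun x => Real.log ‖p.eval x‖) 0 1 ≤ 0
  refine Real.circleAverage_mono_on_of_le_circle ?_ fun z hz => ?_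
  · rw [circleIntegrable_def]; exact p.intervalIntegrable_mahlerMeasure
  · refine Real.log_nonpos (norm_nonneg _) (h z ?_)
    simpa using hz

/-- Reduces by scaling to the bound 1; the slack `δ` covers the case `B = 0`. -/
lemma mahlerMeasure_le {p : Polynomial ℂ} {B : ℝ} (hB : 0 ≤ B)
    (h : ∀ z : ℂ, ‖z‖ = 1 → ‖p.eval z‖ ≤ B) : p.mahlerMeasure ≤ B := by
  refine le_of_forall_pos_le_add fun δ hδ => ?_
  have hB' : 0 < B + δ := by linarith
  have h1 : (Polynomial.C (((B + δ)⁻¹ : ℝ) : ℂ) * p).mahlerMeasure ≤ 1 := by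
    refine mahlerMeasure_le_one fun z hz => ?_
    rw [Polynomial.eval_mul, Polynomial.eval_C, norm_mul, Complex.norm_real, Real.norm_eq_abs,
      abs_of_pos (inv_pos.mpr hB'), inv_mul_le_iff₀ hB', mul_one]
    exact (h z hz).trans (by linarith)
  rw [Polynomial.mahlerMeasure_mul, Polynomial.mahlerMeasure_const, Complex.norm_real,
    Real.norm_eq_abs, abs_of_pos (inv_pos.mpr hB'), inv_mul_le_iff₀ hB', mul_one] at h1
  exact h1

/-- The restriction of a polynomial to the complex line through two points. -/
def lineRestrict (τ : Qbar →+* ℂ) (x y : Fin m → Qbar) :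
    MvPolynomial (Fin m) Qbar →+* Polynomial ℂ :=
  eval₂Hom (Polynomial.C.comp τ)
    (fun i => Polynomial.C (τ (x i)) + Polynomial.X * Polynomial.C (τ (y i) - τ (x i)))

lemma eval_lineRestrict (τ : Qbar →+* ℂ) (x y : Fin m → Qbar) (F : MvPolynomial (Fin m) Qbar)
    (z : ℂ) : (lineRestrict τ x y F).eval z =
      eval₂ τ (fun i => τ (x i) + z * (τ (y i) - τ (x i))) F := by
  rw [lineRestrict, coe_eval₂Hom, ← Polynomial.coe_evalRingHom, hom_eval₂]
  congr 1
  · ext; simp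
  · ext; simp

lemma natDegree_lineRestrict_le (τ : Qbar →+* ℂ) (x y : Fin m → Qbar)
    {F : MvPolynomial (Fin m) Qbar} {e : ℕ} (hF : F.IsHomogeneous e) :
    (lineRestrict τ x y F).natDegree ≤ e := by
  rw [lineRestrict, coe_eval₂Hom, eval₂_eq']
  refine Polynomial.natDegree_sum_le_of_forall_le _ _ fun s hs => ?_
  refine (Polynomial.natDegree_C_mul_le _ _).trans ((Polynomial.natDegree_prod_le _ _).trans ?_)
  rw [← sum_exponent_of_isHomogeneous hF (mem_support_iff.mp hs)]
  refine Finset.sum_le_sum fun i _ =>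
    Polynomial.natDegree_pow_le.trans ((Nat.mul_le_mul_left (s i) (m := 1) ?_).trans (mul_one _).le)
  compute_degree

lemma norm_eval₂_le {τ : Qbar →+* ℂ} (hτ : ∀ a, w a = ‖τ a‖) {F : MvPolynomial (Fin m) Qbar}
    {e : ℕ} (hF : F.IsHomogeneous e) {x : Fin m → ℂ} {R : ℝ} (hR : 0 ≤ R) (hx : ∀ i, ‖x i‖ ≤ R) :
    ‖eval₂ τ x F‖ ≤ ((e + 1 : ℕ) : ℝ) ^ m * (gauss w F * R ^ e) := by
  rw [eval₂_eq']
  have hB : 0 ≤ gauss w F * R ^ e := mul_nonneg (gauss_nonneg w F) (pow_nonneg hR e)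
  refine (norm_sum_le_of_le (f := fun s => τ (coeff s F) * ∏ i, x i ^ s i)
    (n := fun _ => gauss w F * R ^ e) _ fun s hs => ?_).trans ?_
  · rw [norm_mul, norm_prod, ← hτ]
    refine mul_le_mul (le_gauss w F s) ?_ (Finset.prod_nonneg fun i _ => norm_nonneg _)
      (gauss_nonneg w F)
    rw [← sum_exponent_of_isHomogeneous hF (mem_support_iff.mp hs), ← Finset.prod_pow_eq_pow_sum]
    refine Finset.prod_le_prod (fun i _ => norm_nonneg _) fun i _ => ?_
    rw [norm_pow]
    exact pow_le_pow_left₀ (norm_nonneg _) (hx i) _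
  · rw [Finset.sum_const, nsmul_eq_mul]
    refine mul_le_mul_of_nonneg_right ?_ hB
    exact_mod_cast card_support_le hF

/-- Choose points x and y of the unit polydisc at which F and G nearly attain their Gauss norms, and
restrict both forms to the complex line through x and y. The Mahler measure is multiplicative there.
It controls F(x), the value at parameter 0, and up to 2^e' also G(y), the value at parameter 1. The
measure of the product is at most its supremum over the unit circle, where the coordinates on the
line are bounded by 3. -/
lemma gauss_mul_ge_of_embedding {τ : Qbar →+* ℂ} (hτ : ∀ a, w a = ‖τ a‖)
    {F G : MvPolynomial (Fin m) Qbar} {e e' : ℕ} (hF : F.IsHomogeneous e) (hG : G.IsHomogeneous e')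
    (hF0 : F ≠ 0) (hG0 : G ≠ 0) :
    gauss w F * gauss w G ≤ (((e + 2 : ℕ) : ℝ) ^ m * (((e' + 2 : ℕ) : ℝ) ^ m * 2 ^ e')) *
      ((((e + e' + 1 : ℕ) : ℝ) ^ m) * 3 ^ (e + e')) * gauss w (F * G) := by
  have hw : LocalPlace w 1 := Or.inr ⟨rfl, τ, hτ⟩
  obtain ⟨x, hx, hFx⟩ := exists_gauss_le_eval hw hF hF0
  obtain ⟨y, hy, hGy⟩ := exists_gauss_le_eval hw hG hG0
  rw [pow_one, hτ] at hFx hGy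
  have h0 : τ (eval x F) = (lineRestrict τ x y F).eval 0 := by
    rw [eval_lineRestrict]
    simp only [zero_mul, add_zero]
    rw [← eval₂_id, hom_eval₂]
    rfl
  have h1 : τ (eval y G) = (lineRestrict τ x y G).eval 1 := by
    rw [eval_lineRestrict]
    simp only [one_mul, add_sub_cancel]
    rw [← eval₂_id, hom_eval₂]
    rfl
  have hf : ‖τ (eval x F)‖ ≤ (lineRestrict τ x y F).mahlerMeasure := by
    rw [h0, ← Polynomial.coeff_zero_eq_eval_zero]
    refine (Polynomial.norm_coeff_le_choose_mul_mahlerMeasure 0 _).trans ?_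
    simp
  have hg : ‖τ (eval y G)‖ ≤ 2 ^ e' * (lineRestrict τ x y G).mahlerMeasure := by
    rw [h1, Polynomial.eval_eq_sum_range]
    simp only [one_pow, mul_one]
    refine (norm_sum_le_of_le _ fun i _ =>
      Polynomial.norm_coeff_le_choose_mul_mahlerMeasure i _).trans ?_
    rw [← Finset.sum_mul]
    refine mul_le_mul_of_nonneg_right ?_ (Polynomial.mahlerMeasure_nonneg _)
    have := Nat.sum_range_choose (lineRestrict τ x y G).natDegree
    have h2 : ∑ i ∈ Finset.range ((lineRestrict τ x y G).natDegree + 1),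
        (((lineRestrict τ x y G).natDegree.choose i : ℕ) : ℝ) =
        2 ^ (lineRestrict τ x y G).natDegree := by exact_mod_cast this
    rw [h2]
    exact pow_le_pow_right₀ (by norm_num) (natDegree_lineRestrict_le τ x y hG)
  have hfg : (lineRestrict τ x y F).mahlerMeasure * (lineRestrict τ x y G).mahlerMeasure ≤
      ((e + e' + 1 : ℕ) : ℝ) ^ m * (gauss w (F * G) * 3 ^ (e + e')) := by
    rw [← Polynomial.mahlerMeasure_mul, ← map_mul]
    refine mahlerMeasure_le (mul_nonneg (pow_nonneg (Nat.cast_nonneg _) _)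
      (mul_nonneg (gauss_nonneg _ _) (by positivity))) fun z hz => ?_
    rw [eval_lineRestrict]
    refine norm_eval₂_le hτ (hF.mul hG) (by norm_num) fun i => ?_
    have a1 : ‖τ (x i)‖ ≤ 1 := by rw [← hτ]; exact hx i
    have a2 : ‖τ (y i)‖ ≤ 1 := by rw [← hτ]; exact hy i
    calc ‖τ (x i) + z * (τ (y i) - τ (x i))‖ ≤ ‖τ (x i)‖ + ‖z‖ * (‖τ (y i)‖ + ‖τ (x i)‖) := by
          refine (norm_add_le _ _).trans (add_le_add_right ?_ _)
          rw [norm_mul]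
          exact mul_le_mul_of_nonneg_left (norm_sub_le _ _) (norm_nonneg _)
      _ ≤ 3 := by rw [hz]; linarith
  have hM := Polynomial.mahlerMeasure_nonneg (lineRestrict τ x y F)
  calc gauss w F * gauss w G
      ≤ (((e + 2 : ℕ) : ℝ) ^ m * (lineRestrict τ x y F).mahlerMeasure) *
        (((e' + 2 : ℕ) : ℝ) ^ m * (2 ^ e' * (lineRestrict τ x y G).mahlerMeasure)) := by
        refine mul_le_mul (hFx.trans ?_) (hGy.trans ?_) (gauss_nonneg _ _)
          (mul_nonneg (by positivity) hM)
        · exact mul_le_mul_of_nonneg_left hf (by positivity)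
        · exact mul_le_mul_of_nonneg_left hg (by positivity)
    _ = (((e + 2 : ℕ) : ℝ) ^ m * (((e' + 2 : ℕ) : ℝ) ^ m * 2 ^ e')) *
        ((lineRestrict τ x y F).mahlerMeasure * (lineRestrict τ x y G).mahlerMeasure) := by ring
    _ ≤ (((e + 2 : ℕ) : ℝ) ^ m * (((e' + 2 : ℕ) : ℝ) ^ m * 2 ^ e')) *
        (((e + e' + 1 : ℕ) : ℝ) ^ m * (gauss w (F * G) * 3 ^ (e + e'))) :=
        mul_le_mul_of_nonneg_left hfg (by positivity)
    _ = _ := by ring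

/-- The logarithm of the Gauss norm. -/
def lg (w : AbsoluteValue Qbar ℝ) (F : MvPolynomial (Fin m) Qbar) : ℝ := Real.log (gauss w F)

lemma gauss_one (w : AbsoluteValue Qbar ℝ) : gauss w (1 : MvPolynomial (Fin m) Qbar) = 1 := by
  classical
  refine le_antisymm (gauss_le zero_le_one fun s => ?_) ?_
  · rw [coeff_one]
    split_ifs <;> simp
  · have := le_gauss w (1 : MvPolynomial (Fin m) Qbar) 0
    simpa using this

/-- From log n ≤ n - 1. It turns the numbers of monomials into errors linear in the degree. -/
lemma log_card_pow_le (n k m ε : ℕ) (hk : n ≤ k + 1) :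
    Real.log (((n : ℝ) ^ m) ^ ε) ≤ ε * (m * k) := by
  rw [Real.log_pow, Real.log_pow]
  refine mul_le_mul_of_nonneg_left (mul_le_mul_of_nonneg_left ?_ (Nat.cast_nonneg m))
    (Nat.cast_nonneg ε)
  rcases Nat.eq_zero_or_pos n with rfl | hn
  · simp
  · have h1 := Real.log_le_sub_one_of_pos (x := (n : ℝ)) (by exact_mod_cast hn)
    have h2 : (n : ℝ) ≤ k + 1 := by exact_mod_cast hk
    linarith

/-- The constant, depending on the number of variables, in the inequalities for Gauss norms. -/
def kap (m : ℕ) : ℝ := 2 * m + 3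

lemma kap_pos (m : ℕ) : 0 < kap m := by unfold kap; positivity

lemma lg_mul_le (hw : LocalPlace w ε) {F G : MvPolynomial (Fin m) Qbar} {e : ℕ}
    (hF : F.IsHomogeneous e) (hF0 : F ≠ 0) (hG0 : G ≠ 0) :
    lg w (F * G) ≤ lg w F + lg w G + ε * (kap m * e) := by
  have h1 := Real.log_le_log (gauss_pos w (mul_ne_zero hF0 hG0)) (gauss_mul_le hw hF G)
  rw [Real.log_mul (by positivity) (mul_pos (gauss_pos w hF0) (gauss_pos w hG0)).ne',
    Real.log_mul (gauss_pos w hF0).ne' (gauss_pos w hG0).ne'] at h1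
  have h2 := log_card_pow_le (e + 1) e m ε le_rfl
  have h3 : (ε : ℝ) * (m * e) ≤ ε * (kap m * e) := by
    unfold kap; gcongr; linarith [Nat.cast_nonneg (α := ℝ) m]
  unfold lg
  linarith

/-- Gauss's lemma at ultrametric places, Gelfond's inequality at archimedean ones. An error linear
in the degrees remains summable after the normalisation of canonical heights. -/
lemma le_lg_mul (hw : LocalPlace w ε) {F G : MvPolynomial (Fin m) Qbar} {e e' : ℕ}
    (hF : F.IsHomogeneous e) (hG : G.IsHomogeneous e') (hF0 : F ≠ 0) (hG0 : G ≠ 0) :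
    lg w F + lg w G ≤ lg w (F * G) + ε * (kap m * (e + e' + 1)) := by
  unfold lg
  rw [← Real.log_mul (gauss_pos w hF0).ne' (gauss_pos w hG0).ne']
  have hpos := mul_pos (gauss_pos w hF0) (gauss_pos w hG0)
  rcases hw with ⟨rfl, hw⟩ | ⟨rfl, τ, hτ⟩
  · simpa using Real.log_le_log hpos (gauss_mul_of_isNonarchimedean hw hF0 hG0)
  · have h1 := Real.log_le_log hpos (gauss_mul_ge_of_embedding hτ hF hG hF0 hG0)
    have b1 : (0 : ℝ) < ((e + 2 : ℕ) : ℝ) ^ m := by positivity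
    have b2 : (0 : ℝ) < ((e' + 2 : ℕ) : ℝ) ^ m := by positivity
    have b3 : (0 : ℝ) < ((e + e' + 1 : ℕ) : ℝ) ^ m := by positivity
    have b4 : (0 : ℝ) < 2 ^ e' := by positivity
    have b5 : (0 : ℝ) < 3 ^ (e + e') := by positivity
    rw [Real.log_mul (mul_pos (mul_pos b1 (mul_pos b2 b4)) (mul_pos b3 b5)).ne'
      (gauss_pos w (mul_ne_zero hF0 hG0)).ne',
      Real.log_mul (mul_pos b1 (mul_pos b2 b4)).ne' (mul_pos b3 b5).ne',
      Real.log_mul b1.ne' (mul_pos b2 b4).ne', Real.log_mul b2.ne' b4.ne',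
      Real.log_mul b3.ne' b5.ne'] at h1
    have a1 := log_card_pow_le (e + 2) (e + 1) m 1 le_rfl
    have a2 := log_card_pow_le (e' + 2) (e' + 1) m 1 le_rfl
    have a3 := log_card_pow_le (e + e' + 1) (e + e') m 1 le_rfl
    have a4 := log_card_pow_le 2 1 e' 1 le_rfl
    have a5 := log_card_pow_le 3 2 (e + e') 1 le_rfl
    simp only [pow_one] at a1 a2 a3 a4 a5
    push_cast at *
    unfold kap
    nlinarith [Nat.cast_nonneg (α := ℝ) m, Nat.cast_nonneg (α := ℝ) e, Nat.cast_nonneg (α := ℝ) e']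

lemma lg_prod_le (hw : LocalPlace w ε) {ι : Type*} (s : Finset ι)
    (F : ι → MvPolynomial (Fin m) Qbar) {e : ℕ} (hF : ∀ i ∈ s, (F i).IsHomogeneous e)
    (hF0 : ∀ i ∈ s, F i ≠ 0) :
    lg w (∏ i ∈ s, F i) ≤ ∑ i ∈ s, lg w (F i) + ε * (kap m * (s.card * e)) := by
  classical
  induction s using Finset.induction_on with
  | empty => simp [lg, gauss_one]
  | insert a s ha ih =>
    rw [Finset.prod_insert ha, Finset.sum_insert ha, Finset.card_insert_of_notMem ha]
    have h1 := ih (fun i hi => hF i (Finset.mem_insert_of_mem hi))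
      fun i hi => hF0 i (Finset.mem_insert_of_mem hi)
    have h2 := lg_mul_le hw (hF a (Finset.mem_insert_self a s)) (hF0 a (Finset.mem_insert_self a s))
      (Finset.prod_ne_zero_iff.mpr fun i hi => hF0 i (Finset.mem_insert_of_mem hi))
    push_cast
    linarith

/-- The error is quadratic in the number of factors, which is harmless for norms: they always have
dⁿ factors. -/
lemma le_lg_prod (hw : LocalPlace w ε) {ι : Type*} (s : Finset ι)
    (F : ι → MvPolynomial (Fin m) Qbar) {e : ℕ} (hF : ∀ i ∈ s, (F i).IsHomogeneous e)
    (hF0 : ∀ i ∈ s, F i ≠ 0) :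
    ∑ i ∈ s, lg w (F i) ≤ lg w (∏ i ∈ s, F i) + ε * (kap m * (s.card ^ 2 * (e + 1))) := by
  classical
  induction s using Finset.induction_on with
  | empty => simp [lg, gauss_one]
  | insert a s ha ih =>
    rw [Finset.prod_insert ha, Finset.sum_insert ha, Finset.card_insert_of_notMem ha]
    have h1 := ih (fun i hi => hF i (Finset.mem_insert_of_mem hi))
      fun i hi => hF0 i (Finset.mem_insert_of_mem hi)
    have h3 : (∏ i ∈ s, F i).IsHomogeneous (s.card * e) := by
      have := IsHomogeneous.prod s F (fun _ => e) fun i hi => hF i (Finset.mem_insert_of_mem hi)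
      simpa using this
    have h2 := le_lg_mul hw (hF a (Finset.mem_insert_self a s)) h3
      (hF0 a (Finset.mem_insert_self a s))
      (Finset.prod_ne_zero_iff.mpr fun i hi => hF0 i (Finset.mem_insert_of_mem hi))
    have h4 : (ε : ℝ) * (kap m * (s.card ^ 2 * (e + 1))) +
        ε * (kap m * (e + ((s.card * e : ℕ) : ℝ) + 1)) ≤
        ε * (kap m * (((s.card + 1 : ℕ) : ℝ) ^ 2 * (e + 1))) := by
      rw [← mul_add, ← mul_add]
      have := kap_pos m
      gcongr
      push_cast
      nlinarith [Nat.cast_nonneg (α := ℝ) s.card, Nat.cast_nonneg (α := ℝ) e,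
        mul_nonneg (Nat.cast_nonneg (α := ℝ) s.card) (Nat.cast_nonneg (α := ℝ) e)]
    linarith

lemma log_eval_le (hw : LocalPlace w ε) {F : MvPolynomial (Fin m) Qbar} {e : ℕ}
    (hF : F.IsHomogeneous e) {x : Fin m → Qbar} (hFx : eval x F ≠ 0) {R : ℝ} (hR : 0 < R)
    (hx : ∀ i, w (x i) ≤ R) :
    Real.log (w (eval x F)) ≤ lg w F + e * Real.log R + ε * (kap m * e) := by
  have hF0 : F ≠ 0 := by rintro rfl; simp at hFx
  have h1 := Real.log_le_log (w.pos hFx) (eval_le hw hF hR.le hx)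
  rw [Real.log_mul (by positivity) (mul_pos (gauss_pos w hF0) (by positivity)).ne',
    Real.log_mul (gauss_pos w hF0).ne' (by positivity), Real.log_pow R] at h1
  have h2 := log_card_pow_le (e + 1) e m ε le_rfl
  have h3 : (ε : ℝ) * (m * e) ≤ ε * (kap m * e) := by
    unfold kap; gcongr; linarith [Nat.cast_nonneg (α := ℝ) m]
  unfold lg
  linarith

lemma exists_lg_le_log_eval (hw : LocalPlace w ε) {F : MvPolynomial (Fin m) Qbar} {e : ℕ}
    (hF : F.IsHomogeneous e) (hF0 : F ≠ 0) :
    ∃ x : Fin m → Qbar, (∀ i, w (x i) ≤ 1) ∧ eval x F ≠ 0 ∧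
      lg w F ≤ Real.log (w (eval x F)) + ε * (kap m * (e + 1)) := by
  obtain ⟨x, hx, h⟩ := exists_gauss_le_eval hw hF hF0
  have h0 : eval x F ≠ 0 := by
    intro h0
    rw [h0, map_zero, mul_zero] at h
    exact absurd (gauss_pos w hF0) (not_lt.mpr h)
  refine ⟨x, hx, h0, ?_⟩
  have h1 := Real.log_le_log (gauss_pos w hF0) h
  rw [Real.log_mul (by positivity) (w.pos h0).ne'] at h1
  have h2 := log_card_pow_le (e + 2) (e + 1) m ε le_rfl
  have h3 : (ε : ℝ) * (m * (e + 1 : ℕ)) ≤ ε * (kap m * (e + 1)) := by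
    push_cast; unfold kap; gcongr; linarith [Nat.cast_nonneg (α := ℝ) m]
  unfold lg
  linarith

/-- Evaluating the power at a point where F nearly attains its Gauss norm gives an error linear in
`n`, better than multiplying factor by factor. -/
lemma le_lg_pow (hw : LocalPlace w ε) {F : MvPolynomial (Fin m) Qbar} {e : ℕ}
    (hF : F.IsHomogeneous e) (hF0 : F ≠ 0) (n : ℕ) :
    n * lg w F ≤ lg w (F ^ n) + ε * (kap m * (2 * n * e + n + 1)) := by
  obtain ⟨x, hx, h0, h⟩ := exists_lg_le_log_eval hw hF hF0
  have h1 := log_eval_le hw (hF.pow n) (by rw [map_pow]; exact pow_ne_zero n h0) one_pos hx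
  rw [Real.log_one, mul_zero, add_zero, map_pow, map_pow, Real.log_pow] at h1
  have h2 := mul_le_mul_of_nonneg_left h (Nat.cast_nonneg (α := ℝ) n)
  push_cast at h1
  have h3 : 0 ≤ ε * kap m := mul_nonneg (Nat.cast_nonneg _) (kap_pos m).le
  linarith

/-- The maximal absolute value of the entries of a matrix. -/
def matSup (w : AbsoluteValue Qbar ℝ) {p q : ℕ} (B : Matrix (Fin p) (Fin q) Qbar) : ℝ :=
  setSup w (by classical exact Finset.univ.image fun i : Fin p × Fin q => B i.1 i.2)

lemma le_matSup (w : AbsoluteValue Qbar ℝ) {p q : ℕ} (B : Matrix (Fin p) (Fin q) Qbar) (i j) :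
    w (B i j) ≤ matSup w B := by
  classical
  exact le_setSup w (Finset.mem_image.mpr ⟨(i, j), Finset.mem_univ _, rfl⟩)

lemma matSup_le {p q : ℕ} {B : Matrix (Fin p) (Fin q) Qbar} {c : ℝ} (hc : 0 ≤ c)
    (h : ∀ i j, w (B i j) ≤ c) : matSup w B ≤ c := by
  classical
  refine setSup_le w hc fun a ha => ?_
  obtain ⟨i, -, rfl⟩ := Finset.mem_image.mp ha
  exact h i.1 i.2

lemma matSup_nonneg (w : AbsoluteValue Qbar ℝ) {p q : ℕ} (B : Matrix (Fin p) (Fin q) Qbar) :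
    0 ≤ matSup w B := setSup_nonneg _ _

lemma matSup_pos (w : AbsoluteValue Qbar ℝ) {p q : ℕ} {B : Matrix (Fin p) (Fin q) Qbar}
    (hB : B ≠ 0) : 0 < matSup w B := by
  by_contra! h
  apply hB
  ext i j
  exact w.eq_zero.mp (le_antisymm ((le_matSup w B i j).trans h) (w.nonneg _))

/-- The substitution of the linear forms given by the rows of a matrix. -/
def linSub {p q : ℕ} (B : Matrix (Fin p) (Fin q) Qbar) :
    MvPolynomial (Fin p) Qbar →ₐ[Qbar] MvPolynomial (Fin q) Qbar :=
  aeval fun l => ∑ r, C (B l r) * X r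

lemma isHomogeneous_linearForm {k : Type*} [CommSemiring k] {q : ℕ} (c : Fin q → k) :
    (∑ r, C (c r) * X r : MvPolynomial (Fin q) k).IsHomogeneous 1 :=
  IsHomogeneous.sum _ _ _ fun r _ => by
    simpa using (isHomogeneous_C (Fin q) (c r)).mul (isHomogeneous_X k r)

lemma linSub_isHomogeneous {p q : ℕ} (B : Matrix (Fin p) (Fin q) Qbar)
    {F : MvPolynomial (Fin p) Qbar} {e : ℕ} (hF : F.IsHomogeneous e) :
    (linSub B F).IsHomogeneous e := by
  have := hF.aeval (fun l => ∑ r, C (B l r) * X r) (n := 1) fun l => isHomogeneous_linearForm _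
  simpa [linSub] using this

lemma eval_linSub {p q : ℕ} (B : Matrix (Fin p) (Fin q) Qbar) (F : MvPolynomial (Fin p) Qbar)
    (x : Fin q → Qbar) : eval x (linSub B F) = eval (B.mulVec x) F := by
  have h : (eval x).comp (linSub B).toRingHom = eval (B.mulVec x) := by
    ext i
    · simp [linSub]
    · simp [linSub, Matrix.mulVec, dotProduct]
  exact congrArg (fun f : _ →+* Qbar => f F) h

lemma linSub_mul {p q r : ℕ} (B : Matrix (Fin p) (Fin q) Qbar) (B' : Matrix (Fin q) (Fin r) Qbar)
    (F : MvPolynomial (Fin p) Qbar) : linSub (B * B') F = linSub B' (linSub B F) := by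
  refine MvPolynomial.funext fun x => ?_
  rw [eval_linSub, eval_linSub, eval_linSub, Matrix.mulVec_mulVec]

lemma linSub_one {p : ℕ} (F : MvPolynomial (Fin p) Qbar) :
    linSub (1 : Matrix (Fin p) (Fin p) Qbar) F = F := by
  refine MvPolynomial.funext fun x => ?_
  rw [eval_linSub, Matrix.one_mulVec]

lemma gauss_linearForm_le (w : AbsoluteValue Qbar ℝ) {p q : ℕ} (B : Matrix (Fin p) (Fin q) Qbar)
    (l : Fin p) : gauss w (∑ r, C (B l r) * X r : MvPolynomial (Fin q) Qbar) ≤ matSup w B := by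
  classical
  refine gauss_le (matSup_nonneg w B) fun s => ?_
  simp only [coeff_sum, coeff_C_mul, coeff_X]
  by_cases h : ∃ r, Finsupp.single r 1 = s
  · obtain ⟨r, rfl⟩ := h
    rw [Finset.sum_eq_single r]
    · simpa using le_matSup w B l r
    · intro b _ hb
      rw [if_neg, mul_zero]
      intro h
      exact hb (Finsupp.single_left_injective one_ne_zero h)
    · simp
  · push Not at h
    simp [h, matSup_nonneg]

/-- Build each monomial by multiplying with one linear form at a time. A linear form has at most `2
^ q` terms by the crude monomial count, so each step costs the same factor. -/
lemma gauss_linSub_le (hw : LocalPlace w ε) {p q : ℕ} (B : Matrix (Fin p) (Fin q) Qbar)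
    {F : MvPolynomial (Fin p) Qbar} {e : ℕ} (hF : F.IsHomogeneous e) :
    gauss w (linSub B F) ≤ (((e + 1 : ℕ) : ℝ) ^ p) ^ ε * (gauss w F *
      (((((2 : ℕ) : ℝ) ^ q) ^ ε) * matSup w B) ^ e) := by
  classical
  set c : ℝ := (((2 : ℕ) : ℝ) ^ q) ^ ε * matSup w B with hc
  have hc0 : 0 ≤ c := mul_nonneg (by positivity) (matSup_nonneg w B)
  let ℓ : Fin p → MvPolynomial (Fin q) Qbar := fun l => ∑ r, C (B l r) * X r
  have hstep : ∀ l (G : MvPolynomial (Fin q) Qbar), gauss w (ℓ l * G) ≤ c * gauss w G := by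
    intro l G
    refine (gauss_mul_le hw (isHomogeneous_linearForm _) G).trans ?_
    rw [hc, mul_assoc]
    have := gauss_linearForm_le w B l
    have := gauss_nonneg w G
    gcongr
  have hpow : ∀ l n (G : MvPolynomial (Fin q) Qbar),
      gauss w (ℓ l ^ n * G) ≤ c ^ n * gauss w G := by
    intro l n
    induction n with
    | zero => intro G; simp
    | succ n ih =>
      intro G
      rw [pow_succ', mul_assoc, pow_succ', mul_assoc]
      exact (hstep l _).trans (mul_le_mul_of_nonneg_left (ih G) hc0)
  have hprod : ∀ (s : Fin p →₀ ℕ) (t : Finset (Fin p)),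
      gauss w (∏ l ∈ t, ℓ l ^ s l) ≤ c ^ (∑ l ∈ t, s l) := by
    intro s t
    induction t using Finset.induction_on with
    | empty => simp [gauss_one]
    | insert a t ha ih =>
      rw [Finset.prod_insert ha, Finset.sum_insert ha, pow_add]
      exact (hpow _ _ _).trans (mul_le_mul_of_nonneg_left ih (pow_nonneg hc0 _))
  have hB : 0 ≤ gauss w F * c ^ e := mul_nonneg (gauss_nonneg _ _) (pow_nonneg hc0 _)
  refine gauss_le (mul_nonneg (by positivity) hB) fun t => ?_
  have hexp : (linSub B F).coeff t =
      ∑ s ∈ F.support, (C (F.coeff s) * ∏ l, ℓ l ^ s l).coeff t := by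
    rw [linSub, aeval_def, eval₂_eq', coeff_sum]
    rfl
  rw [hexp]
  refine (hw.sum_le F.support _ hB fun s hs => ?_).trans ?_
  · rw [coeff_C_mul, map_mul]
    refine mul_le_mul (le_gauss w F s) ?_ (w.nonneg _) (gauss_nonneg w F)
    rw [← sum_exponent_of_isHomogeneous hF (mem_support_iff.mp hs)]
    exact (le_gauss w _ t).trans (hprod s Finset.univ)
  · refine mul_le_mul_of_nonneg_right (pow_le_pow_eps (Nat.cast_nonneg _) ?_ ε) hB
    exact_mod_cast card_support_le hF

lemma lg_linSub_le (hw : LocalPlace w ε) (B : Matrix (Fin m) (Fin m) Qbar)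
    (hB : B ≠ 0) {F : MvPolynomial (Fin m) Qbar} {e : ℕ} (hF : F.IsHomogeneous e)
    (hF0 : F ≠ 0) (hFB : linSub B F ≠ 0) :
    lg w (linSub B F) ≤ lg w F + e * Real.log (matSup w B) + ε * (kap m * e) := by
  have h1 := Real.log_le_log (gauss_pos w hFB) (gauss_linSub_le hw B hF)
  have hBp := matSup_pos w hB
  have hg := gauss_pos w hF0
  rw [Real.log_mul (by positivity) (by positivity), Real.log_mul hg.ne' (by positivity),
    Real.log_pow _ e, Real.log_mul (by positivity) hBp.ne'] at h1
  have h2 := log_card_pow_le (e + 1) e m ε le_rfl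
  have h3 := mul_le_mul_of_nonneg_left (log_card_pow_le 2 1 m ε le_rfl) (Nat.cast_nonneg (α := ℝ) e)
  have h4 : (ε : ℝ) * (m * e) + e * (ε * (m * 1)) ≤ ε * (kap m * e) := by
    unfold kap
    have : (0 : ℝ) ≤ ε * e := by positivity
    nlinarith
  unfold lg
  push_cast at h1 h2 h3 ⊢
  linarith

end Gelfond

/-! ### Norm forms for the power map -/

section NormForm

open MvPolynomial

variable {m n d e : ℕ} {w : AbsoluteValue Qbar ℝ} {ε : ℕ}

/-- The action on polynomials of a diagonal change of coordinates. -/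
def twist (ζ : Fin m → Qbar) : MvPolynomial (Fin m) Qbar →ₐ[Qbar] MvPolynomial (Fin m) Qbar :=
  aeval fun i => C (ζ i) * X i

lemma coeff_twist (ζ : Fin m → Qbar) (F : MvPolynomial (Fin m) Qbar) (s : Fin m →₀ ℕ) :
    (twist ζ F).coeff s = (∏ i, ζ i ^ s i) * F.coeff s := by
  classical
  induction F using MvPolynomial.induction_on' with
  | monomial t a =>
    have : twist ζ (monomial t a) = monomial t ((∏ i, ζ i ^ t i) * a) := by
      rw [twist, aeval_monomial, Finsupp.prod_fintype _ _ (by simp)]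
      simp only [mul_pow, Finset.prod_mul_distrib, ← C_pow, ← map_prod, algebraMap_eq]
      rw [monomial_eq (s := t), Finsupp.prod_fintype _ _ (by simp), C_mul]
      ring
    rw [this, coeff_monomial, coeff_monomial]
    split_ifs with h
    · rw [h]
    · rw [mul_zero]
  | add p q hp hq => rw [map_add, coeff_add, coeff_add, hp, hq, mul_add]

lemma eval_twist (ζ x : Fin m → Qbar) (F : MvPolynomial (Fin m) Qbar) :
    eval x (twist ζ F) = eval (fun i => ζ i * x i) F := by
  have h : (eval x).comp (twist ζ).toRingHom = eval fun i => ζ i * x i := by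
    ext i <;> simp [twist]
  exact congrArg (fun f : _ →+* Qbar => f F) h

lemma twist_twist (η ζ : Fin m → Qbar) (F : MvPolynomial (Fin m) Qbar) :
    twist η (twist ζ F) = twist (η * ζ) F := by
  refine MvPolynomial.funext fun x => ?_
  rw [eval_twist, eval_twist, eval_twist]
  refine congrArg (fun y => eval y F) (funext fun i => ?_)
  simp only [Pi.mul_apply]
  ring

lemma twist_one (F : MvPolynomial (Fin m) Qbar) : twist 1 F = F := by
  ext s
  rw [coeff_twist]; simp

lemma twist_isHomogeneous (ζ : Fin m → Qbar) {F : MvPolynomial (Fin m) Qbar}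
    (hF : F.IsHomogeneous e) : (twist ζ F).IsHomogeneous e := by
  intro s hs
  rw [coeff_twist] at hs
  exact hF (right_ne_zero_of_mul hs)

lemma twist_ne_zero {ζ : Fin m → Qbar} (hζ : ∀ i, ζ i ≠ 0) {F : MvPolynomial (Fin m) Qbar}
    (hF : F ≠ 0) : twist ζ F ≠ 0 := by
  obtain ⟨s, hs⟩ := ne_zero_iff.mp hF
  refine ne_zero_iff.mpr ⟨s, ?_⟩
  rw [coeff_twist]
  exact mul_ne_zero (Finset.prod_ne_zero_iff.mpr fun i _ => pow_ne_zero _ (hζ i)) hs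

lemma gauss_twist (w : AbsoluteValue Qbar ℝ) {ζ : Fin m → Qbar} (hζ : ∀ i, w (ζ i) = 1)
    (F : MvPolynomial (Fin m) Qbar) : gauss w (twist ζ F) = gauss w F := by
  have h : ∀ s, w ((twist ζ F).coeff s) = w (F.coeff s) := fun s => by
    rw [coeff_twist, map_mul, map_prod]
    simp [hζ]
  refine le_antisymm (gauss_le (gauss_nonneg _ _) fun s => ?_)
    (gauss_le (gauss_nonneg _ _) fun s => ?_)
  · rw [h]; exact le_gauss w F s
  · rw [← h]; exact le_gauss w _ s

/-- The tuples of `d`-th roots of unity whose entries with index in `J` are `1`. -/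
def rootTuplesOn (d : ℕ) (J : Finset (Fin m)) : Finset (Fin m → Qbar) := by
  classical
  exact Fintype.piFinset fun i => if i ∈ J then {1} else Polynomial.nthRootsFinset d 1

lemma mem_rootTuplesOn (hd : 0 < d) {J : Finset (Fin m)} {ζ : Fin m → Qbar} :
    ζ ∈ rootTuplesOn d J ↔ (∀ i, ζ i ^ d = 1) ∧ ∀ i ∈ J, ζ i = 1 := by
  classical
  rw [rootTuplesOn, Fintype.mem_piFinset]
  constructor
  · intro h
    have hl : ∀ i ∈ J, ζ i = 1 := fun i hi => by
      have := h i
      rwa [if_pos hi, Finset.mem_singleton] at this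
    refine ⟨fun i => ?_, hl⟩
    by_cases hi : i ∈ J
    · rw [hl i hi, one_pow]
    · have := h i
      rwa [if_neg hi, Polynomial.mem_nthRootsFinset hd] at this
  · rintro ⟨h, hl⟩ i
    split_ifs with hi
    · rw [hl i hi]; exact Finset.mem_singleton_self _
    · rw [Polynomial.mem_nthRootsFinset hd]; exact h i

lemma exists_primitiveRoot_Qbar (hd : 0 < d) : ∃ ζ : Qbar, IsPrimitiveRoot ζ d := by
  have : NeZero d := ⟨hd.ne'⟩
  exact HasEnoughRootsOfUnity.exists_primitiveRoot Qbar d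

lemma card_rootTuplesOn (hd : 0 < d) (J : Finset (Fin m)) :
    (rootTuplesOn d J).card = d ^ (m - J.card) := by
  classical
  obtain ⟨ζ, hζ⟩ := exists_primitiveRoot_Qbar hd
  rw [rootTuplesOn, Fintype.card_piFinset, Finset.prod_congr rfl (g := fun i =>
    if i ∈ J then 1 else d) (fun i _ => by split_ifs <;> simp [hζ.card_nthRootsFinset]),
    Finset.prod_ite, Finset.prod_const_one, one_mul, Finset.prod_const]
  congr 1
  rw [Finset.filter_not, Finset.card_sdiff_of_subset (Finset.filter_subset _ _)]
  simp

/-- The tuples of `d`-th roots of unity with last entry `1`. -/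
def rootTuples (d n : ℕ) : Finset (Fin (n + 1) → Qbar) := rootTuplesOn d {Fin.last n}

lemma mem_rootTuples (hd : 0 < d) {ζ : Fin (n + 1) → Qbar} :
    ζ ∈ rootTuples d n ↔ (∀ i, ζ i ^ d = 1) ∧ ζ (Fin.last n) = 1 := by
  rw [rootTuples, mem_rootTuplesOn hd]
  simp

lemma card_rootTuples (hd : 0 < d) : (rootTuples d n).card = d ^ n := by
  rw [rootTuples, card_rootTuplesOn hd]
  simp

lemma rootTuples_ne_zero (hd : 0 < d) {ζ : Fin (n + 1) → Qbar} (hζ : ζ ∈ rootTuples d n) (i) :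
    ζ i ≠ 0 := by
  intro h
  have := ((mem_rootTuples hd).mp hζ).1 i
  rw [h, zero_pow hd.ne'] at this
  exact zero_ne_one this

lemma abs_rootTuples (w : AbsoluteValue Qbar ℝ) (hd : 0 < d) {ζ : Fin (n + 1) → Qbar}
    (hζ : ζ ∈ rootTuples d n) (i) : w (ζ i) = 1 := by
  have := congrArg w (((mem_rootTuples hd).mp hζ).1 i)
  rw [map_pow, map_one] at this
  exact (pow_eq_one_iff_of_nonneg (w.nonneg _) hd.ne').mp this

lemma one_mem_rootTuples (hd : 0 < d) : (1 : Fin (n + 1) → Qbar) ∈ rootTuples d n :=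
  (mem_rootTuples hd).mpr ⟨fun i => by simp, rfl⟩

lemma mul_mem_rootTuples (hd : 0 < d) {η ζ : Fin (n + 1) → Qbar} (hη : η ∈ rootTuples d n)
    (hζ : ζ ∈ rootTuples d n) : η * ζ ∈ rootTuples d n := by
  rw [mem_rootTuples hd] at *
  exact ⟨fun i => by rw [Pi.mul_apply, mul_pow, hη.1, hζ.1, one_mul],
    by rw [Pi.mul_apply, hη.2, hζ.2, one_mul]⟩

lemma inv_mem_rootTuples (hd : 0 < d) {η : Fin (n + 1) → Qbar} (hη : η ∈ rootTuples d n) :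
    η⁻¹ ∈ rootTuples d n := by
  rw [mem_rootTuples hd] at *
  exact ⟨fun i => by rw [Pi.inv_apply, inv_pow, hη.1, inv_one],
    by rw [Pi.inv_apply, hη.2, inv_one]⟩

/-- The product of the conjugates of a polynomial under the Galois group of the power map. -/
def normProd (d : ℕ) (F : MvPolynomial (Fin (n + 1)) Qbar) : MvPolynomial (Fin (n + 1)) Qbar :=
  ∏ ζ ∈ rootTuples d n, twist ζ F

lemma twist_normProd (hd : 0 < d) {η : Fin (n + 1) → Qbar} (hη : η ∈ rootTuples d n)
    (F : MvPolynomial (Fin (n + 1)) Qbar) : twist η (normProd d F) = normProd d F := by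
  rw [normProd, map_prod]
  refine Finset.prod_bij' (fun ζ _ => η * ζ) (fun ζ _ => η⁻¹ * ζ)
    (fun ζ hζ => mul_mem_rootTuples hd hη hζ)
    (fun ζ hζ => mul_mem_rootTuples hd (inv_mem_rootTuples hd hη) hζ) ?_ ?_ ?_
  · intro ζ _
    ext i
    simp [rootTuples_ne_zero hd hη i]
  · intro ζ _
    ext i
    simp [rootTuples_ne_zero hd hη i]
  · intro ζ _
    rw [twist_twist]

lemma normProd_isHomogeneous (hd : 0 < d) {F : MvPolynomial (Fin (n + 1)) Qbar}
    (hF : F.IsHomogeneous e) : (normProd d F).IsHomogeneous (d ^ n * e) := by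
  have := IsHomogeneous.prod (rootTuples d n) (fun ζ => twist ζ F) (fun _ => e)
    fun ζ _ => twist_isHomogeneous ζ hF
  rwa [Finset.sum_const, card_rootTuples hd, smul_eq_mul] at this

lemma exists_expand_eq {F : MvPolynomial (Fin m) Qbar}
    (h : ∀ s, F.coeff s ≠ 0 → ∀ i, d ∣ s i) : ∃ G, expand d G = F := by
  refine ⟨∑ s ∈ F.support, monomial (s.mapRange (· / d) (Nat.zero_div d)) (F.coeff s), ?_⟩
  rw [map_sum]
  conv_rhs => rw [F.as_sum]
  refine Finset.sum_congr rfl fun s hs => ?_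
  rw [expand_monomial]
  refine congrArg (fun t => monomial t (F.coeff s)) (Finsupp.ext fun i => ?_)
  simpa using Nat.mul_div_cancel' (h s (mem_support_iff.mp hs) i)

/-- Invariance under a primitive root of unity in the i-th coordinate alone forces d to divide the
i-th exponent, for i not last. The last exponent follows from the total degree dⁿ·e, which is
divisible by d because n ≥ 1. -/
lemma dvd_of_coeff_normProd_ne_zero (hd : 0 < d) (hn : 1 ≤ n)
    {F : MvPolynomial (Fin (n + 1)) Qbar} (hF : F.IsHomogeneous e) {s : Fin (n + 1) →₀ ℕ}
    (hs : (normProd d F).coeff s ≠ 0) (i : Fin (n + 1)) : d ∣ s i := by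
  classical
  have key : ∀ i : Fin (n + 1), i ≠ Fin.last n → d ∣ s i := by
    intro i hi
    obtain ⟨ζ, hζ⟩ := exists_primitiveRoot_Qbar hd
    let η : Fin (n + 1) → Qbar := Function.update 1 i ζ
    have hη : η ∈ rootTuples d n := by
      rw [mem_rootTuples hd]
      constructor
      · intro j
        by_cases hj : j = i
        · subst hj; simp [η, hζ.pow_eq_one]
        · simp [η, hj]
      · simp [η, Ne.symm hi]
    have h1 := congrArg (coeff s) (twist_normProd hd hη F)
    rw [coeff_twist] at h1
    have h2 := mul_right_cancel₀ hs (h1.trans (one_mul _).symm)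
    rw [Finset.prod_eq_single i] at h2
    · simp only [η, Function.update_self] at h2
      exact (hζ.pow_eq_one_iff_dvd _).mp h2
    · intro j _ hj
      simp [η, hj]
    · simp
  by_cases hi : i = Fin.last n
  · subst hi
    have h1 := sum_exponent_of_isHomogeneous (normProd_isHomogeneous hd hF) hs
    rw [Fin.sum_univ_castSucc] at h1
    have h2 : d ∣ ∑ j : Fin n, s j.castSucc :=
      Finset.dvd_sum fun j _ => key _ (Fin.castSucc_lt_last j).ne
    have h3 : d ∣ d ^ n * e := Dvd.dvd.mul_right (dvd_pow_self d (by omega)) e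
    rw [← h1] at h3
    exact (Nat.dvd_add_right h2).mp h3
  · exact key i hi

/-- The polynomial `G` such that `G(𝐗ᵈ)` is the product of the conjugates of a form. -/
def normForm (d : ℕ) (F : MvPolynomial (Fin (n + 1)) Qbar) : MvPolynomial (Fin (n + 1)) Qbar :=
  Function.invFun (expand d) (normProd d F)

/-- For n = 0 there is only one conjugate, and it need not be a polynomial in 𝐗ᵈ. This is why
projective space of dimension 0 is handled separately throughout. -/
lemma expand_normForm (hd : 0 < d) (hn : 1 ≤ n) {F : MvPolynomial (Fin (n + 1)) Qbar}
    (hF : F.IsHomogeneous e) : expand d (normForm d F) = normProd d F :=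
  Function.invFun_eq (exists_expand_eq fun _ hs =>
    dvd_of_coeff_normProd_ne_zero hd hn hF hs)

lemma normForm_isHomogeneous (hd : 0 < d) (hn : 1 ≤ n) {F : MvPolynomial (Fin (n + 1)) Qbar}
    (hF : F.IsHomogeneous e) : (normForm d F).IsHomogeneous (d ^ (n - 1) * e) := by
  intro t ht
  rw [← coeff_expand_smul d hd.ne', expand_normForm hd hn hF] at ht
  have h1 := normProd_isHomogeneous hd hF ht
  rw [map_nsmul, smul_eq_mul] at h1
  refine Nat.eq_of_mul_eq_mul_left hd (h1.trans ?_)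
  rw [← mul_assoc, ← pow_succ', Nat.sub_add_cancel hn]

lemma normProd_ne_zero (hd : 0 < d) {F : MvPolynomial (Fin (n + 1)) Qbar} (hF0 : F ≠ 0) :
    normProd d F ≠ 0 :=
  Finset.prod_ne_zero_iff.mpr fun _ hζ => twist_ne_zero (rootTuples_ne_zero hd hζ) hF0

lemma normForm_ne_zero (hd : 0 < d) (hn : 1 ≤ n) {F : MvPolynomial (Fin (n + 1)) Qbar}
    (hF : F.IsHomogeneous e) (hF0 : F ≠ 0) : normForm d F ≠ 0 := by
  intro h
  have := expand_normForm hd hn hF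
  rw [h, map_zero] at this
  exact normProd_ne_zero hd hF0 this.symm

lemma normForm_mul (hd : 0 < d) (hn : 1 ≤ n) {F G : MvPolynomial (Fin (n + 1)) Qbar} {e' : ℕ}
    (hF : F.IsHomogeneous e) (hG : G.IsHomogeneous e') :
    normForm d (F * G) = normForm d F * normForm d G := by
  refine expand_injective hd ?_
  rw [map_mul, expand_normForm hd hn hF, expand_normForm hd hn hG, expand_normForm hd hn (hF.mul hG),
    normProd, normProd, normProd, ← Finset.prod_mul_distrib]
  exact Finset.prod_congr rfl fun ζ _ => map_mul _ _ _

lemma normForm_C (hd : 0 < d) (hn : 1 ≤ n) (c : Qbar) :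
    normForm d (C c : MvPolynomial (Fin (n + 1)) Qbar) = C (c ^ d ^ n) := by
  refine expand_injective hd ?_
  rw [expand_normForm hd hn (isHomogeneous_C _ c), normProd, expand_C]
  simp only [twist, aeval_C, algebraMap_eq]
  rw [Finset.prod_const, card_rootTuples hd, C_pow]

/-- Expansion only relabels the monomials, so estimates for the norm product are estimates for the
norm form. -/
lemma gauss_expand (w : AbsoluteValue Qbar ℝ) (hd : 0 < d) (G : MvPolynomial (Fin m) Qbar) :
    gauss w (expand d G) = gauss w G := by
  classical
  refine le_antisymm (gauss_le (gauss_nonneg _ _) fun s => ?_)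
    (gauss_le (gauss_nonneg _ _) fun s => ?_)
  · by_cases h : ∀ i, d ∣ s i
    · obtain ⟨t, rfl⟩ : ∃ t : Fin m →₀ ℕ, d • t = s :=
        ⟨s.mapRange (· / d) (Nat.zero_div d), by
          ext i; simpa using Nat.mul_div_cancel' (h i)⟩
      rw [coeff_expand_smul d hd.ne']
      exact le_gauss w G t
    · push Not at h
      obtain ⟨i, hi⟩ := h
      rw [coeff_expand_of_not_dvd _ hi, map_zero]
      exact gauss_nonneg _ _
  · rw [← coeff_expand_smul d hd.ne']
    exact le_gauss w _ _

lemma lg_normForm_le (hw : LocalPlace w ε) (hd : 0 < d) (hn : 1 ≤ n)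
    {F : MvPolynomial (Fin (n + 1)) Qbar} (hF : F.IsHomogeneous e) (hF0 : F ≠ 0) :
    lg w (normForm d F) ≤ d ^ n * lg w F + ε * (kap (n + 1) * (d ^ n * e)) := by
  have h := lg_prod_le hw (rootTuples d n) (fun ζ => twist ζ F)
    (fun ζ _ => twist_isHomogeneous ζ hF) fun ζ hζ => twist_ne_zero (rootTuples_ne_zero hd hζ) hF0
  rw [Finset.sum_congr rfl (g := fun _ => lg w F) (fun ζ hζ => by
    rw [lg, gauss_twist w (abs_rootTuples w hd hζ), lg]), Finset.sum_const, card_rootTuples hd,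
    nsmul_eq_mul] at h
  rw [lg, ← gauss_expand w hd, expand_normForm hd hn hF]
  push_cast at h
  exact h

lemma le_lg_normForm (hw : LocalPlace w ε) (hd : 0 < d) (hn : 1 ≤ n)
    {F : MvPolynomial (Fin (n + 1)) Qbar} (hF : F.IsHomogeneous e) (hF0 : F ≠ 0) :
    d ^ n * lg w F ≤ lg w (normForm d F) + ε * (kap (n + 1) * ((d ^ n) ^ 2 * (e + 1))) := by
  have h := le_lg_prod hw (rootTuples d n) (fun ζ => twist ζ F)
    (fun ζ _ => twist_isHomogeneous ζ hF) fun ζ hζ => twist_ne_zero (rootTuples_ne_zero hd hζ) hF0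
  rw [Finset.sum_congr rfl (g := fun _ => lg w F) (fun ζ hζ => by
    rw [lg, gauss_twist w (abs_rootTuples w hd hζ), lg]), Finset.sum_const, card_rootTuples hd,
    nsmul_eq_mul] at h
  rw [lg.eq_1 w (normForm d F), ← gauss_expand w hd, expand_normForm hd hn hF]
  push_cast at h
  exact h

end NormForm

/-! ### Zero loci of forms -/

section ZeroLoci

open MvPolynomial

variable {m n d e : ℕ}

/-- The substitution `Xᵢ ↦ T Xᵢ`. -/
def gradeHom (m : ℕ) : MvPolynomial (Fin m) Qbar →+* Polynomial (MvPolynomial (Fin m) Qbar) :=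
  eval₂Hom (Polynomial.C.comp C) fun i => Polynomial.C (X i) * Polynomial.X

lemma coeff_gradeHom (F : MvPolynomial (Fin m) Qbar) (j : ℕ) (s : Fin m →₀ ℕ) :
    ((gradeHom m F).coeff j).coeff s = if ∑ i, s i = j then F.coeff s else 0 := by
  classical
  induction F using MvPolynomial.induction_on' with
  | monomial t a =>
    have : gradeHom m (monomial t a) =
        Polynomial.C (monomial t a) * Polynomial.X ^ (∑ i, t i) := by
      rw [gradeHom, coe_eval₂Hom, eval₂_monomial, Finsupp.prod_fintype _ _ (by simp),
        monomial_eq (s := t), Finsupp.prod_fintype _ _ (by simp)]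
      simp only [mul_pow, Finset.prod_mul_distrib, Finset.prod_pow_eq_pow_sum, map_mul, map_prod,
        map_pow, RingHom.comp_apply]
      ring
    rw [this, Polynomial.coeff_C_mul, Polynomial.coeff_X_pow, coeff_monomial]
    by_cases hts : t = s
    · subst hts
      by_cases hj : ∑ i, t i = j
      · simp [hj]
      · simp [hj, Ne.symm hj]
    · by_cases hj : j = ∑ i, t i
      · simp [hj, hts]
      · simp [hj, hts]
  | add p q hp hq =>
    rw [map_add, Polynomial.coeff_add, coeff_add, coeff_add, hp, hq]
    split_ifs <;> simp

lemma gradeHom_ne_zero {F : MvPolynomial (Fin m) Qbar} (hF : F ≠ 0) : gradeHom m F ≠ 0 := by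
  obtain ⟨s, hs⟩ := ne_zero_iff.mp hF
  intro h
  have := coeff_gradeHom F (∑ i, s i) s
  rw [h, if_pos rfl] at this
  exact hs (by simpa using this.symm)

lemma isHomogeneous_iff_sum {F : MvPolynomial (Fin m) Qbar} :
    F.IsHomogeneous e ↔ ∀ s, F.coeff s ≠ 0 → ∑ i, s i = e := by
  refine ⟨fun hF s hs => sum_exponent_of_isHomogeneous hF hs, fun h s hs => ?_⟩
  rw [Finsupp.weight_apply, Finsupp.sum_fintype _ _ (by simp)]
  simpa using h s hs

/-- A factor of a form is a form. -/
lemma isHomogeneous_of_mul {F G : MvPolynomial (Fin m) Qbar} (h : (F * G).IsHomogeneous e)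
    (h0 : F * G ≠ 0) : ∃ e', F.IsHomogeneous e' := by
  have hF := gradeHom_ne_zero (left_ne_zero_of_mul h0)
  have hG := gradeHom_ne_zero (right_ne_zero_of_mul h0)
  have hFG := gradeHom_ne_zero h0
  have hcoeff : ∀ j, (gradeHom m (F * G)).coeff j ≠ 0 → j = e := by
    intro j hj
    obtain ⟨s, hs⟩ := ne_zero_iff.mp hj
    rw [coeff_gradeHom] at hs
    split_ifs at hs with hj'
    · rw [← hj', isHomogeneous_iff_sum.mp h s hs]
    · exact absurd rfl hs
  -- Highest and lowest degree in T agree for the product. Both are additive over factors, so they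
  -- agree for each factor, which is therefore homogeneous.
  have h1 : (gradeHom m (F * G)).natDegree = e :=
    hcoeff _ (by
      rw [Polynomial.coeff_natDegree]; exact Polynomial.leadingCoeff_ne_zero.mpr hFG)
  have h2 : (gradeHom m (F * G)).natTrailingDegree = e :=
    hcoeff _ (Polynomial.trailingCoeff_nonzero_iff_nonzero.mpr hFG)
  rw [map_mul] at h1 h2
  rw [Polynomial.natDegree_mul hF hG] at h1
  rw [Polynomial.natTrailingDegree_mul hF hG] at h2
  have h3 := (gradeHom m F).natTrailingDegree_le_natDegree
  have h4 := (gradeHom m G).natTrailingDegree_le_natDegree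
  refine ⟨(gradeHom m F).natDegree, isHomogeneous_iff_sum.mpr fun s hs => ?_⟩
  have h5 : (gradeHom m F).coeff (∑ i, s i) ≠ 0 := by
    intro h6
    have := coeff_gradeHom F (∑ i, s i) s
    rw [h6, if_pos rfl] at this
    exact hs (by simpa using this.symm)
  have h6 := Polynomial.le_natDegree_of_ne_zero h5
  have h7 := Polynomial.natTrailingDegree_le_of_ne_zero h5
  omega

lemma isHomogeneous_of_dvd {F G : MvPolynomial (Fin m) Qbar} (h : G.IsHomogeneous e)
    (h0 : G ≠ 0) (hd : F ∣ G) : ∃ e', F.IsHomogeneous e' := by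
  obtain ⟨H, rfl⟩ := hd
  exact isHomogeneous_of_mul h h0

lemma eval_smul_of_isHomogeneous {F : MvPolynomial (Fin m) Qbar} (hF : F.IsHomogeneous e)
    (a : Qbar) (x : Fin m → Qbar) : eval (a • x) F = a ^ e * eval x F := by
  rw [eval_eq', eval_eq', Finset.mul_sum]
  refine Finset.sum_congr rfl fun s hs => ?_
  simp only [Pi.smul_apply, smul_eq_mul, mul_pow, Finset.prod_mul_distrib,
    Finset.prod_pow_eq_pow_sum, sum_exponent_of_isHomogeneous hF (mem_support_iff.mp hs)]
  ring

lemma eval_zero_of_isHomogeneous {F : MvPolynomial (Fin m) Qbar} (hF : F.IsHomogeneous e)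
    (he : 0 < e) : eval 0 F = 0 := by
  have := eval_smul_of_isHomogeneous hF 0 0
  rwa [zero_smul, zero_pow he.ne', zero_mul] at this

lemma not_isUnit_of_eval_eq_zero {F : MvPolynomial (Fin m) Qbar} {x : Fin m → Qbar}
    (h : eval x F = 0) : ¬IsUnit F := fun hu => by
  have := hu.map (eval x)
  rw [h] at this
  exact not_isUnit_zero this

lemma degree_pos_of_irreducible {F : MvPolynomial (Fin m) Qbar} (hF : Irreducible F)
    (hF' : F.IsHomogeneous e) : 0 < e := by
  rcases Nat.eq_zero_or_pos e with rfl | he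
  · exfalso
    rw [← totalDegree_zero_iff_isHomogeneous, totalDegree_eq_zero_iff_eq_C] at hF'
    refine hF.not_isUnit ?_
    rw [hF']
    refine (isUnit_iff_ne_zero.mpr fun h => hF.ne_zero ?_).map C
    rw [hF', h, map_zero]
  · exact he

/-- The Nullstellensatz for irreducible hypersurfaces. -/
lemma dvd_of_eval_eq_zero {P g : MvPolynomial (Fin m) Qbar} (hP : Irreducible P)
    (h : ∀ x, eval x P = 0 → eval x g = 0) : P ∣ g := by
  have : (Ideal.span {P}).IsPrime := (Ideal.span_singleton_prime hP.ne_zero).mpr hP.prime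
  rw [← Ideal.mem_span_singleton, ← IsPrime.vanishingIdeal_zeroLocus (K := Qbar) (Ideal.span {P}),
    mem_vanishingIdeal_iff]
  intro x hx
  rw [mem_zeroLocus_iff] at hx
  have := hx P (Ideal.mem_span_singleton_self P)
  rw [aeval_eq_eval] at this ⊢
  exact h x this

lemma associated_of_eval {P Q : MvPolynomial (Fin m) Qbar} (hP : Irreducible P)
    (hQ : Irreducible Q) (h : ∀ x, eval x P = 0 ↔ eval x Q = 0) : Associated P Q :=
  associated_of_dvd_dvd (dvd_of_eval_eq_zero hP fun x => (h x).mp)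
    (dvd_of_eval_eq_zero hQ fun x => (h x).mpr)

lemma mk_mem_zeroLocus {F : MvPolynomial (Fin m) Qbar} (hF : F.IsHomogeneous e)
    {x : Fin m → Qbar} (hx : x ≠ 0) :
    Projectivization.mk Qbar x hx ∈ zeroLocus F ↔ eval x F = 0 := by
  obtain ⟨a, ha⟩ := Projectivization.exists_smul_eq_mk_rep Qbar x hx
  change eval (Projectivization.mk Qbar x hx).rep F = 0 ↔ _
  rw [← ha, Units.smul_def, eval_smul_of_isHomogeneous hF]
  simp

lemma associated_of_zeroLocus_eq {P Q : MvPolynomial (Fin m) Qbar} {e' : ℕ} (hP : Irreducible P)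
    (hP' : P.IsHomogeneous e) (hQ : Irreducible Q) (hQ' : Q.IsHomogeneous e')
    (h : zeroLocus P = zeroLocus Q) : Associated P Q := by
  refine associated_of_eval hP hQ fun x => ?_
  by_cases hx : x = 0
  · subst hx
    rw [eval_zero_of_isHomogeneous hP' (degree_pos_of_irreducible hP hP'),
      eval_zero_of_isHomogeneous hQ' (degree_pos_of_irreducible hQ hQ')]
  · rw [← mk_mem_zeroLocus hP' hx, ← mk_mem_zeroLocus hQ' hx, h]

lemma eval_eq_zero_iff_of_associated {P Q : MvPolynomial (Fin m) Qbar} (h : Associated P Q)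
    (x : Fin m → Qbar) : eval x P = 0 ↔ eval x Q = 0 := by
  obtain ⟨u, rfl⟩ := h
  rw [map_mul, mul_eq_zero, or_iff_left]
  exact (u.isUnit.map (eval x)).ne_zero

lemma isHomogeneous_of_associated {P Q : MvPolynomial (Fin m) Qbar} (h : Associated P Q)
    (hP : P.IsHomogeneous e) : Q.IsHomogeneous e := by
  obtain ⟨u, rfl⟩ := h
  obtain ⟨c, -, hc⟩ := isUnit_iff_eq_C_of_isReduced.mp u.isUnit
  rw [hc]
  simpa using hP.mul (isHomogeneous_C _ c)

/-- An effective divisor is defined by a form. -/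
def IsFormOf (D : EffDivisor m) (F : MvPolynomial (Fin m) Qbar) : Prop :=
  ∃ S : Multiset (MvPolynomial (Fin m) Qbar),
    (∀ p ∈ S, Irreducible p ∧ ∃ e, p.IsHomogeneous e) ∧ D = S.map zeroLocus ∧ Associated S.prod F

lemma formOf_isHomogeneous (Z : Set (PSpace m)) : ∃ e, (formOf Z).IsHomogeneous e := by
  unfold formOf
  split_ifs with h
  · exact h.choose_spec.2.1
  · exact ⟨0, isHomogeneous_one _ _⟩

lemma formOf_zeroLocus {p : MvPolynomial (Fin m) Qbar} (hp : Irreducible p)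
    (hp' : p.IsHomogeneous e) : Associated (formOf (zeroLocus p)) p := by
  have h : ∃ q : MvPolynomial (Fin m) Qbar,
      Irreducible q ∧ (∃ e, q.IsHomogeneous e) ∧ zeroLocus q = zeroLocus p := ⟨p, hp, ⟨e, hp'⟩, rfl⟩
  rw [formOf, dif_pos h]
  obtain ⟨h1, ⟨e', h2⟩, h3⟩ := h.choose_spec
  exact associated_of_zeroLocus_eq h1 h2 hp hp' h3

/-- The product formula for `c` enters as the vanishing of the height of the one-element set `{c}`.
The same device removes scalar factors from later local inequalities. -/
lemma setHeight_coeffs_C_mul {c : Qbar} (hc : c ≠ 0) {F : MvPolynomial (Fin m) Qbar} (hF : F ≠ 0) :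
    setHeight (C c * F).coeffs = setHeight F.coeffs := by
  have key : ∀ (c : Qbar) (_ : c ≠ 0) (F : MvPolynomial (Fin m) Qbar) (_ : F ≠ 0),
      setHeight (C c * F).coeffs ≤ setHeight F.coeffs := by
    intro c hc F hF
    have hcF : C c * F ≠ 0 := mul_ne_zero (C_ne_zero.mpr hc) hF
    have h := setHeight_sum_le ![(C c * F).coeffs, F.coeffs, {c}]
      (fun j => by
        fin_cases j
        · exact exists_mem_coeffs_ne_zero hcF
        · exact exists_mem_coeffs_ne_zero hF
        · exact ⟨c, Finset.mem_singleton_self c, hc⟩) ![1, -1, -1] 0 (fun w ε _ => by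
        have h1 := gauss_C_mul w c F
        unfold gauss at h1
        have h2 : setSup w {c} = w c :=
          le_antisymm (setSup_le w (w.nonneg c) fun a ha => by
            rw [Finset.mem_singleton.mp ha]) (le_setSup w (Finset.mem_singleton_self c))
        simp only [Fin.sum_univ_three, Matrix.cons_val_zero, Matrix.cons_val_one,
          Matrix.cons_val_two, Matrix.head_cons, Matrix.tail_cons]
        have h3 := Real.log_mul (w.pos hc).ne' (gauss_pos w hF).ne'
        unfold gauss at h3
        rw [h1, h2, h3]
        linarith)
    have h3 : setHeight {c} = 0 := by
      rw [setHeight, absLogHeight, Height.logHeight_eq_zero_of_subsingleton, zero_div]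
    simp only [Fin.sum_univ_three, Matrix.cons_val_zero, Matrix.cons_val_one,
      Matrix.cons_val_two, Matrix.head_cons, Matrix.tail_cons] at h
    linarith
  refine le_antisymm (key c hc F hF) ?_
  have := key c⁻¹ (inv_ne_zero hc) (C c * F) (mul_ne_zero (C_ne_zero.mpr hc) hF)
  rwa [← mul_assoc, ← C_mul, inv_mul_cancel₀ hc, C_1, one_mul] at this

lemma setHeight_coeffs_of_associated {F G : MvPolynomial (Fin m) Qbar} (h : Associated F G)
    (hF : F ≠ 0) : setHeight F.coeffs = setHeight G.coeffs := by
  obtain ⟨u, rfl⟩ := h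
  obtain ⟨c, hc, hc'⟩ := isUnit_iff_eq_C_of_isReduced.mp u.isUnit
  rw [hc', mul_comm, setHeight_coeffs_C_mul hc.ne_zero hF]

lemma IsFormOf.ne_zero {D : EffDivisor m} {F : MvPolynomial (Fin m) Qbar} (h : IsFormOf D F) :
    F ≠ 0 := by
  obtain ⟨S, hS, -, h⟩ := h
  exact h.ne_zero_iff.mp (Multiset.prod_ne_zero fun h0 => (hS 0 h0).1.ne_zero rfl)

/-- By the Nullstellensatz `formOf` recovers each irreducible factor up to a constant, and heights
do not see constants. -/
lemma IsFormOf.divHeight_eq {D : EffDivisor m} {F : MvPolynomial (Fin m) Qbar}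
    (h : IsFormOf D F) : divHeight D = setHeight F.coeffs := by
  have h0 := h.ne_zero
  obtain ⟨S, hS, rfl, h⟩ := h
  rw [divHeight, formHeight_eq]
  refine setHeight_coeffs_of_associated (Associated.trans ?_ h) ?_
  · rw [Multiset.map_map]
    clear h h0
    induction S using Multiset.induction_on with
    | empty => simp
    | cons p S ih =>
      rw [Multiset.map_cons, Multiset.prod_cons, Multiset.prod_cons]
      obtain ⟨h1, e, h2⟩ := hS p (Multiset.mem_cons_self p S)
      exact (formOf_zeroLocus h1 h2).mul_mul
        (ih fun q hq => hS q (Multiset.mem_cons_of_mem hq))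
  · refine Multiset.prod_ne_zero fun hm => ?_
    rw [Multiset.map_map, Multiset.mem_map] at hm
    obtain ⟨p, hp, h0⟩ := hm
    obtain ⟨h1, e, h2⟩ := hS p hp
    exact h1.ne_zero ((formOf_zeroLocus h1 h2).eq_zero_iff.mp h0)

lemma IsFormOf.congr {D : EffDivisor m} {F G : MvPolynomial (Fin m) Qbar} (h : IsFormOf D F)
    (hFG : Associated F G) : IsFormOf D G := by
  obtain ⟨S, hS, hD, h⟩ := h
  exact ⟨S, hS, hD, h.trans hFG⟩

lemma IsFormOf.add {D D' : EffDivisor m} {F F' : MvPolynomial (Fin m) Qbar} (h : IsFormOf D F)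
    (h' : IsFormOf D' F') : IsFormOf (D + D') (F * F') := by
  obtain ⟨S, hS, rfl, h⟩ := h
  obtain ⟨S', hS', rfl, h'⟩ := h'
  refine ⟨S + S', fun p hp => ?_, (Multiset.map_add _ _ _).symm, ?_⟩
  · rcases Multiset.mem_add.mp hp with hp | hp
    exacts [hS p hp, hS' p hp]
  · rw [Multiset.prod_add]
    exact h.mul_mul h'

lemma isFormOf_divisorOf {F : MvPolynomial (Fin m) Qbar} (hF : F ≠ 0) (hF' : F.IsHomogeneous e) :
    IsFormOf (divisorOf F) F :=
  ⟨UniqueFactorizationMonoid.factors F, fun p hp =>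
    ⟨UniqueFactorizationMonoid.irreducible_of_factor p hp,
      isHomogeneous_of_dvd hF' hF (UniqueFactorizationMonoid.dvd_of_mem_factors hp)⟩, rfl,
    UniqueFactorizationMonoid.factors_prod hF⟩

end ZeroLoci

/-! ### The push-forward of divisors by the maps `𝐗 ↦ M 𝐗ᵈ` -/

section PowerMaps

open MvPolynomial

variable {m n d e : ℕ}

/-- The forms defining the map `𝐗 ↦ M 𝐗ᵈ`. -/
def powerMap (d : ℕ) (M : Matrix (Fin m) (Fin m) Qbar) : FormTuple m :=
  fun i => ∑ j, C (M i j) * X j ^ d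

lemma eval_powerMap (M : Matrix (Fin m) (Fin m) Qbar) (x : Fin m → Qbar) :
    (fun i => eval x (powerMap d M i)) = M.mulVec (x ^ d) := by
  ext i
  simp [powerMap, Matrix.mulVec, dotProduct]

lemma mulVec_pow_ne_zero {M : Matrix (Fin m) (Fin m) Qbar} (hM : IsUnit M.det)
    {x : Fin m → Qbar} (hx : x ≠ 0) : M.mulVec (x ^ d) ≠ 0 := by
  intro h
  have h1 : M⁻¹.mulVec (M.mulVec (x ^ d)) = 0 := by rw [h, Matrix.mulVec_zero]
  rw [Matrix.mulVec_mulVec, Matrix.nonsing_inv_mul M hM, Matrix.one_mulVec] at h1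
  exact hx (pow_eq_zero_iff_of_pos_pi h1)
where
  pow_eq_zero_iff_of_pos_pi {x : Fin m → Qbar} (h : x ^ d = 0) : x = 0 := by
    ext i
    exact eq_zero_of_pow_eq_zero (congrFun h i)

lemma exists_mulVec_pow_eq (hd : 0 < d) {M : Matrix (Fin m) (Fin m) Qbar} (hM : IsUnit M.det)
    (y : Fin m → Qbar) : ∃ x : Fin m → Qbar, M.mulVec (x ^ d) = y := by
  choose x hx using fun i => IsAlgClosed.exists_pow_nat_eq (M⁻¹.mulVec y i) hd
  refine ⟨x, ?_⟩
  have : x ^ d = M⁻¹.mulVec y := funext hx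
  rw [this, Matrix.mulVec_mulVec, Matrix.mul_nonsing_inv M hM, Matrix.one_mulVec]

lemma mulVec_smul_pow (M : Matrix (Fin m) (Fin m) Qbar) (a : Qbar) (x : Fin m → Qbar) :
    M.mulVec ((a • x) ^ d) = a ^ d • M.mulVec (x ^ d) := by
  rw [smul_pow, Matrix.mulVec_smul]

lemma projMap_mk {M : Matrix (Fin m) (Fin m) Qbar} (hM : IsUnit M.det) {x : Fin m → Qbar}
    (hx : x ≠ 0) : projMap (powerMap d M) (Projectivization.mk Qbar x hx) =
      Projectivization.mk Qbar (M.mulVec (x ^ d)) (mulVec_pow_ne_zero hM hx) := by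
  obtain ⟨a, ha⟩ := Projectivization.exists_smul_eq_mk_rep Qbar x hx
  have h := eval_powerMap (d := d) M (Projectivization.mk Qbar x hx).rep
  have h0 : (fun i => eval (Projectivization.mk Qbar x hx).rep (powerMap d M i)) ≠ 0 := by
    rw [h]
    exact mulVec_pow_ne_zero hM (Projectivization.rep_nonzero _)
  rw [projMap, dif_pos h0, Projectivization.mk_eq_mk_iff']
  refine ⟨(a : Qbar) ^ d, ?_⟩
  rw [h, ← ha, Units.smul_def, mulVec_smul_pow]

/-- After cancelling M, the d-th powers of the coordinates are proportional; `a` is a d-th root of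
the factor of proportionality. -/
lemma mk_mulVec_eq_iff (hd : 0 < d) {M : Matrix (Fin m) (Fin m) Qbar} (hM : IsUnit M.det)
    {x y : Fin m → Qbar} (hx : x ≠ 0) (hy : y ≠ 0) :
    projMap (powerMap d M) (Projectivization.mk Qbar y hy) =
      Projectivization.mk Qbar (M.mulVec (x ^ d)) (mulVec_pow_ne_zero hM hx) ↔
      ∃ a : Qbar, a ≠ 0 ∧ ∀ i, y i ^ d = (a * x i) ^ d := by
  rw [projMap_mk hM, Projectivization.mk_eq_mk_iff']
  constructor
  · rintro ⟨b, hb⟩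
    obtain ⟨a, ha⟩ := IsAlgClosed.exists_pow_nat_eq b hd
    have h1 : y ^ d = (a • x) ^ d := by
      rw [← ha, ← mulVec_smul_pow] at hb
      have := congrArg M⁻¹.mulVec hb
      rw [Matrix.mulVec_mulVec, Matrix.mulVec_mulVec, Matrix.nonsing_inv_mul M hM,
        Matrix.one_mulVec, Matrix.one_mulVec] at this
      exact this.symm
    refine ⟨a, ?_, fun i => congrFun h1 i⟩
    rintro rfl
    rw [zero_smul, zero_pow hd.ne'] at h1
    exact hy (funext fun i => eq_zero_of_pow_eq_zero (congrFun h1 i))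
  · rintro ⟨a, -, h⟩
    refine ⟨a ^ d, ?_⟩
    rw [← mulVec_smul_pow]
    congr 1
    exact (funext h : y ^ d = (a • x) ^ d).symm

lemma ne_zero_of_rootTuplesOn (hd : 0 < d) {J : Finset (Fin m)} {ζ : Fin m → Qbar}
    (hζ : ζ ∈ rootTuplesOn d J) (i) : ζ i ≠ 0 := by
  intro h
  have := ((mem_rootTuplesOn hd).mp hζ).1 i
  rw [h, zero_pow hd.ne'] at this
  exact zero_ne_one this

open Classical in
-- The fibre through x consists of the points ζ·x with ζ a tuple of d-th roots of unity. Fixing the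
-- entry at `i₀` removes the common scalar, and entries where x vanishes play no role, so the tuples
-- that are 1 on `J` parametrise the fibre without repetition.
lemma ncard_fiber (hd : 0 < d) {M : Matrix (Fin m) (Fin m) Qbar} (hM : IsUnit M.det)
    {F : MvPolynomial (Fin m) Qbar} (hF : F.IsHomogeneous e) {x : Fin m → Qbar} (hx : x ≠ 0)
    {J : Finset (Fin m)} {i₀ : Fin m} (hi₀ : i₀ ∈ J) (hxi₀ : x i₀ ≠ 0)
    (hJ : ∀ i ∈ J, i ≠ i₀ → x i = 0) (hJ' : ∀ i, i ∉ J → x i ≠ 0) :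
    {P ∈ zeroLocus F | projMap (powerMap d M) P =
      Projectivization.mk Qbar (M.mulVec (x ^ d)) (mulVec_pow_ne_zero hM hx)}.ncard =
      ((rootTuplesOn d J).filter fun ζ => eval (ζ * x) F = 0).card := by
  have hne : ∀ ζ ∈ rootTuplesOn d J, ζ * x ≠ 0 := fun ζ hζ h =>
    mul_ne_zero (ne_zero_of_rootTuplesOn hd hζ i₀) hxi₀ (congrFun h i₀)
  rw [← Set.ncard_coe_finset]
  symm
  refine Set.ncard_congr
    (fun ζ hζ => Projectivization.mk Qbar (ζ * x) (hne ζ (Finset.mem_filter.mp hζ).1)) ?_ ?_ ?_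
  · intro ζ hζ
    obtain ⟨h1, h2⟩ := Finset.mem_filter.mp hζ
    refine ⟨(mk_mem_zeroLocus hF _).mpr h2, ?_⟩
    rw [mk_mulVec_eq_iff hd hM hx]
    refine ⟨1, one_ne_zero, fun i => ?_⟩
    rw [Pi.mul_apply, mul_pow, ((mem_rootTuplesOn hd).mp h1).1 i]
    simp
  · intro ζ η hζ hη h
    have hζ' := (mem_rootTuplesOn hd).mp (Finset.mem_filter.mp hζ).1
    have hη' := (mem_rootTuplesOn hd).mp (Finset.mem_filter.mp hη).1
    obtain ⟨a, ha⟩ := (Projectivization.mk_eq_mk_iff' _ _ _ _ _).mp h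
    have h1 := congrFun ha i₀
    simp only [Pi.smul_apply, Pi.mul_apply, smul_eq_mul, hζ'.2 i₀ hi₀, hη'.2 i₀ hi₀] at h1
    have ha1 : a = 1 := by
      refine mul_right_cancel₀ hxi₀ ?_
      linear_combination h1
    subst ha1
    ext i
    by_cases hi : i ∈ J
    · rw [hζ'.2 i hi, hη'.2 i hi]
    · have h2 := congrFun ha i
      simp only [Pi.smul_apply, Pi.mul_apply, one_smul] at h2
      exact (mul_right_cancel₀ (hJ' i hi) h2).symm
  · rintro P ⟨hP1, hP2⟩
    induction P using Projectivization.ind with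
    | h y hy =>
    rw [mk_mem_zeroLocus hF] at hP1
    obtain ⟨a, ha, h⟩ := (mk_mulVec_eq_iff hd hM hx hy).mp hP2
    -- normalise so that `y i₀ = c * x i₀`
    have hyi₀ : y i₀ ≠ 0 := by
      intro h0
      have := h i₀
      rw [h0, zero_pow hd.ne'] at this
      exact pow_ne_zero d (mul_ne_zero ha hxi₀) this.symm
    set c : Qbar := y i₀ / x i₀ with hc
    have hc0 : c ≠ 0 := div_ne_zero hyi₀ hxi₀
    have hcd : c ^ d = a ^ d := by
      rw [hc, div_pow, h i₀, mul_pow, mul_div_assoc, div_self (pow_ne_zero d hxi₀), mul_one]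
    let ζ : Fin m → Qbar := fun i => if i ∈ J then 1 else y i / (c * x i)
    have hy0 : ∀ i ∈ J, i ≠ i₀ → y i = 0 := fun i hi hi' => by
      have := h i
      rw [hJ i hi hi', mul_zero, zero_pow hd.ne'] at this
      exact eq_zero_of_pow_eq_zero this
    have hyζ : y = c • (ζ * x) := by
      ext i
      simp only [Pi.smul_apply, Pi.mul_apply, smul_eq_mul, ζ]
      by_cases hi : i ∈ J
      · rw [if_pos hi, one_mul]
        by_cases hi' : i = i₀
        · subst hi'
          rw [hc, div_mul_cancel₀ _ hxi₀]
        · rw [hy0 i hi hi', hJ i hi hi', mul_zero]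
      · rw [if_neg hi]
        have := hJ' i hi
        field_simp
    have hζ : ζ ∈ rootTuplesOn d J := by
      rw [mem_rootTuplesOn hd]
      refine ⟨fun i => ?_, fun i hi => if_pos hi⟩
      simp only [ζ]
      split_ifs with hi
      · exact one_pow d
      · rw [div_pow, h i, mul_pow, mul_pow, hcd, div_self]
        exact mul_ne_zero (pow_ne_zero d ha) (pow_ne_zero d (hJ' i hi))
    refine ⟨ζ, Finset.mem_filter.mpr ⟨hζ, ?_⟩, ?_⟩
    · rw [hyζ, eval_smul_of_isHomogeneous hF] at hP1
      exact (mul_eq_zero.mp hP1).resolve_left (pow_ne_zero _ hc0)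
    · rw [Projectivization.mk_eq_mk_iff']
      exact ⟨c⁻¹, by rw [hyζ, smul_smul, inv_mul_cancel₀ hc0, one_smul]⟩

/-- The push-forward of a form by the map `𝐗 ↦ M 𝐗ᵈ`. -/
def pushForm (d : ℕ) (M : Matrix (Fin (n + 1)) (Fin (n + 1)) Qbar)
    (F : MvPolynomial (Fin (n + 1)) Qbar) : MvPolynomial (Fin (n + 1)) Qbar :=
  linSub M⁻¹ (normForm d F)

section

variable {M : Matrix (Fin (n + 1)) (Fin (n + 1)) Qbar} {F : MvPolynomial (Fin (n + 1)) Qbar}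

lemma pushForm_isHomogeneous (hd : 0 < d) (hn : 1 ≤ n) (hF : F.IsHomogeneous e) :
    (pushForm d M F).IsHomogeneous (d ^ (n - 1) * e) :=
  linSub_isHomogeneous _ (normForm_isHomogeneous hd hn hF)

lemma linSub_pushForm (hM : IsUnit M.det) : linSub M (pushForm d M F) = normForm d F := by
  rw [pushForm, ← linSub_mul, Matrix.nonsing_inv_mul M hM, linSub_one]

lemma pushForm_ne_zero (hd : 0 < d) (hn : 1 ≤ n) (hM : IsUnit M.det) (hF : F.IsHomogeneous e)
    (hF0 : F ≠ 0) : pushForm d M F ≠ 0 := by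
  intro h
  have := linSub_pushForm (d := d) (F := F) hM
  rw [h, map_zero] at this
  exact normForm_ne_zero hd hn hF hF0 this.symm

lemma pushForm_mul (hd : 0 < d) (hn : 1 ≤ n) {G : MvPolynomial (Fin (n + 1)) Qbar} {e' : ℕ}
    (hF : F.IsHomogeneous e) (hG : G.IsHomogeneous e') :
    pushForm d M (F * G) = pushForm d M F * pushForm d M G := by
  rw [pushForm, normForm_mul hd hn hF hG, map_mul, pushForm, pushForm]

lemma pushForm_C (hd : 0 < d) (hn : 1 ≤ n) (c : Qbar) :
    pushForm d M (C c) = C (c ^ d ^ n) := by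
  rw [pushForm, normForm_C hd hn, linSub, aeval_C, algebraMap_eq]

lemma pushForm_one (hd : 0 < d) (hn : 1 ≤ n) : pushForm d M 1 = 1 := by
  rw [← C_1, pushForm_C hd hn, one_pow]

lemma pushForm_associated (hd : 0 < d) (hn : 1 ≤ n) {G : MvPolynomial (Fin (n + 1)) Qbar}
    (hF : F.IsHomogeneous e) (h : Associated F G) :
    Associated (pushForm d M F) (pushForm d M G) := by
  obtain ⟨u, rfl⟩ := h
  obtain ⟨c, hc, hc'⟩ := isUnit_iff_eq_C_of_isReduced.mp u.isUnit
  rw [hc', pushForm_mul hd hn hF (isHomogeneous_C _ c), pushForm_C hd hn]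
  exact associated_mul_unit_right _ _ ((hc.pow _).map C)

/-- The push-forward at the image of x is the norm of F at x. Since 𝐗 ↦ M 𝐗ᵈ is surjective on
vectors, this formula determines the push-forward, and identities between forms are checked through
it. -/
lemma eval_pushForm (hd : 0 < d) (hn : 1 ≤ n) (hM : IsUnit M.det) (hF : F.IsHomogeneous e)
    (x : Fin (n + 1) → Qbar) : eval (M.mulVec (x ^ d)) (pushForm d M F) =
      ∏ ζ ∈ rootTuples d n, eval (ζ * x) F := by
  rw [← eval_linSub, linSub_pushForm hM]
  have h1 : eval (x ^ d) (normForm d F) = eval x (expand d (normForm d F)) := by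
    rw [eval_expand]
  rw [h1, expand_normForm hd hn hF, normProd, eval_prod]
  exact Finset.prod_congr rfl fun ζ _ => eval_twist ζ x F

lemma eval_pushForm_eq_zero (hd : 0 < d) (hn : 1 ≤ n) (hM : IsUnit M.det)
    (hF : F.IsHomogeneous e) {x : Fin (n + 1) → Qbar} (hx : eval x F = 0) :
    eval (M.mulVec (x ^ d)) (pushForm d M F) = 0 := by
  rw [eval_pushForm hd hn hM hF]
  exact Finset.prod_eq_zero (one_mem_rootTuples hd) (by rwa [one_mul])

lemma image_zeroLocus (hd : 0 < d) (hn : 1 ≤ n) (hM : IsUnit M.det) (hF : F.IsHomogeneous e) :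
    projMap (powerMap d M) '' zeroLocus F = zeroLocus (pushForm d M F) := by
  ext Q
  have hG := pushForm_isHomogeneous (M := M) hd hn hF
  constructor
  · rintro ⟨P, hP, rfl⟩
    induction P using Projectivization.ind with
    | h x hx =>
    rw [projMap_mk hM hx, mk_mem_zeroLocus hG]
    exact eval_pushForm_eq_zero hd hn hM hF ((mk_mem_zeroLocus hF hx).mp hP)
  · induction Q using Projectivization.ind with
    | h y hy =>
    intro hQ
    rw [mk_mem_zeroLocus hG] at hQ
    obtain ⟨x, rfl⟩ := exists_mulVec_pow_eq hd hM y
    rw [eval_pushForm hd hn hM hF, Finset.prod_eq_zero_iff] at hQ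
    obtain ⟨ζ, hζ, h⟩ := hQ
    have hx : x ≠ 0 := by
      rintro rfl
      rw [zero_pow hd.ne', Matrix.mulVec_zero] at hy
      exact hy rfl
    have hζx : ζ * x ≠ 0 := fun h0 => hx (funext fun i =>
      (mul_eq_zero.mp (congrFun h0 i)).resolve_left (rootTuples_ne_zero hd hζ i))
    refine ⟨Projectivization.mk Qbar (ζ * x) hζx, (mk_mem_zeroLocus hF hζx).mpr h, ?_⟩
    rw [mk_mulVec_eq_iff hd hM hx]
    refine ⟨1, one_ne_zero, fun i => ?_⟩
    rw [Pi.mul_apply, mul_pow, ((mem_rootTuples hd).mp hζ).1 i, one_mul, one_mul]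

lemma twist_expand (hd : 0 < d) {ζ : Fin (n + 1) → Qbar} (hζ : ζ ∈ rootTuples d n)
    (G : MvPolynomial (Fin (n + 1)) Qbar) : twist ζ (expand d G) = expand d G := by
  refine MvPolynomial.funext fun x => ?_
  rw [eval_twist, eval_expand, eval_expand]
  refine congrArg (fun y => eval y G) (funext fun i => ?_)
  simp only [Pi.pow_apply, mul_pow, ((mem_rootTuples hd).mp hζ).1 i, one_mul]

lemma irreducible_twist (hd : 0 < d) {ζ : Fin (n + 1) → Qbar} (hζ : ζ ∈ rootTuples d n)
    (hF : Irreducible F) : Irreducible (twist ζ F) := by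
  have hinv : ζ⁻¹ * ζ = 1 := by
    ext i
    simp [inv_mul_cancel₀ (rootTuples_ne_zero hd hζ i)]
  let E : MvPolynomial (Fin (n + 1)) Qbar ≃ₐ[Qbar] MvPolynomial (Fin (n + 1)) Qbar :=
    AlgEquiv.ofAlgHom (twist ζ) (twist ζ⁻¹)
      (AlgHom.ext fun G => by
        rw [AlgHom.comp_apply, twist_twist, mul_comm, hinv, twist_one]; rfl)
      (AlgHom.ext fun G => by rw [AlgHom.comp_apply, twist_twist, hinv, twist_one]; rfl)
  exact (MulEquiv.irreducible_iff E.toMulEquiv (x := F)).mpr hF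

lemma irreducible_linSub {p : ℕ} {B : Matrix (Fin p) (Fin p) Qbar} (hB : IsUnit B.det)
    {F : MvPolynomial (Fin p) Qbar} (hF : Irreducible F) : Irreducible (linSub B F) := by
  let E : MvPolynomial (Fin p) Qbar ≃ₐ[Qbar] MvPolynomial (Fin p) Qbar :=
    AlgEquiv.ofAlgHom (linSub B) (linSub B⁻¹)
      (AlgHom.ext fun G => by
        rw [AlgHom.comp_apply, ← linSub_mul, Matrix.nonsing_inv_mul B hB, linSub_one]; rfl)
      (AlgHom.ext fun G => by
        rw [AlgHom.comp_apply, ← linSub_mul, Matrix.mul_nonsing_inv B hB, linSub_one]; rfl)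
  exact (MulEquiv.irreducible_iff E.toMulEquiv (x := F)).mpr hF

/-- The conjugates of an irreducible form divide the pull-back of every factor of its
push-forward. -/
lemma twist_dvd_expand (hd : 0 < d) (hn : 1 ≤ n) (hM : IsUnit M.det) (hF : F.IsHomogeneous e)
    (hFi : Irreducible F) {P : MvPolynomial (Fin (n + 1)) Qbar} (hP : Irreducible P)
    (hPd : P ∣ pushForm d M F) {η : Fin (n + 1) → Qbar} (hη : η ∈ rootTuples d n) :
    twist η F ∣ expand d (linSub M P) := by
  have hG := pushForm_isHomogeneous (M := M) hd hn hF
  obtain ⟨e', hP'⟩ := isHomogeneous_of_dvd hG (pushForm_ne_zero hd hn hM hF hFi.ne_zero) hPd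
  have h1 : expand d (linSub M P) ∣ normProd d F := by
    rw [← expand_normForm hd hn hF, ← linSub_pushForm (M := M) hM]
    exact map_dvd _ (map_dvd _ hPd)
  have h2 : ¬IsUnit (expand d (linSub M P)) := by
    refine not_isUnit_of_eval_eq_zero (x := 0) ?_
    rw [eval_expand, zero_pow hd.ne', eval_linSub, Matrix.mulVec_zero,
      eval_zero_of_isHomogeneous hP' (degree_pos_of_irreducible hP hP')]
  have h3 : expand d (linSub M P) ≠ 0 := ne_zero_of_dvd_ne_zero (normProd_ne_zero hd hFi.ne_zero) h1
  -- An irreducible factor of the pull-back of P is, up to a unit, one of the conjugates of F. The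
  -- pull-back is invariant under the Galois group, which permutes the conjugates transitively, so
  -- all of them divide it.
  obtain ⟨q, hq, hqd⟩ := WfDvdMonoid.exists_irreducible_factor h2 h3
  obtain ⟨ζ, hζ, hqζ⟩ := (Prime.dvd_finsetProd_iff hq.prime _).mp (hqd.trans h1)
  have h4 : twist ζ F ∣ expand d (linSub M P) :=
    ((hq.associated_of_dvd (irreducible_twist hd hζ hFi) hqζ).symm.dvd).trans hqd
  have h5 := map_dvd (twist (η * ζ⁻¹)) h4
  have hinv : η * ζ⁻¹ * ζ = η := by
    ext i
    simp [mul_assoc, inv_mul_cancel₀ (rootTuples_ne_zero hd hζ i)]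
  rwa [twist_twist, twist_expand hd (mul_mem_rootTuples hd hη (inv_mem_rootTuples hd hζ)),
    hinv] at h5

lemma eval_eq_zero_iff_of_dvd_pushForm (hd : 0 < d) (hn : 1 ≤ n) (hM : IsUnit M.det)
    (hF : F.IsHomogeneous e) (hFi : Irreducible F) {P : MvPolynomial (Fin (n + 1)) Qbar}
    (hP : Irreducible P) (hPd : P ∣ pushForm d M F) (y : Fin (n + 1) → Qbar) :
    eval y P = 0 ↔ eval y (pushForm d M F) = 0 := by
  constructor
  · intro h
    obtain ⟨Q, hQ⟩ := hPd
    rw [hQ, map_mul, h, zero_mul]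
  · intro h
    obtain ⟨x, rfl⟩ := exists_mulVec_pow_eq hd hM y
    rw [eval_pushForm hd hn hM hF, Finset.prod_eq_zero_iff] at h
    obtain ⟨ζ, hζ, h⟩ := h
    obtain ⟨Q, hQ⟩ := twist_dvd_expand hd hn hM hF hFi hP hPd hζ
    have := congrArg (eval x) hQ
    rw [map_mul, eval_twist] at this
    change eval (fun i => ζ i * x i) F = 0 at h
    rwa [h, zero_mul, eval_expand, eval_linSub] at this

/-- The push-forward of an irreducible form is a power of an irreducible form. -/
lemma exists_associated_pow_pushForm (hd : 0 < d) (hn : 1 ≤ n) (hM : IsUnit M.det)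
    (hF : F.IsHomogeneous e) (hFi : Irreducible F) :
    ∃ (P : MvPolynomial (Fin (n + 1)) Qbar) (r e' : ℕ), Irreducible P ∧ P.IsHomogeneous e' ∧
      P ∣ pushForm d M F ∧ Associated (P ^ r) (pushForm d M F) := by
  have hG := pushForm_isHomogeneous (M := M) hd hn hF
  have hG0 := pushForm_ne_zero hd hn hM hF hFi.ne_zero
  have hGu : ¬IsUnit (pushForm d M F) := by
    refine not_isUnit_of_eval_eq_zero (x := 0) (eval_zero_of_isHomogeneous hG ?_)
    exact Nat.mul_pos (Nat.pow_pos hd) (degree_pos_of_irreducible hFi hF)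
  obtain ⟨P, hP, hPd⟩ := WfDvdMonoid.exists_irreducible_factor hGu hG0
  obtain ⟨e', hP'⟩ := isHomogeneous_of_dvd hG hG0 hPd
  refine ⟨P, (UniqueFactorizationMonoid.factors (pushForm d M F)).card, e', hP, hP', hPd,
    Associated.trans ?_ (UniqueFactorizationMonoid.factors_prod hG0)⟩
  have : ∀ S : Multiset (MvPolynomial (Fin (n + 1)) Qbar), (∀ q ∈ S, Associated P q) →
      Associated (P ^ S.card) S.prod := by
    intro S
    induction S using Multiset.induction_on with
    | empty => intro; simp
    | cons q S ih =>
      intro h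
      rw [Multiset.card_cons, Multiset.prod_cons, pow_succ']
      exact (h q (Multiset.mem_cons_self q S)).mul_mul
        (ih fun q' hq' => h q' (Multiset.mem_cons_of_mem hq'))
  -- Every irreducible factor vanishes exactly where the push-forward does, so any two are
  -- associated by the Nullstellensatz.
  refine this _ fun q hq => ?_
  have hqi := UniqueFactorizationMonoid.irreducible_of_factor q hq
  refine associated_of_eval hP hqi fun x => ?_
  rw [eval_eq_zero_iff_of_dvd_pushForm hd hn hM hF hFi hP hPd,
    eval_eq_zero_iff_of_dvd_pushForm hd hn hM hF hFi hqi
      (UniqueFactorizationMonoid.dvd_of_mem_factors hq)]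

end

/-- Two nonempty open subsets of an irreducible hypersurface meet, so two generic fibre
cardinalities agree and the set whose infimum is `mapDegree` is a singleton. -/
lemma mapDegree_eq {f : PSpace m → PSpace m} {Z : Set (PSpace m)} {P : MvPolynomial (Fin m) Qbar}
    (hP : Irreducible P) (hP' : P.IsHomogeneous e) (hZ : f '' Z = zeroLocus P)
    {s : MvPolynomial (Fin m) Qbar} {k : ℕ} (hs : s.IsHomogeneous k) (hk : 0 < k) (hPs : ¬P ∣ s)
    {r : ℕ} (h : ∀ Q ∈ zeroLocus P, Q ∉ zeroLocus s → {p ∈ Z | f p = Q}.ncard = r) :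
    mapDegree f Z = r := by
  have key : ∀ (t : MvPolynomial (Fin m) Qbar) (k' : ℕ), t.IsHomogeneous k' → ¬P ∣ t →
      ∃ Q ∈ zeroLocus P, Q ∉ zeroLocus s ∧ Q ∉ zeroLocus t := by
    intro t k' ht hPt
    have h1 : ¬P ∣ s * t := fun h2 => (hP.prime.dvd_or_dvd h2).elim hPs hPt
    have h2 : ∃ x, eval x P = 0 ∧ eval x (s * t) ≠ 0 := by
      by_contra! h3
      exact h1 (dvd_of_eval_eq_zero hP h3)
    obtain ⟨x, hx, hx'⟩ := h2
    rw [map_mul] at hx'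
    have hx0 : x ≠ 0 := by
      rintro rfl
      rw [eval_zero_of_isHomogeneous hs hk, zero_mul] at hx'
      exact hx' rfl
    exact ⟨Projectivization.mk Qbar x hx0, (mk_mem_zeroLocus hP' hx0).mpr hx,
      fun h => left_ne_zero_of_mul hx' ((mk_mem_zeroLocus hs hx0).mp h),
      fun h => right_ne_zero_of_mul hx' ((mk_mem_zeroLocus ht hx0).mp h)⟩
  have hset : {n : ℕ | ∃ (s : MvPolynomial (Fin m) Qbar) (e : ℕ), s.IsHomogeneous e ∧
      (∃ Q ∈ f '' Z, Q ∉ zeroLocus s) ∧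
      ∀ Q ∈ f '' Z, Q ∉ zeroLocus s → {P ∈ Z | f P = Q}.ncard = n} = {r} := by
    ext r'
    simp only [Set.mem_ofPred_eq, Set.mem_singleton_iff]
    rw [hZ]
    constructor
    · rintro ⟨t, k', ht, ⟨Q, hQ, hQt⟩, h'⟩
      have hPt : ¬P ∣ t := by
        rintro ⟨u, rfl⟩
        refine hQt ?_
        change eval Q.rep (P * u) = 0
        rw [map_mul, (show eval Q.rep P = 0 from hQ), zero_mul]
      obtain ⟨Q', hQ', h1, h2⟩ := key t k' ht hPt
      rw [← h' Q' hQ' h2, h Q' hQ' h1]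
    · rintro rfl
      obtain ⟨Q, hQ, h1, -⟩ := key s k hs hPs
      exact ⟨s, k, hs, ⟨Q, hQ, h1⟩, h⟩
  rw [mapDegree, hset, csInf_singleton]

end PowerMaps

/-! ### The multiplicity of a push-forward as a mapping degree -/

section MapDegree

open MvPolynomial

variable {m n d e : ℕ}

lemma derivative_aeval (θ : Fin m → Polynomial Qbar) (F : MvPolynomial (Fin m) Qbar) :
    Polynomial.derivative (aeval θ F) =
      ∑ k, aeval θ (pderiv k F) * Polynomial.derivative (θ k) := by
  classical
  induction F using MvPolynomial.induction_on with
  | C a => simp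
  | add p q hp hq =>
    simp only [map_add, hp, hq, add_mul, Finset.sum_add_distrib]
  | mul_X p i hp =>
    have h1 : ∀ k, aeval θ (pderiv k (p * X i)) * Polynomial.derivative (θ k) =
        aeval θ (pderiv k p) * Polynomial.derivative (θ k) * θ i +
          if k = i then aeval θ p * Polynomial.derivative (θ i) else 0 := by
      intro k
      rw [pderiv_mul, map_add, map_mul, map_mul, aeval_X]
      split_ifs with h
      · subst h
        rw [pderiv_X_self, map_one]
        ring
      · rw [pderiv_X_of_ne (Ne.symm h), map_zero]
        ring
    rw [map_mul, aeval_X, Polynomial.derivative_mul, hp, Finset.sum_congr rfl fun k _ => h1 k,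
      Finset.sum_add_distrib, Finset.sum_mul, Finset.sum_ite_eq' Finset.univ i,
      if_pos (Finset.mem_univ i)]

/-- Euler's identity in characteristic zero gives a nonzero partial derivative, whose degree is too
small for divisibility by P. -/
lemma exists_pderiv_not_dvd {P : MvPolynomial (Fin m) Qbar} (hP : Irreducible P)
    (hP' : P.IsHomogeneous e) : ∃ i, pderiv i P ≠ 0 ∧ ¬P ∣ pderiv i P := by
  have he := degree_pos_of_irreducible hP hP'
  have h1 := hP'.sum_X_mul_pderiv
  have h2 : ∃ i, pderiv i P ≠ 0 := by
    by_contra! h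
    rw [Finset.sum_eq_zero fun i _ => by rw [h i, mul_zero]] at h1
    have := h1.symm
    rw [nsmul_eq_mul, mul_eq_zero] at this
    rcases this with h3 | h3
    · exact he.ne' (by exact_mod_cast h3)
    · exact hP.ne_zero h3
  obtain ⟨i, hi⟩ := h2
  refine ⟨i, hi, fun hd => ?_⟩
  have h3 : (pderiv i P).IsHomogeneous (e - 1) := hP'.pderiv
  have h4 := totalDegree_le_of_dvd_of_isDomain hd hi
  rw [hP'.totalDegree hP.ne_zero, h3.totalDegree hi] at h4
  omega

variable {M : Matrix (Fin (n + 1)) (Fin (n + 1)) Qbar} {F : MvPolynomial (Fin (n + 1)) Qbar}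

open Classical in
/-- At a general point of the image, the number of conjugates of `F` through a preimage is the
multiplicity of the push-forward. -/
lemma card_filter_eq (hd : 0 < d) (hn : 1 ≤ n) (hM : IsUnit M.det) (hF : F.IsHomogeneous e)
    (hFi : Irreducible F) {P : MvPolynomial (Fin (n + 1)) Qbar} {r : ℕ} (hP : Irreducible P)
    (hPd : P ∣ pushForm d M F) (hr : Associated (P ^ r) (pushForm d M F))
    {x : Fin (n + 1) → Qbar} (hx : ∀ l, x l ≠ 0) (hPx : eval (M.mulVec (x ^ d)) P = 0)
    {i : Fin (n + 1)} (hi : eval (M.mulVec (x ^ d)) (pderiv i P) ≠ 0) :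
    ((rootTuples d n).filter fun ζ => eval (ζ * x) F = 0).card = r := by
  -- The direction `u` at x is chosen so that the image of the line x + uT has velocity the i-th
  -- unit vector at T = 0. Pulling P back to this line gives a polynomial `p` with derivative ∂ᵢP ≠
  -- 0 at 0, hence a simple zero there.
  let u : Fin (n + 1) → Qbar := fun l => M⁻¹ l i / (d * x l ^ (d - 1))
  have hdQ : (d : Qbar) ≠ 0 := Nat.cast_ne_zero.mpr hd.ne'
  let φ : MvPolynomial (Fin (n + 1)) Qbar →ₐ[Qbar] Polynomial Qbar :=
    aeval fun l => Polynomial.C (x l) + Polynomial.C (u l) * Polynomial.X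
  have hφ0 : ∀ G, (φ G).eval 0 = eval x G := by
    intro G
    have : (Polynomial.evalRingHom 0).comp φ.toRingHom = eval x := by
      ext l
      · simp [φ]
      · simp [φ]
    exact congrArg (fun f : _ →+* Qbar => f G) this
  let θ : Fin (n + 1) → Polynomial Qbar := fun k =>
    ∑ l, Polynomial.C (M k l) * (Polynomial.C (x l) + Polynomial.C (u l) * Polynomial.X) ^ d
  have hφp : φ (expand d (linSub M P)) = aeval θ P := by
    have : (φ.comp ((expand d).comp (linSub M))) = aeval θ := by
      ext k
      simp [φ, θ, linSub]
    exact congrArg (fun f : _ →ₐ[Qbar] _ => f P) this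
  set p := φ (expand d (linSub M P)) with hp
  have hp0 : p.eval 0 = 0 := by
    rw [hp, hφ0, eval_expand, eval_linSub, hPx]
  have hθ0 : ∀ G, (aeval θ G).eval 0 = eval (M.mulVec (x ^ d)) G := by
    intro G
    have : (Polynomial.evalRingHom 0).comp (aeval θ).toRingHom = eval (M.mulVec (x ^ d)) := by
      ext l
      · simp
      · simp [θ, Polynomial.eval_finsetSum, Matrix.mulVec, dotProduct]
    exact congrArg (fun f : _ →+* Qbar => f G) this
  have hθ1 : ∀ k, (θ k).derivative.eval 0 = (M * M⁻¹) k i := by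
    intro k
    simp only [θ, Polynomial.derivative_sum, Polynomial.eval_finsetSum, Matrix.mul_apply]
    refine Finset.sum_congr rfl fun l _ => ?_
    have h1 : (d : Qbar) * x l ^ (d - 1) * u l = M⁻¹ l i :=
      mul_div_cancel₀ _ (mul_ne_zero hdQ (pow_ne_zero _ (hx l)))
    rw [← h1]
    simp [Polynomial.derivative_pow]
  have hp1 : p.derivative.eval 0 = eval (M.mulVec (x ^ d)) (pderiv i P) := by
    rw [hφp, derivative_aeval, Polynomial.eval_finsetSum, Finset.sum_eq_single i]
    · rw [Polynomial.eval_mul, hθ0]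
      rw [hθ1, Matrix.mul_nonsing_inv M hM, Matrix.one_apply_eq, mul_one]
    · intro k _ hk
      rw [Polynomial.eval_mul, hθ1, Matrix.mul_nonsing_inv M hM, Matrix.one_apply_ne hk, mul_zero]
    · simp
  have hpne : p ≠ 0 := by
    intro h
    rw [h] at hp1
    simp only [Polynomial.derivative_zero, Polynomial.eval_zero] at hp1
    exact hi hp1.symm
  have hroot : p.rootMultiplicity 0 = 1 := by
    refine le_antisymm ?_ ((Polynomial.rootMultiplicity_pos hpne).mpr hp0)
    by_contra! h
    have := (Polynomial.one_lt_rootMultiplicity_iff_isRoot hpne).mp h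
    exact hi (hp1 ▸ this.2)
  -- the multiplicity at `0` of the conjugates
  have hζ : ∀ ζ ∈ rootTuples d n, (φ (twist ζ F)).rootMultiplicity 0 =
      if eval (ζ * x) F = 0 then 1 else 0 := by
    intro ζ hζ
    have h1 : φ (twist ζ F) ∣ p := map_dvd φ (twist_dvd_expand hd hn hM hF hFi hP hPd hζ)
    have h2 : φ (twist ζ F) ≠ 0 := ne_zero_of_dvd_ne_zero hpne h1
    have h3 := Polynomial.rootMultiplicity_le_rootMultiplicity_of_dvd hpne h1 0
    have h4 : (φ (twist ζ F)).eval 0 = eval (ζ * x) F := by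
      rw [hφ0, eval_twist]; rfl
    split_ifs with h
    · exact le_antisymm (h3.trans hroot.le)
        ((Polynomial.rootMultiplicity_pos h2).mpr (h4.trans h))
    · exact Polynomial.rootMultiplicity_eq_zero fun h5 => h (h4.symm.trans h5)
  -- Compare orders of vanishing at 0: the left side has order `r`, and each conjugate on the right
  -- contributes 1 or 0 according to whether it passes through x.
  have hprod : Associated (p ^ r) (∏ ζ ∈ rootTuples d n, φ (twist ζ F)) := by
    have h1 := hr.map (φ.comp ((expand d).comp (linSub M)) : _ →* Polynomial Qbar)
    rw [map_pow] at h1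
    have h2 : ∏ ζ ∈ rootTuples d n, φ (twist ζ F) =
        φ (expand d (linSub M (pushForm d M F))) := by
      rw [linSub_pushForm hM, expand_normForm hd hn hF, normProd, map_prod]
    rw [h2]
    exact h1
  have hmul : ∀ (s : Finset (Fin (n + 1) → Qbar)), s ⊆ rootTuples d n →
      (∏ ζ ∈ s, φ (twist ζ F)) ≠ 0 ∧ (∏ ζ ∈ s, φ (twist ζ F)).rootMultiplicity 0 =
      (s.filter fun ζ => eval (ζ * x) F = 0).card := by
    intro s
    induction s using Finset.induction_on with
    | empty =>
      intro _
      simp only [Finset.prod_empty, Finset.filter_empty, Finset.card_empty]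
      exact ⟨one_ne_zero, Polynomial.rootMultiplicity_eq_zero (by simp)⟩
    | insert a s ha ih =>
      intro h
      have ha' : a ∈ rootTuples d n := h (Finset.mem_insert_self a s)
      obtain ⟨h1, h2⟩ := ih fun _ hb => h (Finset.mem_insert_of_mem hb)
      have h3 : φ (twist a F) ≠ 0 := ne_zero_of_dvd_ne_zero hpne
        (map_dvd φ (twist_dvd_expand hd hn hM hF hFi hP hPd ha'))
      rw [Finset.prod_insert ha]
      refine ⟨mul_ne_zero h3 h1, ?_⟩
      rw [Polynomial.rootMultiplicity_mul (mul_ne_zero h3 h1), h2, hζ a ha', Finset.filter_insert]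
      split_ifs with h4
      · rw [Finset.card_insert_of_notMem (fun hm => ha (Finset.mem_filter.mp hm).1), add_comm]
      · rw [zero_add]
  have hpow : ∀ k : ℕ, (p ^ k).rootMultiplicity 0 = k := by
    intro k
    rw [← Polynomial.count_roots, Polynomial.roots_pow, Multiset.count_nsmul,
      Polynomial.count_roots, hroot, mul_one]
  have h1 := (hmul _ Finset.Subset.rfl)
  have h2 := Polynomial.rootMultiplicity_le_rootMultiplicity_of_dvd h1.1 hprod.dvd 0
  have h3 := Polynomial.rootMultiplicity_le_rootMultiplicity_of_dvd (pow_ne_zero r hpne)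
    hprod.symm.dvd 0
  rw [← h1.2, le_antisymm h3 h2, hpow]

/-- The linear forms `(M⁻¹ X)_j`. -/
lemma eval_linSub_inv_X (hM : IsUnit M.det) (x : Fin (n + 1) → Qbar) (j : Fin (n + 1)) :
    eval (M.mulVec (x ^ d)) (linSub M⁻¹ (X j)) = x j ^ d := by
  rw [eval_linSub, Matrix.mulVec_mulVec, Matrix.nonsing_inv_mul M hM, Matrix.one_mulVec, eval_X,
    Pi.pow_apply]

lemma irreducible_linSub_X (hM : IsUnit M.det) (j : Fin (n + 1)) :
    Irreducible (linSub M⁻¹ (X j)) :=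
  irreducible_linSub ((Matrix.isUnit_nonsing_inv_det_iff).mpr hM) (X_prime (R := Qbar) (i := j)).irreducible

/-- If F is not a coordinate, a general point of the image has only preimages with nonzero
coordinates, and `card_filter_eq` counts those on F. A coordinate hyperplane lies in the branch
locus of the map and is treated directly: all conjugates coincide up to units, and the general fibre
has d^(n-1) points. -/
lemma mapDegree_pushForm (hd : 0 < d) (hn : 1 ≤ n) (hM : IsUnit M.det) (hF : F.IsHomogeneous e)
    (hFi : Irreducible F) {P : MvPolynomial (Fin (n + 1)) Qbar} {r e' : ℕ} (hP : Irreducible P)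
    (hP' : P.IsHomogeneous e')
    (hPd : P ∣ pushForm d M F) (hr : Associated (P ^ r) (pushForm d M F)) :
    projMap (powerMap d M) '' zeroLocus F = zeroLocus P ∧
      mapDegree (projMap (powerMap d M)) (zeroLocus F) = r := by
  classical
  have hG := pushForm_isHomogeneous (M := M) hd hn hF
  have himg : projMap (powerMap d M) '' zeroLocus F = zeroLocus P := by
    rw [image_zeroLocus hd hn hM hF]
    ext Q
    exact (eval_eq_zero_iff_of_dvd_pushForm hd hn hM hF hFi hP hPd Q.rep).symm
  refine ⟨himg, ?_⟩
  let ℓ : Fin (n + 1) → MvPolynomial (Fin (n + 1)) Qbar := fun j => linSub M⁻¹ (X j)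
  have hℓ : ∀ j, (ℓ j).IsHomogeneous 1 := fun j => linSub_isHomogeneous _ (isHomogeneous_X _ _)
  have hPF : ∀ x, eval x F = 0 → eval (M.mulVec (x ^ d)) P = 0 := fun x hx =>
    (eval_eq_zero_iff_of_dvd_pushForm hd hn hM hF hFi hP hPd _).mpr
      (eval_pushForm_eq_zero hd hn hM hF hx)
  have hprime : ∀ {a b}, ¬P ∣ a → ¬P ∣ b → ¬P ∣ a * b := fun ha hb h =>
    (hP.prime.dvd_or_dvd h).elim ha hb
  by_cases hX : ∃ j, Associated F (X j)
  · obtain ⟨j, hj⟩ := hX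
    have hF0 : ∀ x : Fin (n + 1) → Qbar, eval x F = 0 ↔ x j = 0 := fun x => by
      rw [eval_eq_zero_iff_of_associated hj, eval_X]
    have he : e = 1 := by
      rw [← hF.totalDegree hFi.ne_zero]
      have := isHomogeneous_of_associated hj.symm (isHomogeneous_X Qbar j)
      exact this.totalDegree hFi.ne_zero
    have hPℓ : Associated P (ℓ j) := by
      refine associated_of_eval hP (irreducible_linSub_X hM j) fun y => ?_
      obtain ⟨x, rfl⟩ := exists_mulVec_pow_eq hd hM y
      rw [eval_linSub_inv_X hM, eval_eq_zero_iff_of_dvd_pushForm hd hn hM hF hFi hP hPd,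
        eval_pushForm hd hn hM hF, Finset.prod_eq_zero_iff, pow_eq_zero_iff hd.ne']
      constructor
      · rintro ⟨ζ, hζ, h⟩
        rw [hF0] at h
        exact (mul_eq_zero.mp h).resolve_left (rootTuples_ne_zero hd hζ j)
      · intro h
        refine ⟨1, one_mem_rootTuples hd, ?_⟩
        rw [hF0, one_mul, h]
    have he' : e' = 1 := by
      rw [← hP'.totalDegree hP.ne_zero]
      exact (isHomogeneous_of_associated hPℓ.symm (hℓ j)).totalDegree hP.ne_zero
    -- Since F and P both have degree 1, the exponent is the degree of the push-forward.
    have hr' : r = d ^ (n - 1) := by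
      have h1 := isHomogeneous_of_associated hr (hP'.pow r)
      have h2 := h1.totalDegree (pushForm_ne_zero hd hn hM hF hFi.ne_zero)
      rw [hG.totalDegree (pushForm_ne_zero hd hn hM hF hFi.ne_zero), he, he'] at h2
      omega
    have hnd : ∀ l, l ≠ j → ¬P ∣ ℓ l := by
      intro l hl h
      obtain ⟨Q, hQ⟩ := hPℓ.symm.dvd.trans h
      have h1 := congrArg (eval (M.mulVec ((Pi.single l 1 : Fin (n + 1) → Qbar) ^ d))) hQ
      rw [map_mul, eval_linSub_inv_X hM, eval_linSub_inv_X hM, Pi.single_eq_same,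
        Pi.single_eq_of_ne (Ne.symm hl), zero_pow hd.ne', one_pow, zero_mul] at h1
      exact one_ne_zero h1
    have hs : ¬P ∣ ∏ l ∈ Finset.univ.erase j, ℓ l := by
      intro h
      obtain ⟨l, hl, h⟩ := (Prime.dvd_finsetProd_iff hP.prime _).mp h
      exact hnd l (Finset.ne_of_mem_erase hl) h
    have hs' : (∏ l ∈ Finset.univ.erase j, ℓ l).IsHomogeneous n := by
      have := IsHomogeneous.prod (Finset.univ.erase j) ℓ (fun _ => 1) fun l _ => hℓ l
      simpa [Finset.card_erase_of_mem] using this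
    refine mapDegree_eq hP hP' himg hs' hn hs fun Q hQ hQs => ?_
    induction Q using Projectivization.ind with
    | h y hy =>
    rw [mk_mem_zeroLocus hP'] at hQ
    rw [mk_mem_zeroLocus hs'] at hQs
    obtain ⟨x, rfl⟩ := exists_mulVec_pow_eq hd hM y
    rw [eval_eq_zero_iff_of_associated hPℓ, eval_linSub_inv_X hM, pow_eq_zero_iff hd.ne'] at hQ
    rw [map_prod, ← ne_eq, Finset.prod_ne_zero_iff] at hQs
    have hxl : ∀ l, l ≠ j → x l ≠ 0 := fun l hl h => by
      refine hQs l (Finset.mem_erase.mpr ⟨hl, Finset.mem_univ l⟩) ?_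
      rw [eval_linSub_inv_X hM, h, zero_pow hd.ne']
    have : Nontrivial (Fin (n + 1)) := Fin.nontrivial_iff_two_le.mpr (by omega)
    obtain ⟨i₀, hi₀⟩ := exists_ne j
    have hx : x ≠ 0 := fun h => hxl i₀ hi₀ (congrFun h i₀)
    -- Of the n + 1 entries, `i₀` fixes the scalar and `j` is where x vanishes, which leaves n - 1
    -- free roots of unity.
    have h1 := ncard_fiber hd hM hF hx (J := {i₀, j}) (i₀ := i₀) (by simp) (hxl i₀ hi₀)
      (fun i hi hi' => by
        rcases Finset.mem_insert.mp hi with h | h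
        · exact absurd h hi'
        · rw [Finset.mem_singleton.mp h, hQ])
      (fun i hi => hxl i fun h => hi (by simp [h]))
    rw [h1, Finset.filter_true_of_mem (fun ζ _ => by
      rw [hF0, Pi.mul_apply, hQ, mul_zero]), card_rootTuplesOn hd, Finset.card_pair hi₀, hr']
    congr 1
  · push Not at hX
    have hnd : ∀ l, ¬P ∣ ℓ l := by
      rintro l ⟨Q, hQ⟩
      refine hX l ?_
      refine hFi.associated_of_dvd (X_prime (R := Qbar) (i := l)).irreducible
        (dvd_of_eval_eq_zero hFi fun x hx => ?_)
      have h1 := congrArg (eval (M.mulVec (x ^ d))) hQ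
      rw [map_mul, hPF x hx, zero_mul, eval_linSub_inv_X hM, pow_eq_zero_iff hd.ne'] at h1
      rw [eval_X, h1]
    obtain ⟨i, hi0, hi⟩ := exists_pderiv_not_dvd hP hP'
    have hs : ¬P ∣ pderiv i P * ∏ l, ℓ l := by
      refine hprime hi fun h => ?_
      obtain ⟨l, hl, h⟩ := (Prime.dvd_finsetProd_iff hP.prime _).mp h
      exact hnd l h
    have hs' : (pderiv i P * ∏ l, ℓ l).IsHomogeneous (e' - 1 + (n + 1)) := by
      have := IsHomogeneous.prod Finset.univ ℓ (fun _ => 1) fun l _ => hℓ l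
      refine hP'.pderiv.mul ?_
      simpa using this
    refine mapDegree_eq hP hP' himg hs' (by omega) hs fun Q hQ hQs => ?_
    induction Q using Projectivization.ind with
    | h y hy =>
    rw [mk_mem_zeroLocus hP'] at hQ
    rw [mk_mem_zeroLocus hs'] at hQs
    obtain ⟨x, rfl⟩ := exists_mulVec_pow_eq hd hM y
    rw [map_mul, map_prod] at hQs
    have hxl : ∀ l, x l ≠ 0 := fun l h => by
      refine Finset.prod_ne_zero_iff.mp (right_ne_zero_of_mul hQs) l (Finset.mem_univ l) ?_
      rw [eval_linSub_inv_X hM, h, zero_pow hd.ne']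
    have hx : x ≠ 0 := fun h => hxl 0 (congrFun h 0)
    rw [ncard_fiber hd hM hF hx (J := {Fin.last n}) (i₀ := Fin.last n) (by simp) (hxl _)
      (fun i hi hi' => absurd (Finset.mem_singleton.mp hi) hi') (fun i _ => hxl i)]
    exact card_filter_eq hd hn hM hF hFi hP hPd hr hxl hQ (left_ne_zero_of_mul hQs)

/-- The push-forward of the divisor of a form is the divisor of the push-forward of the form. -/
theorem IsFormOf.pushforward (hd : 0 < d) (hn : 1 ≤ n) (hM : IsUnit M.det) {D : EffDivisor (n + 1)}
    (h : IsFormOf D F) :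
    IsFormOf (CritHeight.pushforward (projMap (powerMap d M)) D) (pushForm d M F) := by
  obtain ⟨S, hS, rfl, h⟩ := h
  have hhom : ∀ S : Multiset (MvPolynomial (Fin (n + 1)) Qbar),
      (∀ p ∈ S, Irreducible p ∧ ∃ e, p.IsHomogeneous e) → ∃ e, S.prod.IsHomogeneous e := by
    intro S
    induction S using Multiset.induction_on with
    | empty => exact fun _ => ⟨0, by simpa using isHomogeneous_one _ _⟩
    | cons p S ih =>
      intro hS
      obtain ⟨-, e, he⟩ := hS p (Multiset.mem_cons_self p S)
      obtain ⟨e', he'⟩ := ih fun q hq => hS q (Multiset.mem_cons_of_mem hq)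
      exact ⟨e + e', by rw [Multiset.prod_cons]; exact he.mul he'⟩
  obtain ⟨e, he⟩ := hhom S hS
  refine IsFormOf.congr ?_ (pushForm_associated hd hn he h)
  clear he h
  induction S using Multiset.induction_on with
  | empty =>
    rw [Multiset.prod_zero, pushForm_one hd hn]
    exact ⟨0, by simp, by simp [CritHeight.pushforward], by simp⟩
  | cons p S ih =>
    have hS' : ∀ q ∈ S, Irreducible q ∧ ∃ e, q.IsHomogeneous e :=
      fun q hq => hS q (Multiset.mem_cons_of_mem hq)
    obtain ⟨hp, e, he⟩ := hS p (Multiset.mem_cons_self p S)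
    obtain ⟨e', he'⟩ := hhom S hS'
    rw [Multiset.prod_cons, pushForm_mul hd hn he he', Multiset.map_cons, CritHeight.pushforward,
      Multiset.cons_bind]
    refine IsFormOf.add ?_ (ih hS')
    obtain ⟨P, r, k, hP, hP', hPd, hr⟩ := exists_associated_pow_pushForm (M := M) hd hn hM he hp
    obtain ⟨h1, h2⟩ := mapDegree_pushForm hd hn hM he hp hP hP' hPd hr
    rw [h1, h2]
    refine ⟨Multiset.replicate r P, fun q hq => ?_, by rw [Multiset.map_replicate], ?_⟩
    · rw [Multiset.eq_of_mem_replicate hq]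
      exact ⟨hP, k, hP'⟩
    · rwa [Multiset.prod_replicate]

end MapDegree

/-! ### Critical heights of the maps `𝐗 ↦ M 𝐗ᵈ` -/

section CriticalForms

open MvPolynomial

variable {m n d e : ℕ}

/-- The monomial defining the critical divisor of `𝐗 ↦ M 𝐗ᵈ`. -/
def critForm (d m : ℕ) : MvPolynomial (Fin m) Qbar := ∏ i, X i ^ (d - 1)

lemma critForm_isHomogeneous (d m : ℕ) : (critForm d m).IsHomogeneous (m * (d - 1)) := by
  have := IsHomogeneous.prod Finset.univ (fun i : Fin m => (X i ^ (d - 1) : MvPolynomial _ Qbar))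
    (fun _ => d - 1) fun i _ => by simpa using (isHomogeneous_X Qbar i).pow (d - 1)
  simpa [critForm] using this

lemma critForm_ne_zero (d m : ℕ) : critForm d m ≠ 0 :=
  Finset.prod_ne_zero_iff.mpr fun i _ => pow_ne_zero _ (X_ne_zero i)

/-- The Jacobian matrix factors as M times the diagonal matrix of the derivatives of the d-th
powers, so the critical divisor does not depend on M. -/
lemma det_jacobian_powerMap (M : Matrix (Fin m) (Fin m) Qbar) :
    (Matrix.of fun i j => pderiv j (powerMap d M i)).det =
      C (M.det * (d : Qbar) ^ m) * critForm d m := by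
  have h : (Matrix.of fun i j => pderiv j (powerMap d M i)) =
      (C.mapMatrix M) * Matrix.diagonal fun j => C (d : Qbar) * X j ^ (d - 1) := by
    ext1 i j
    rw [Matrix.mul_diagonal]
    simp only [Matrix.of_apply, powerMap, map_sum, RingHom.mapMatrix_apply, Matrix.map_apply]
    rw [Finset.sum_eq_single j]
    · rw [pderiv_C_mul, pderiv_pow, pderiv_X_self]
      simp
    · intro l _ hl
      rw [pderiv_C_mul, pderiv_pow, pderiv_X_of_ne hl]
      simp
    · simp
  rw [h, Matrix.det_mul, Matrix.det_diagonal, Finset.prod_mul_distrib, ← RingHom.map_det,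
    Finset.prod_const, critForm]
  simp [mul_assoc]

lemma isFormOf_critDivisor (hd : 0 < d) {M : Matrix (Fin m) (Fin m) Qbar} (hM : IsUnit M.det) :
    IsFormOf (critDivisor (powerMap d M)) (critForm d m) := by
  have hc : M.det * (d : Qbar) ^ m ≠ 0 :=
    mul_ne_zero hM.ne_zero (pow_ne_zero _ (Nat.cast_ne_zero.mpr hd.ne'))
  rw [critDivisor, det_jacobian_powerMap]
  refine (isFormOf_divisorOf (mul_ne_zero (C_ne_zero.mpr hc) (critForm_ne_zero d m))
    ((isHomogeneous_C _ _).mul (critForm_isHomogeneous d m))).congr ?_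
  rw [mul_comm]
  exact (associated_mul_unit_right _ _ ((isUnit_iff_ne_zero.mpr hc).map C)).symm

lemma setHeight_of_subsingleton {s : Finset Qbar} (h : ∀ a ∈ s, ∀ b ∈ s, a = b) :
    setHeight s = 0 := by
  have : Subsingleton s := ⟨fun a b => Subtype.ext (h a.1 a.2 b.1 b.2)⟩
  rw [setHeight, absLogHeight, Height.logHeight_eq_zero_of_subsingleton, zero_div]

/-- Multiplication by a monomial does not change the coefficients. -/
lemma coeffs_monomial_mul (s : Fin m →₀ ℕ) (F : MvPolynomial (Fin m) Qbar) :
    (monomial s 1 * F).coeffs = F.coeffs := by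
  ext a
  simp only [mem_coeffs_iff, mem_support_iff]
  constructor
  · rintro ⟨t, ht, rfl⟩
    rw [coeff_monomial_mul'] at ht ⊢
    split_ifs at ht ⊢ with h
    · exact ⟨t - s, by simpa using ht, by simp⟩
    · exact absurd rfl ht
  · rintro ⟨t, ht, rfl⟩
    refine ⟨s + t, ?_, ?_⟩ <;> rw [coeff_monomial_mul, one_mul]
    exact ht

lemma critForm_eq_monomial (d m : ℕ) :
    ∃ s : Fin m →₀ ℕ, critForm d m = monomial s 1 := by
  refine ⟨∑ i, Finsupp.single i (d - 1), ?_⟩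
  rw [critForm, monomial_sum_one]
  exact Finset.prod_congr rfl fun i _ => X_pow_eq_monomial

lemma setHeight_coeffs_monomial (s : Fin m →₀ ℕ) :
    setHeight (monomial s (1 : Qbar)).coeffs = 0 := by
  refine setHeight_of_subsingleton fun a ha b hb => ?_
  have key : ∀ a ∈ (monomial s (1 : Qbar)).coeffs, a = 1 := by
    intro a ha
    obtain ⟨t, ht, rfl⟩ := mem_coeffs_iff.mp ha
    classical
    rw [mem_support_iff, coeff_monomial] at ht
    rw [coeff_monomial]
    split_ifs at ht ⊢ with h
    · rfl
    · exact absurd rfl ht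
  rw [key a ha, key b hb]

lemma setHeight_coeffs_critForm (d m : ℕ) : setHeight (critForm d m).coeffs = 0 := by
  obtain ⟨s, hs⟩ := critForm_eq_monomial d m
  rw [hs, setHeight_coeffs_monomial]

/-- A form in one variable has at most one coefficient; this is the convention for projective space
of dimension 0. -/
lemma divHeight_fin_one (D : EffDivisor 1) : divHeight D = 0 := by
  have hhom : ∃ e, (D.map formOf).prod.IsHomogeneous e := by
    induction D using Multiset.induction_on with
    | empty => exact ⟨0, by simpa using isHomogeneous_one _ _⟩
    | cons Z D ih =>
      obtain ⟨e, he⟩ := ih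
      obtain ⟨e', he'⟩ := formOf_isHomogeneous Z
      exact ⟨e' + e, by rw [Multiset.map_cons, Multiset.prod_cons]; exact he'.mul he⟩
  obtain ⟨e, he⟩ := hhom
  rw [divHeight, formHeight_eq]
  refine setHeight_of_subsingleton fun a ha b hb => ?_
  obtain ⟨s, hs, rfl⟩ := mem_coeffs_iff.mp ha
  obtain ⟨t, ht, rfl⟩ := mem_coeffs_iff.mp hb
  have h1 := sum_exponent_of_isHomogeneous he (mem_support_iff.mp hs)
  have h2 := sum_exponent_of_isHomogeneous he (mem_support_iff.mp ht)
  rw [Fin.sum_univ_one] at h1 h2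
  have hst : s = t := by
    refine Finsupp.ext fun i => ?_
    rw [Subsingleton.elim i 0, h1, h2]
  rw [hst]

lemma canonicalSeq_fin_one (Φ : FormTuple 1) (D : EffDivisor 1) (k : ℕ) :
    canonicalSeq d Φ D k = 0 := by
  rw [canonicalSeq, divHeight_fin_one, zero_div]

end CriticalForms

/-! ### Heights of iterated push-forwards and convergence -/

section Iterates

open MvPolynomial

variable {n d e : ℕ} {M : Matrix (Fin (n + 1)) (Fin (n + 1)) Qbar}
  {F : MvPolynomial (Fin (n + 1)) Qbar} {w : AbsoluteValue Qbar ℝ} {ε : ℕ}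

lemma iterate_pushForm_isHomogeneous (hd : 0 < d) (hn : 1 ≤ n) (hF : F.IsHomogeneous e) (k : ℕ) :
    ((pushForm d M)^[k] F).IsHomogeneous (d ^ (k * (n - 1)) * e) := by
  induction k with
  | zero => simpa using hF
  | succ k ih =>
    rw [Function.iterate_succ_apply']
    have := pushForm_isHomogeneous (M := M) hd hn ih
    rwa [← mul_assoc, ← pow_add, add_comm (n - 1), ← Nat.succ_mul] at this

lemma iterate_pushForm_ne_zero (hd : 0 < d) (hn : 1 ≤ n) (hM : IsUnit M.det)
    (hF : F.IsHomogeneous e) (hF0 : F ≠ 0) (k : ℕ) : (pushForm d M)^[k] F ≠ 0 := by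
  induction k with
  | zero => exact hF0
  | succ k ih =>
    rw [Function.iterate_succ_apply']
    exact pushForm_ne_zero hd hn hM (iterate_pushForm_isHomogeneous hd hn hF k) ih

lemma iterate_pushForm_mul (hd : 0 < d) (hn : 1 ≤ n) {G : MvPolynomial (Fin (n + 1)) Qbar}
    {e' : ℕ} (hF : F.IsHomogeneous e) (hG : G.IsHomogeneous e') (k : ℕ) :
    (pushForm d M)^[k] (F * G) = (pushForm d M)^[k] F * (pushForm d M)^[k] G := by
  induction k with
  | zero => rfl
  | succ k ih =>
    rw [Function.iterate_succ_apply', ih, pushForm_mul hd hn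
      (iterate_pushForm_isHomogeneous hd hn hF k) (iterate_pushForm_isHomogeneous hd hn hG k),
      Function.iterate_succ_apply', Function.iterate_succ_apply']

/-- From here on only the iterated forms matter, no longer the divisors. -/
lemma canonicalSeq_powerMap (hd : 0 < d) (hn : 1 ≤ n) (hM : IsUnit M.det)
    {D : EffDivisor (n + 1)} (h : IsFormOf D F) (k : ℕ) :
    canonicalSeq d (powerMap d M) D k =
      setHeight ((pushForm d M)^[k] F).coeffs / (d : ℝ) ^ (k * n) := by
  have : IsFormOf ((CritHeight.pushforward (projMap (powerMap d M)))^[k] D)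
      ((pushForm d M)^[k] F) := by
    induction k with
    | zero => exact h
    | succ k ih =>
      rw [Function.iterate_succ_apply', Function.iterate_succ_apply']
      exact ih.pushforward hd hn hM
  rw [canonicalSeq, this.divHeight_eq, Nat.add_sub_cancel]

/-- An error constant for push-forwards. -/
def pushConst (n d : ℕ) : ℝ := 2 * kap (n + 1) * ((d : ℝ) ^ n) ^ 2

lemma pushConst_nonneg (n d : ℕ) : 0 ≤ pushConst n d := by
  have := kap_pos (n + 1)
  unfold pushConst
  positivity

lemma one_le_pow_cast (hd : 0 < d) (k : ℕ) : (1 : ℝ) ≤ (d : ℝ) ^ k :=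
  one_le_pow₀ (by exact_mod_cast hd)

/-- The norm has dⁿ factors with the Gauss norm of F. It is a form of degree d^(n-1)·e, and each
degree costs one factor of M⁻¹ in the substitution. -/
lemma lg_pushForm_le (hw : LocalPlace w ε) (hd : 0 < d) (hn : 1 ≤ n) (hM : IsUnit M.det)
    (hF : F.IsHomogeneous e) (hF0 : F ≠ 0) :
    lg w (pushForm d M F) ≤ d ^ n * lg w F + d ^ (n - 1) * e * Real.log (matSup w M⁻¹) +
      ε * (pushConst n d * (e + 1)) := by
  have hM' : M⁻¹ ≠ 0 := by
    intro h
    have := Matrix.nonsing_inv_mul M hM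
    rw [h, zero_mul] at this
    exact zero_ne_one this
  have h1 := lg_normForm_le hw hd hn hF hF0
  have h2 := lg_linSub_le hw M⁻¹ hM' (normForm_isHomogeneous hd hn hF)
    (normForm_ne_zero hd hn hF hF0) (pushForm_ne_zero hd hn hM hF hF0)
  have hk := kap_pos (n + 1)
  have hdn := one_le_pow_cast hd n
  have hdn' : (d : ℝ) ^ (n - 1) ≤ d ^ n :=
    pow_le_pow_right₀ (by exact_mod_cast hd) (Nat.sub_le n 1)
  have h3 : (ε : ℝ) * (kap (n + 1) * (d ^ n * e)) + ε * (kap (n + 1) * (d ^ (n - 1) * e)) ≤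
      ε * (pushConst n d * (e + 1)) := by
    rw [← mul_add, ← mul_add, pushConst]
    refine mul_le_mul_of_nonneg_left ?_ (Nat.cast_nonneg ε)
    have he : (0 : ℝ) ≤ e := Nat.cast_nonneg e
    calc kap (n + 1) * ((d : ℝ) ^ n * e + d ^ (n - 1) * e)
        ≤ kap (n + 1) * (2 * (((d : ℝ) ^ n) ^ 2) * (e + 1)) := by
          refine mul_le_mul_of_nonneg_left ?_ hk.le
          have h4 : (d : ℝ) ^ n ≤ ((d : ℝ) ^ n) ^ 2 := le_self_pow₀ hdn two_ne_zero
          have h5 := mul_le_mul_of_nonneg_right (hdn'.trans h4) he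
          have h6 := mul_le_mul_of_nonneg_right h4 he
          nlinarith
      _ = _ := by ring
  push_cast at h2
  unfold pushForm
  linarith

/-- Substituting M into the push-forward returns the norm form, so in this direction M appears in
place of its inverse. -/
lemma le_lg_pushForm (hw : LocalPlace w ε) (hd : 0 < d) (hn : 1 ≤ n) (hM : IsUnit M.det)
    (hF : F.IsHomogeneous e) (hF0 : F ≠ 0) :
    d ^ n * lg w F ≤ lg w (pushForm d M F) + d ^ (n - 1) * e * Real.log (matSup w M) +
      ε * (pushConst n d * (e + 1)) := by
  have hM' : M ≠ 0 := by
    intro h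
    have := Matrix.nonsing_inv_mul M hM
    rw [h, mul_zero] at this
    exact zero_ne_one this
  have h1 := le_lg_normForm hw hd hn hF hF0
  have h2 := lg_linSub_le hw M hM' (pushForm_isHomogeneous (M := M) hd hn hF)
    (pushForm_ne_zero hd hn hM hF hF0)
    (by rw [linSub_pushForm hM]; exact normForm_ne_zero hd hn hF hF0)
  rw [linSub_pushForm hM] at h2
  have hk := kap_pos (n + 1)
  have hdn := one_le_pow_cast hd n
  have hdn' : (d : ℝ) ^ (n - 1) ≤ d ^ n :=
    pow_le_pow_right₀ (by exact_mod_cast hd) (Nat.sub_le n 1)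
  have h3 : (ε : ℝ) * (kap (n + 1) * ((d ^ n) ^ 2 * (e + 1))) +
      ε * (kap (n + 1) * (d ^ (n - 1) * e)) ≤ ε * (pushConst n d * (e + 1)) := by
    rw [← mul_add, ← mul_add, pushConst]
    refine mul_le_mul_of_nonneg_left ?_ (Nat.cast_nonneg ε)
    have he : (0 : ℝ) ≤ e := Nat.cast_nonneg e
    calc kap (n + 1) * (((d : ℝ) ^ n) ^ 2 * (e + 1) + d ^ (n - 1) * e)
        ≤ kap (n + 1) * (2 * (((d : ℝ) ^ n) ^ 2) * (e + 1)) := by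
          refine mul_le_mul_of_nonneg_left ?_ hk.le
          have h4 : (d : ℝ) ^ n ≤ ((d : ℝ) ^ n) ^ 2 := le_self_pow₀ hdn two_ne_zero
          have h5 := mul_le_mul_of_nonneg_right (hdn'.trans h4) he
          have h6 := mul_le_mul_of_nonneg_right h4 he
          nlinarith
      _ = _ := by ring
  push_cast at h2
  linarith

/-- The set of entries of a matrix. -/
def entries {p q : ℕ} (B : Matrix (Fin p) (Fin q) Qbar) : Finset Qbar := by
  classical exact Finset.univ.image fun i : Fin p × Fin q => B i.1 i.2

lemma matSup_eq (w : AbsoluteValue Qbar ℝ) {p q : ℕ} (B : Matrix (Fin p) (Fin q) Qbar) :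
    matSup w B = setSup w (entries B) := rfl

lemma matHeight_eq {N : ℕ} (A : Matrix (Fin N) (Fin N) Qbar) :
    matHeight A = setHeight (entries A) := by
  classical
  rw [matHeight, absLogHeight_eq_setHeight, entries]

lemma exists_entry_ne_zero {N : ℕ} {A : Matrix (Fin N) (Fin N) Qbar} (hA : A ≠ 0) :
    ∃ a ∈ entries A, a ≠ 0 := by
  classical
  by_contra! h
  exact hA (Matrix.ext fun i j => h _ (Finset.mem_image.mpr ⟨(i, j), Finset.mem_univ _, rfl⟩))

lemma matHeight_nonneg {N : ℕ} (A : Matrix (Fin N) (Fin N) Qbar) : 0 ≤ matHeight A := by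
  rw [matHeight_eq]
  exact setHeight_nonneg _

lemma setHeight_pushForm_le (hd : 0 < d) (hn : 1 ≤ n) (hM : IsUnit M.det)
    (hF : F.IsHomogeneous e) (hF0 : F ≠ 0) :
    setHeight (pushForm d M F).coeffs ≤ d ^ n * setHeight F.coeffs +
      d ^ (n - 1) * e * matHeight M⁻¹ + pushConst n d * (e + 1) := by
  have hM' : M⁻¹ ≠ 0 := by
    intro h
    have := Matrix.nonsing_inv_mul M hM
    rw [h, zero_mul] at this
    exact zero_ne_one this
  have h := setHeight_sum_le ![(pushForm d M F).coeffs, F.coeffs, entries M⁻¹]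
    (fun j => by
      fin_cases j
      · exact exists_mem_coeffs_ne_zero (pushForm_ne_zero hd hn hM hF hF0)
      · exact exists_mem_coeffs_ne_zero hF0
      · exact exists_entry_ne_zero hM')
    ![1, -(d : ℝ) ^ n, -((d : ℝ) ^ (n - 1) * e)] (pushConst n d * (e + 1)) (fun w ε hw => by
      have h1 := lg_pushForm_le hw hd hn hM hF hF0
      simp only [Fin.sum_univ_three, Matrix.cons_val_zero, Matrix.cons_val_one,
        Matrix.cons_val_two, Matrix.head_cons, Matrix.tail_cons]
      rw [matSup_eq] at h1
      unfold lg gauss at h1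
      linarith)
  simp only [Fin.sum_univ_three, Matrix.cons_val_zero, Matrix.cons_val_one,
    Matrix.cons_val_two, Matrix.head_cons, Matrix.tail_cons] at h
  rw [matHeight_eq]
  linarith

lemma le_setHeight_pushForm (hd : 0 < d) (hn : 1 ≤ n) (hM : IsUnit M.det)
    (hF : F.IsHomogeneous e) (hF0 : F ≠ 0) :
    d ^ n * setHeight F.coeffs ≤ setHeight (pushForm d M F).coeffs +
      d ^ (n - 1) * e * matHeight M + pushConst n d * (e + 1) := by
  have hM' : M ≠ 0 := by
    intro h
    have := Matrix.nonsing_inv_mul M hM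
    rw [h, mul_zero] at this
    exact zero_ne_one this
  have h := setHeight_sum_le ![(pushForm d M F).coeffs, F.coeffs, entries M]
    (fun j => by
      fin_cases j
      · exact exists_mem_coeffs_ne_zero (pushForm_ne_zero hd hn hM hF hF0)
      · exact exists_mem_coeffs_ne_zero hF0
      · exact exists_entry_ne_zero hM')
    ![-1, (d : ℝ) ^ n, -((d : ℝ) ^ (n - 1) * e)] (pushConst n d * (e + 1)) (fun w ε hw => by
      have h1 := le_lg_pushForm hw hd hn hM hF hF0
      simp only [Fin.sum_univ_three, Matrix.cons_val_zero, Matrix.cons_val_one,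
        Matrix.cons_val_two, Matrix.head_cons, Matrix.tail_cons]
      rw [matSup_eq] at h1
      unfold lg gauss at h1
      linarith)
  simp only [Fin.sum_univ_three, Matrix.cons_val_zero, Matrix.cons_val_one,
    Matrix.cons_val_two, Matrix.head_cons, Matrix.tail_cons] at h
  rw [matHeight_eq]
  linarith

lemma le_of_geometric_increments {a : ℕ → ℝ} {D B : ℝ} (hD : 1 < D) (hB : 0 ≤ B)
    (h : ∀ k, a (k + 1) ≤ a k + B / D ^ (k + 1)) (k : ℕ) : a k ≤ a 0 + B / (D - 1) := by
  have hD1 : 0 < D - 1 := by linarith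
  have hD0 : 0 < D := by linarith
  have key : ∀ k, a k ≤ a 0 + B / (D - 1) * (1 - 1 / D ^ k) := by
    intro k
    induction k with
    | zero => simp
    | succ k ih =>
      refine (h k).trans ((add_le_add_left ih _).trans (le_of_eq ?_))
      have : D ^ k ≠ 0 := (pow_pos hD0 k).ne'
      field_simp
      ring
  refine (key k).trans ?_
  have h1 : 0 ≤ B / (D - 1) := div_nonneg hB hD1.le
  have h2 : 0 ≤ 1 / D ^ k := by positivity
  nlinarith

/-- The increments of the sequence defining a canonical height. -/
lemma canonical_increment {h h' H K : ℝ} (hd : 0 < d) (hn : 1 ≤ n) (hK : 0 ≤ K) (k : ℕ)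
    (hle : h' ≤ d ^ n * h + d ^ (n - 1) * ((d ^ (k * (n - 1)) * e : ℕ) : ℝ) * H +
      K * (((d ^ (k * (n - 1)) * e : ℕ) : ℝ) + 1)) :
    h' / (d : ℝ) ^ ((k + 1) * n) ≤ h / (d : ℝ) ^ (k * n) + (e * H + K * (e + 1)) / d ^ (k + 1) := by
  obtain ⟨n, rfl⟩ : ∃ l, n = l + 1 := ⟨n - 1, by omega⟩
  rw [Nat.add_sub_cancel] at hle
  have hd' : (0 : ℝ) < d := by exact_mod_cast hd
  have hX : (1 : ℝ) ≤ (d : ℝ) ^ (k * n) := one_le_pow_cast hd _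
  have hX' : (1 : ℝ) ≤ (d : ℝ) ^ n := one_le_pow_cast hd _
  rw [div_le_iff₀ (by positivity)]
  have h1 : (h / (d : ℝ) ^ (k * (n + 1)) + (e * H + K * (e + 1)) / d ^ (k + 1)) *
      (d : ℝ) ^ ((k + 1) * (n + 1)) =
      d ^ (n + 1) * h + (e * H + K * (e + 1)) * (d ^ n * d ^ (k * n)) := by
    have e1 : (d : ℝ) ^ ((k + 1) * (n + 1)) = d ^ (k * (n + 1)) * d ^ (n + 1) := by
      rw [← pow_add]; ring
    have e2 : (d : ℝ) ^ ((k + 1) * (n + 1)) = d ^ (k + 1) * (d ^ n * d ^ (k * n)) := by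
      rw [← pow_add, ← pow_add]; ring
    rw [add_mul]
    congr 1
    · rw [e1]; field_simp
    · rw [e2]; field_simp
  rw [h1]
  refine hle.trans ?_
  push_cast
  have he : (0 : ℝ) ≤ e := Nat.cast_nonneg e
  have h2 : (d : ℝ) ^ (k * n) * e + 1 ≤ (e + 1) * (d ^ n * d ^ (k * n)) := by
    have : (d : ℝ) ^ (k * n) ≤ d ^ n * d ^ (k * n) := le_mul_of_one_le_left (by positivity) hX'
    nlinarith
  have h3 := mul_le_mul_of_nonneg_left h2 hK
  nlinarith

/-- Bounds and convergence for the critical height of `𝐗 ↦ M 𝐗ᵈ`. -/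
lemma canonicalSeq_bounds (hd : 2 ≤ d) (hn : 1 ≤ n) (hM : IsUnit M.det) :
    Tendsto (canonicalSeq d (powerMap d M) (critDivisor (powerMap d M))) atTop
      (𝓝 (critHeight d (powerMap d M))) ∧
    critHeight d (powerMap d M) ≤ (n + 1) * matHeight M⁻¹ + pushConst n d * (n + 2) ∧
    -((n + 1) * matHeight M + pushConst n d * (n + 2)) ≤ critHeight d (powerMap d M) := by
  have hd0 : 0 < d := by omega
  have hd1 : (1 : ℝ) < d := by exact_mod_cast hd
  set a := canonicalSeq d (powerMap d M) (critDivisor (powerMap d M)) with ha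
  set e := (n + 1) * (d - 1) with he
  have hdc : ((d - 1 : ℕ) : ℝ) = d - 1 := by
    rw [Nat.cast_sub (by omega), Nat.cast_one]
  have hec : (e : ℝ) = (n + 1) * (d - 1) := by
    rw [he, Nat.cast_mul, hdc]; push_cast; ring
  have hK := pushConst_nonneg n d
  have hak : ∀ k, a k = setHeight ((pushForm d M)^[k] (critForm d (n + 1))).coeffs /
      (d : ℝ) ^ (k * n) := canonicalSeq_powerMap hd0 hn hM (isFormOf_critDivisor hd0 hM)
  -- The critical form is a monomial, so both bounds are sums of increments alone.
  have ha0 : a 0 = 0 := by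
    rw [hak, Function.iterate_zero, id, setHeight_coeffs_critForm, zero_div]
  have hhom := iterate_pushForm_isHomogeneous (M := M) hd0 hn (critForm_isHomogeneous d (n + 1))
  have hne := iterate_pushForm_ne_zero hd0 hn hM (critForm_isHomogeneous d (n + 1))
    (critForm_ne_zero d (n + 1))
  have h1 : ∀ k, a (k + 1) ≤ a k + (e * matHeight M⁻¹ + pushConst n d * (e + 1)) / d ^ (k + 1) := by
    intro k
    rw [hak, hak]
    refine canonical_increment hd0 hn hK k ?_
    rw [Function.iterate_succ_apply']
    exact setHeight_pushForm_le hd0 hn hM (hhom k) (hne k)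
  have h2 : ∀ k, -a (k + 1) ≤ -a k + (e * matHeight M + pushConst n d * (e + 1)) / d ^ (k + 1) := by
    intro k
    rw [hak, hak, ← neg_div, ← neg_div]
    refine canonical_increment hd0 hn hK k ?_
    rw [Function.iterate_succ_apply']
    have := le_setHeight_pushForm hd0 hn hM (hhom k) (hne k)
    linarith
  have hB1 : 0 ≤ e * matHeight M⁻¹ + pushConst n d * (e + 1) := by
    have := matHeight_nonneg M⁻¹
    positivity
  have hB2 : 0 ≤ e * matHeight M + pushConst n d * (e + 1) := by
    have := matHeight_nonneg M
    positivity
  have h3 := le_of_geometric_increments hd1 hB1 h1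
  have h4 := le_of_geometric_increments (a := fun k => -a k) hd1 hB2 h2
  -- The degree (n + 1)(d - 1) of the critical form cancels the factor 1/(d - 1) from the geometric
  -- series, so the coefficient of the matrix height is n + 1.
  have hbound : ∀ H : ℝ, (e * H + pushConst n d * (e + 1)) / ((d : ℝ) - 1) ≤
      (n + 1) * H + pushConst n d * (n + 2) := by
    intro H
    have hd2 : (1 : ℝ) ≤ d - 1 := by
      have : (2 : ℝ) ≤ d := by exact_mod_cast hd
      linarith
    rw [div_le_iff₀ (by linarith), hec]
    nlinarith [mul_nonneg hK (sub_nonneg.mpr hd2)]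
  have hconv : Tendsto a atTop (𝓝 (critHeight d (powerMap d M))) := by
    refine tendsto_nhds_limUnder (cauchySeq_tendsto_of_complete ?_)
    refine cauchySeq_of_le_geometric (1 / d)
      (max (e * matHeight M⁻¹ + pushConst n d * (e + 1))
        (e * matHeight M + pushConst n d * (e + 1)))
      (by rw [div_lt_one (by linarith)]; exact hd1) fun k => ?_
    have hpow : (0 : ℝ) < d ^ k := by positivity
    have hstep : ∀ B : ℝ, 0 ≤ B → B / (d : ℝ) ^ (k + 1) ≤ B * (1 / d) ^ k := fun B hB => by
      rw [one_div, inv_pow, ← div_eq_mul_inv]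
      exact div_le_div_of_nonneg_left hB hpow (pow_le_pow_right₀ hd1.le (Nat.le_succ k))
    have hq : (0 : ℝ) ≤ (1 / d) ^ k := by positivity
    rw [Real.dist_eq, abs_le]
    constructor
    · have := h1 k
      have h5 := hstep _ hB1
      have h6 := mul_le_mul_of_nonneg_right (le_max_left (e * matHeight M⁻¹ +
        pushConst n d * (e + 1)) (e * matHeight M + pushConst n d * (e + 1))) hq
      linarith
    · have := h2 k
      have h5 := hstep _ hB2
      have h6 := mul_le_mul_of_nonneg_right (le_max_right (e * matHeight M⁻¹ +
        pushConst n d * (e + 1)) (e * matHeight M + pushConst n d * (e + 1))) hq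
      linarith
  refine ⟨hconv, le_of_tendsto' hconv fun k => ?_, ge_of_tendsto' hconv fun k => ?_⟩
  · have := h3 k
    rw [ha0, zero_add] at this
    exact this.trans (hbound _)
  · have := h4 k
    simp only [ha0, neg_zero, zero_add] at this
    linarith [hbound (matHeight M)]

end Iterates

/-! ### The maps `𝐗 ↦ A 𝐗ᵈ + 𝐛` -/

section AffineMaps

open MvPolynomial

variable {N d : ℕ}

/-- The matrix of the affine map `𝐗 ↦ A 𝐗 + 𝐛`. -/
def augMatrix (A : Matrix (Fin N) (Fin N) Qbar) (b : Fin N → Qbar) :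
    Matrix (Fin (N + 1)) (Fin (N + 1)) Qbar :=
  Matrix.of (Fin.snoc (α := fun _ => Fin (N + 1) → Qbar)
    (fun i => Fin.snoc (α := fun _ => Qbar) (A i) (b i)) (Fin.snoc (α := fun _ => Qbar) 0 1))

variable (A A' : Matrix (Fin N) (Fin N) Qbar) (b b' : Fin N → Qbar)

@[simp] lemma augMatrix_castSucc_castSucc (i j : Fin N) :
    augMatrix A b i.castSucc j.castSucc = A i j := by simp [augMatrix]

@[simp] lemma augMatrix_castSucc_last (i : Fin N) :
    augMatrix A b i.castSucc (Fin.last N) = b i := by simp [augMatrix]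

@[simp] lemma augMatrix_last_castSucc (j : Fin N) :
    augMatrix A b (Fin.last N) j.castSucc = 0 := by simp [augMatrix]

@[simp] lemma augMatrix_last_last : augMatrix A b (Fin.last N) (Fin.last N) = 1 := by
  simp [augMatrix]

lemma augMatrix_mul :
    augMatrix A b * augMatrix A' b' = augMatrix (A * A') (A.mulVec b' + b) := by
  ext i j
  rw [Matrix.mul_apply, Fin.sum_univ_castSucc]
  refine Fin.lastCases ?_ (fun i => ?_) i <;> refine Fin.lastCases ?_ (fun j => ?_) j <;>
    simp [Matrix.mul_apply, Matrix.mulVec, dotProduct]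

lemma augMatrix_one : augMatrix (1 : Matrix (Fin N) (Fin N) Qbar) 0 = 1 := by
  ext i j
  refine Fin.lastCases ?_ (fun i => ?_) i <;> refine Fin.lastCases ?_ (fun j => ?_) j
  · simp
  · simp [(Fin.castSucc_lt_last j).ne']
  · simp [(Fin.castSucc_lt_last i).ne]
  · simp [Matrix.one_apply]

lemma augMatrix_mulVec (x : Fin N → Qbar) (t : Qbar) :
    (augMatrix A b).mulVec (Fin.snoc (α := fun _ => Qbar) x t) =
      Fin.snoc (α := fun _ => Qbar) (A.mulVec x + t • b) t := by
  ext i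
  rw [Matrix.mulVec, dotProduct, Fin.sum_univ_castSucc]
  refine Fin.lastCases ?_ (fun i => ?_) i <;>
    simp [Matrix.mulVec, dotProduct, mul_comm]

variable {A} {b}

lemma augMatrix_mul_inv (hA : IsUnit A.det) :
    augMatrix A b * augMatrix A⁻¹ (-(A⁻¹.mulVec b)) = 1 := by
  rw [augMatrix_mul, Matrix.mul_nonsing_inv A hA, Matrix.mulVec_neg, Matrix.mulVec_mulVec,
    Matrix.mul_nonsing_inv A hA, Matrix.one_mulVec, neg_add_cancel, augMatrix_one]

lemma isUnit_det_augMatrix (hA : IsUnit A.det) : IsUnit (augMatrix A b).det :=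
  Matrix.isUnit_det_of_right_inverse (augMatrix_mul_inv hA)

lemma augMatrix_inv (hA : IsUnit A.det) :
    (augMatrix A b)⁻¹ = augMatrix A⁻¹ (-(A⁻¹.mulVec b)) :=
  Matrix.inv_eq_right_inv (augMatrix_mul_inv hA)

variable (A) (b)

lemma affinePowerMap_eq : affinePowerMap d A b = powerMap d (augMatrix A b) := by
  funext i
  rw [powerMap, Fin.sum_univ_castSucc]
  refine Fin.lastCases ?_ (fun i => ?_) i <;> simp [affinePowerMap]

lemma restrictH_affinePowerMap (hd : 0 < d) :
    restrictH (affinePowerMap d A b) = powerMap d A := by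
  funext i
  simp [restrictH, affinePowerMap, powerMap, hd.ne']

end AffineMaps

/-! ### Local bounds for determinants and inverse matrices -/

section MatrixBounds

variable {N : ℕ} {w : AbsoluteValue Qbar ℝ} {ε : ℕ}

/-- The coordinates of the point `[b₁ : ⋯ : b_N : 1]`. -/
def pointSet (b : Fin N → Qbar) : Finset Qbar := by
  classical exact Finset.univ.image (Fin.snoc (α := fun _ => Qbar) b 1 : Fin (N + 1) → Qbar)

lemma vecHeight_eq (b : Fin N → Qbar) : vecHeight b = setHeight (pointSet b) := by
  classical
  rw [vecHeight, absLogHeight_eq_setHeight, pointSet]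

lemma one_mem_pointSet (b : Fin N → Qbar) : (1 : Qbar) ∈ pointSet b := by
  classical
  exact Finset.mem_image.mpr ⟨Fin.last N, Finset.mem_univ _, by simp⟩

lemma mem_pointSet (b : Fin N → Qbar) (i : Fin N) : b i ∈ pointSet b := by
  classical
  exact Finset.mem_image.mpr ⟨i.castSucc, Finset.mem_univ _, by simp⟩

lemma mem_pointSet_iff {b : Fin N → Qbar} {a : Qbar} :
    a ∈ pointSet b ↔ a = 1 ∨ ∃ i, a = b i := by
  classical
  constructor
  · intro h
    obtain ⟨i, -, rfl⟩ := Finset.mem_image.mp h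
    refine Fin.lastCases ?_ (fun i => ?_) i
    · simp
    · exact Or.inr ⟨i, by simp⟩
  · rintro (rfl | ⟨i, rfl⟩)
    exacts [one_mem_pointSet b, mem_pointSet b i]

lemma one_le_setSup_pointSet (w : AbsoluteValue Qbar ℝ) (b : Fin N → Qbar) :
    1 ≤ setSup w (pointSet b) := by
  simpa using le_setSup w (one_mem_pointSet b)

lemma vecHeight_nonneg (b : Fin N → Qbar) : 0 ≤ vecHeight b := by
  rw [vecHeight_eq]; exact setHeight_nonneg _

lemma LocalPlace.mulVec_le (hw : LocalPlace w ε) {p q : ℕ} (B : Matrix (Fin p) (Fin q) Qbar)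
    {x : Fin q → Qbar} {R : ℝ} (hR : 0 ≤ R) (hx : ∀ j, w (x j) ≤ R) (i : Fin p) :
    w (B.mulVec x i) ≤ (q : ℝ) ^ ε * (matSup w B * R) := by
  have := hw.sum_le Finset.univ (fun j => B i j * x j) (mul_nonneg (matSup_nonneg w B) hR)
    (fun j _ => by
      rw [map_mul]
      exact mul_le_mul (le_matSup w B i j) (hx j) (w.nonneg _) (matSup_nonneg w B))
  simpa [Matrix.mulVec, dotProduct] using this

lemma LocalPlace.det_le (hw : LocalPlace w ε) (B : Matrix (Fin N) (Fin N) Qbar) {c : Fin N → ℝ}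
    (hc : ∀ i, 0 ≤ c i) (hB : ∀ i j, w (B i j) ≤ c i) :
    w B.det ≤ (N.factorial : ℝ) ^ ε * ∏ i, c i := by
  have := hw.sum_le Finset.univ
    (fun σ : Equiv.Perm (Fin N) => Equiv.Perm.sign σ • ∏ i, B (σ i) i)
    (B := ∏ i, c i) (Finset.prod_nonneg fun i _ => hc i) (fun σ _ => by
      have h1 : w (Equiv.Perm.sign σ • ∏ i, B (σ i) i) = w (∏ i, B (σ i) i) := by
        rcases Int.units_eq_one_or (Equiv.Perm.sign σ) with h | h <;> rw [h] <;> simp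
      rw [h1, map_prod, ← Equiv.prod_comp σ c]
      exact Finset.prod_le_prod (fun i _ => w.nonneg _) fun i _ => hB _ _)
  rw [← Matrix.det_apply, Finset.card_univ, Fintype.card_perm, Fintype.card_fin] at this
  exact this

/-- An error constant for determinants. -/
def detConst (N : ℕ) : ℝ := Real.log N.factorial

lemma detConst_nonneg (N : ℕ) : 0 ≤ detConst N :=
  Real.log_nonneg (by exact_mod_cast N.factorial_pos)

lemma matSup_pos_of_det {B : Matrix (Fin N) (Fin N) Qbar} (w : AbsoluteValue Qbar ℝ)
    (hN : 1 ≤ N) (hB : B.det ≠ 0) : 0 < matSup w B := by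
  refine matSup_pos w ?_
  rintro rfl
  have : Nonempty (Fin N) := ⟨⟨0, hN⟩⟩
  exact hB (Matrix.det_zero)

/-- By the Leibniz expansion a matrix with very small entries cannot have determinant 1. -/
lemma le_log_matSup (hw : LocalPlace w ε) (hN : 1 ≤ N) {B : Matrix (Fin N) (Fin N) Qbar}
    (hB : B.det = 1) : 0 ≤ Real.log (matSup w B) + ε * detConst N := by
  have hpos := matSup_pos_of_det w hN (hB.trans_ne one_ne_zero)
  have h := hw.det_le B (fun _ => matSup_nonneg w B) (le_matSup w B)
  rw [hB, map_one, Finset.prod_const, Finset.card_univ, Fintype.card_fin] at h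
  have h1 := Real.log_le_log one_pos h
  have hf : (0 : ℝ) < N.factorial := by exact_mod_cast N.factorial_pos
  rw [Real.log_one, Real.log_mul (by positivity) (by positivity), Real.log_pow, Real.log_pow] at h1
  have h2 : 0 ≤ (ε : ℝ) * detConst N := mul_nonneg (Nat.cast_nonneg _) (detConst_nonneg N)
  change 0 ≤ (ε : ℝ) * detConst N + _ at h1
  have hN' : (1 : ℝ) ≤ N := by exact_mod_cast hN
  by_contra! h3
  nlinarith

lemma matSup_adjugate_le (hw : LocalPlace w ε) (B : Matrix (Fin N) (Fin N) Qbar) :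
    matSup w B.adjugate ≤ (N.factorial : ℝ) ^ ε * matSup w B ^ (N - 1) := by
  classical
  have hB := matSup_nonneg w B
  refine matSup_le (by positivity) fun i j => ?_
  rw [Matrix.adjugate_apply]
  -- The row replaced by a unit vector has bound 1, which leaves the exponent N - 1.
  have := hw.det_le (B.updateRow j (Pi.single i 1)) (c := fun l => if l = j then 1 else matSup w B)
    (fun l => by split_ifs <;> positivity) (fun l m => by
      by_cases hl : l = j
      · subst hl
        rw [Matrix.updateRow_self, if_pos rfl, Pi.single_apply]
        split_ifs <;> simp
      · rw [Matrix.updateRow_ne hl, if_neg hl]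
        exact le_matSup w B l m)
  refine this.trans (le_of_eq ?_)
  congr 1
  rw [Finset.prod_ite, Finset.prod_const_one, one_mul, Finset.prod_const]
  congr 1
  rw [Finset.filter_ne' Finset.univ j, Finset.card_erase_of_mem (Finset.mem_univ j),
    Finset.card_univ, Fintype.card_fin]

lemma log_matSup_inv_le (hw : LocalPlace w ε) (hN : 1 ≤ N) {B : Matrix (Fin N) (Fin N) Qbar}
    (hB : B.det = 1) : Real.log (matSup w B⁻¹) ≤
      ((N : ℝ) - 1) * Real.log (matSup w B) + ε * detConst N := by
  have hpos := matSup_pos_of_det w hN (hB.trans_ne one_ne_zero)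
  have hpos' : 0 < matSup w B⁻¹ := matSup_pos_of_det w hN (by
    rw [Matrix.det_nonsing_inv, hB]; simp)
  have hf : (0 : ℝ) < N.factorial := by exact_mod_cast N.factorial_pos
  have h := matSup_adjugate_le hw B
  have h0 : B⁻¹ = B.adjugate := by rw [Matrix.inv_def, hB, Ring.inverse_one, one_smul]
  rw [← h0] at h
  have h1 := Real.log_le_log hpos' h
  rw [Real.log_mul (by positivity) (by positivity), Real.log_pow, Real.log_pow,
    Nat.cast_sub hN, Nat.cast_one] at h1
  unfold detConst
  linarith

lemma inv_det_eq_one {B : Matrix (Fin N) (Fin N) Qbar} (hB : B.det = 1) : B⁻¹.det = 1 := by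
  rw [Matrix.det_nonsing_inv, hB, Ring.inverse_one]

/-- The inverse consists of A⁻¹, the column -A⁻¹𝐛, zeros and a 1. Locally everything is bounded by
|A⁻¹| · max(1, |𝐛|), and the adjugate bounds |A⁻¹| by |A|^(N-1). -/
lemma matHeight_augMatrix_inv_le (hN : 1 ≤ N) {A : Matrix (Fin N) (Fin N) Qbar} (hA : A.det = 1)
    (b : Fin N → Qbar) : matHeight (augMatrix A b)⁻¹ ≤
      vecHeight b + ((N : ℝ) - 1) * matHeight A + (2 * detConst N + N) := by
  have hA' : IsUnit A.det := by rw [hA]; exact isUnit_one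
  have hA0 : A ≠ 0 := by
    rintro rfl
    have : Nonempty (Fin N) := ⟨⟨0, hN⟩⟩
    rw [Matrix.det_zero] at hA
    exact zero_ne_one hA
  have hL0 : (augMatrix A b)⁻¹ ≠ 0 := by
    intro h
    have := augMatrix_inv (b := b) hA'
    rw [h] at this
    have h1 := congrFun (congrFun this (Fin.last N)) (Fin.last N)
    simp at h1
  have h := setHeight_sum_le ![entries (augMatrix A b)⁻¹, pointSet b, entries A]
    (fun j => by
      fin_cases j
      · exact exists_entry_ne_zero hL0
      · exact ⟨1, one_mem_pointSet b, one_ne_zero⟩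
      · exact exists_entry_ne_zero hA0) ![1, -1, -((N : ℝ) - 1)] (2 * detConst N + N)
    (fun w ε hw => by
      simp only [Fin.sum_univ_three, Matrix.cons_val_zero, Matrix.cons_val_one,
        Matrix.cons_val_two, Matrix.head_cons, Matrix.tail_cons]
      have h1 := one_le_setSup_pointSet w b
      have h2 := log_matSup_inv_le hw hN hA
      have h3 := le_log_matSup hw hN (inv_det_eq_one hA)
      have h4 := matSup_pos_of_det w hN ((inv_det_eq_one hA).trans_ne one_ne_zero)
      have hNpos : (1 : ℝ) ≤ N := by exact_mod_cast hN
      have hf : (1 : ℝ) ≤ N.factorial := by exact_mod_cast N.factorial_pos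
      have hNε : (1 : ℝ) ≤ (N : ℝ) ^ ε := one_le_pow₀ hNpos
      have hfε : (1 : ℝ) ≤ (N.factorial : ℝ) ^ ε := one_le_pow₀ hf
      -- The factorial is included so that the common bound also covers the corner entry 1.
      have h5 : 1 ≤ (N.factorial : ℝ) ^ ε * matSup w A⁻¹ := by
        rw [← Real.log_nonneg_iff (by positivity), Real.log_mul (by positivity) h4.ne',
          Real.log_pow]
        unfold detConst at h3
        linarith
      have hs : 0 < setSup w (pointSet b) := by linarith
      have h6 : matSup w (augMatrix A b)⁻¹ ≤ (N : ℝ) ^ ε *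
          ((N.factorial : ℝ) ^ ε * matSup w A⁻¹ * setSup w (pointSet b)) := by
        refine matSup_le (by positivity) fun i j => ?_
        rw [augMatrix_inv hA']
        have hle : ∀ t : ℝ, t ≤ (N.factorial : ℝ) ^ ε * matSup w A⁻¹ * setSup w (pointSet b) →
            t ≤ (N : ℝ) ^ ε *
              ((N.factorial : ℝ) ^ ε * matSup w A⁻¹ * setSup w (pointSet b)) :=
          fun t ht => ht.trans (le_mul_of_one_le_left (by positivity) hNε)
        refine Fin.lastCases ?_ (fun i => ?_) i <;> refine Fin.lastCases ?_ (fun j => ?_) j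
        · rw [augMatrix_last_last, map_one]
          exact hle _ (one_le_mul_of_one_le_of_one_le h5 h1)
        · rw [augMatrix_last_castSucc, map_zero]
          positivity
        · rw [augMatrix_castSucc_last, Pi.neg_apply, AbsoluteValue.map_neg]
          refine (hw.mulVec_le A⁻¹ hs.le (fun j => le_setSup w (mem_pointSet b j)) i).trans ?_
          refine mul_le_mul_of_nonneg_left ?_ (by positivity)
          exact mul_le_mul_of_nonneg_right (le_mul_of_one_le_left h4.le hfε) hs.le
        · rw [augMatrix_castSucc_castSucc]
          refine hle _ ((le_matSup w A⁻¹ i j).trans ?_)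
          rw [mul_assoc]
          refine (le_mul_of_one_le_right h4.le h1).trans ?_
          exact le_mul_of_one_le_left (by positivity) hfε
      have h7 := Real.log_le_log (matSup_pos w hL0) h6
      rw [Real.log_mul (by positivity) (by positivity), Real.log_mul (by positivity) hs.ne',
        Real.log_mul (by positivity) h4.ne', Real.log_pow, Real.log_pow] at h7
      have h8 : (ε : ℝ) * Real.log N ≤ ε * N :=
        mul_le_mul_of_nonneg_left (Real.log_le_self (by positivity)) (Nat.cast_nonneg _)
      have h9 : Real.log N.factorial = detConst N := rfl
      rw [h9] at h7
      rw [matSup_eq, matSup_eq] at h2 h7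
      linarith)
  simp only [Fin.sum_univ_three, Matrix.cons_val_zero, Matrix.cons_val_one,
    Matrix.cons_val_two, Matrix.head_cons, Matrix.tail_cons] at h
  rw [matHeight_eq, matHeight_eq, vecHeight_eq]
  linarith

end MatrixBounds

/-! ### Restriction to the hyperplane at infinity -/

section Restriction

open MvPolynomial

variable {N n d e : ℕ} {w : AbsoluteValue Qbar ℝ} {ε : ℕ}

/-- The restriction of a form to the hyperplane where the last coordinate vanishes. -/
def resH (N : ℕ) : MvPolynomial (Fin (N + 1)) Qbar →ₐ[Qbar] MvPolynomial (Fin N) Qbar :=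
  aeval (Fin.snoc (α := fun _ => MvPolynomial (Fin N) Qbar) X 0)

lemma eval_resH (F : MvPolynomial (Fin (N + 1)) Qbar) (x : Fin N → Qbar) :
    eval x (resH N F) = eval (Fin.snoc (α := fun _ => Qbar) x 0) F := by
  have h : (eval x).comp (resH N).toRingHom = eval (Fin.snoc (α := fun _ => Qbar) x 0) := by
    ext i
    · simp [resH]
    · refine Fin.lastCases ?_ (fun i => ?_) i <;> simp [resH]
  exact congrArg (fun f : _ →+* Qbar => f F) h

lemma resH_isHomogeneous {F : MvPolynomial (Fin (N + 1)) Qbar} (hF : F.IsHomogeneous e) :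
    (resH N F).IsHomogeneous e := by
  have := hF.aeval (Fin.snoc (α := fun _ => MvPolynomial (Fin N) Qbar) X 0) (n := 1) fun i => by
    refine Fin.lastCases ?_ (fun i => ?_) i
    · simpa using isHomogeneous_zero _ _ 1
    · simpa using isHomogeneous_X _ i
  simpa [resH] using this

lemma resH_eq_killCompl (N : ℕ) :
    resH N = killCompl (R := Qbar) (Fin.castSucc_injective N) := by
  ext1 i
  refine Fin.lastCases ?_ (fun i => ?_) i
  · rw [resH, aeval_X, Fin.snoc_last, killCompl, aeval_X, dif_neg]
    rintro ⟨i, hi⟩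
    exact (Fin.castSucc_lt_last i).ne hi
  · have := killCompl_rename_app (R := Qbar) (Fin.castSucc_injective N) (X i)
    rw [rename_X] at this
    rw [this, resH, aeval_X, Fin.snoc_castSucc]

lemma coeff_resH (F : MvPolynomial (Fin (N + 1)) Qbar) (s : Fin N →₀ ℕ) :
    (resH N F).coeff s = F.coeff (s.mapDomain Fin.castSucc) := by
  classical
  rw [resH_eq_killCompl]
  induction F using MvPolynomial.induction_on' with
  | monomial t a =>
    by_cases h : (t.support : Set (Fin (N + 1))) ⊆ Set.range Fin.castSucc
    · obtain ⟨t', rfl⟩ : ∃ t' : Fin N →₀ ℕ, t'.mapDomain Fin.castSucc = t :=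
        ⟨t.comapDomain Fin.castSucc (Fin.castSucc_injective N).injOn,
          Finsupp.mapDomain_comapDomain _ (Fin.castSucc_injective N) _ h⟩
      rw [killCompl_monomial_mapDomain, coeff_monomial, coeff_monomial]
      simp only [(Finsupp.mapDomain_injective (Fin.castSucc_injective N)).eq_iff]
    · rw [killCompl_monomial_eq_zero_of_not_subset _ _ h, coeff_zero, coeff_monomial, if_neg]
      rintro rfl
      refine h fun i hi => ?_
      obtain ⟨j, -, hj⟩ := Finset.mem_image.mp (Finsupp.mapDomain_support hi)
      exact ⟨j, hj⟩
  | add p q hp hq => rw [map_add, coeff_add, hp, hq, coeff_add]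

lemma gauss_resH_le (w : AbsoluteValue Qbar ℝ) (F : MvPolynomial (Fin (N + 1)) Qbar) :
    gauss w (resH N F) ≤ gauss w F :=
  gauss_le (gauss_nonneg _ _) fun s => by
    rw [coeff_resH]
    exact le_gauss w F _

lemma lg_resH_le (w : AbsoluteValue Qbar ℝ) {F : MvPolynomial (Fin (N + 1)) Qbar}
    (hF : resH N F ≠ 0) : lg w (resH N F) ≤ lg w F :=
  Real.log_le_log (gauss_pos w hF) (gauss_resH_le w F)

variable {A : Matrix (Fin N) (Fin N) Qbar} {b : Fin N → Qbar}
  {F : MvPolynomial (Fin (N + 1)) Qbar}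

lemma snoc_pow (x : Fin N → Qbar) (t : Qbar) :
    (Fin.snoc (α := fun _ => Qbar) x t : Fin (N + 1) → Qbar) ^ d =
      Fin.snoc (α := fun _ => Qbar) (x ^ d) (t ^ d) := by
  ext i
  refine Fin.lastCases ?_ (fun i => ?_) i <;> simp

/-- Dropping the last entry 1 turns the index set of the norm on ℙᴺ into all N-tuples of roots of
unity. Compared with the norm on H, which fixes one more entry, each conjugate occurs d times up to
a scalar. -/
lemma eval_resH_pushForm (hd : 0 < d) (hN : 1 ≤ N) (hA : IsUnit A.det) (hF : F.IsHomogeneous e)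
    (x : Fin N → Qbar) :
    eval (A.mulVec (x ^ d)) (resH N (pushForm d (augMatrix A b) F)) =
      ∏ ζ ∈ rootTuplesOn d (∅ : Finset (Fin N)), eval (ζ * x) (resH N F) := by
  have h1 : (Fin.snoc (α := fun _ => Qbar) (A.mulVec (x ^ d)) 0 : Fin (N + 1) → Qbar) =
      (augMatrix A b).mulVec ((Fin.snoc (α := fun _ => Qbar) x 0 : Fin (N + 1) → Qbar) ^ d) := by
    rw [snoc_pow, augMatrix_mulVec, zero_pow hd.ne', zero_smul, add_zero]
  rw [eval_resH, h1, eval_pushForm hd hN (isUnit_det_augMatrix hA) hF]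
  refine Finset.prod_bij' (fun ζ _ => Fin.init ζ)
    (fun ζ _ => (Fin.snoc (α := fun _ => Qbar) ζ 1 : Fin (N + 1) → Qbar)) ?_ ?_ ?_ ?_ ?_
  · intro ζ hζ
    rw [mem_rootTuplesOn hd]
    exact ⟨fun i => ((mem_rootTuples hd).mp hζ).1 i.castSucc, by simp⟩
  · intro ζ hζ
    rw [mem_rootTuples hd]
    refine ⟨fun i => ?_, by simp⟩
    refine Fin.lastCases ?_ (fun i => ?_) i
    · simp
    · simpa using ((mem_rootTuplesOn hd).mp hζ).1 i
  · intro ζ hζ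
    ext i
    refine Fin.lastCases ?_ (fun i => ?_) i
    · simp [((mem_rootTuples hd).mp hζ).2]
    · simp [Fin.init]
  · intro ζ _
    simp
  · intro ζ _
    rw [eval_resH]
    refine congrArg (fun y => eval y F) (funext fun i => ?_)
    refine Fin.lastCases ?_ (fun i => ?_) i <;> simp [Fin.init]

/-- On H the push-forward takes the values of a product of conjugates of the nonzero restriction. -/
lemma resH_pushForm_ne_zero (hd : 0 < d) (hN : 1 ≤ N) (hA : IsUnit A.det)
    (hF : F.IsHomogeneous e) (hF0 : resH N F ≠ 0) :
    resH N (pushForm d (augMatrix A b) F) ≠ 0 := by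
  intro h
  have h1 : ∏ ζ ∈ rootTuplesOn d (∅ : Finset (Fin N)), twist ζ (resH N F) = 0 := by
    refine MvPolynomial.funext fun x => ?_
    have h2 := eval_resH_pushForm (b := b) hd hN hA hF x
    rw [h, map_zero] at h2
    rw [map_zero, h2, map_prod]
    exact Finset.prod_congr rfl fun ζ _ => eval_twist ζ x _
  obtain ⟨ζ, hζ, h2⟩ := Finset.prod_eq_zero_iff.mp h1
  exact twist_ne_zero (ne_zero_of_rootTuplesOn hd hζ) hF0 h2

lemma resH_iterate_ne_zero (hd : 0 < d) (hN : 1 ≤ N) (hA : IsUnit A.det)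
    (hF : F.IsHomogeneous e) (hF0 : resH N F ≠ 0) (k : ℕ) :
    resH N ((pushForm d (augMatrix A b))^[k] F) ≠ 0 := by
  induction k with
  | zero => exact hF0
  | succ k ih =>
    rw [Function.iterate_succ_apply']
    exact resH_pushForm_ne_zero hd hN hA (iterate_pushForm_isHomogeneous hd hN hF k) ih

/-- Every tuple is uniquely its last entry times a tuple with last entry 1. -/
lemma prod_rootTuplesOn_empty (hd : 0 < d) (g : (Fin (n + 1) → Qbar) → Qbar) :
    ∏ ζ ∈ rootTuplesOn d (∅ : Finset (Fin (n + 1))), g ζ =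
      ∏ ω ∈ Polynomial.nthRootsFinset d (1 : Qbar), ∏ η ∈ rootTuples d n, g (ω • η) := by
  have hω : ∀ {ω : Qbar}, ω ∈ Polynomial.nthRootsFinset d (1 : Qbar) ↔ ω ^ d = 1 := fun {ω} =>
    Polynomial.mem_nthRootsFinset hd 1
  have hne : ∀ {ω : Qbar}, ω ^ d = 1 → ω ≠ 0 := by
    rintro ω h rfl
    rw [zero_pow hd.ne'] at h
    exact zero_ne_one h
  rw [← Finset.prod_product']
  refine Finset.prod_bij' (fun ζ _ => (ζ (Fin.last n), (ζ (Fin.last n))⁻¹ • ζ))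
    (fun p _ => p.1 • p.2) ?_ ?_ ?_ ?_ ?_
  · intro ζ hζ
    have h := ((mem_rootTuplesOn hd).mp hζ).1
    rw [Finset.mem_product, hω, mem_rootTuples hd]
    refine ⟨h _, fun i => ?_, ?_⟩
    · simp only [Pi.smul_apply, smul_eq_mul]
      rw [mul_pow, inv_pow, h, h, inv_one, one_mul]
    · simp only [Pi.smul_apply, smul_eq_mul]
      rw [inv_mul_cancel₀ (hne (h _))]
  · rintro ⟨ω, η⟩ hp
    rw [Finset.mem_product, hω, mem_rootTuples hd] at hp
    rw [mem_rootTuplesOn hd]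
    refine ⟨fun i => ?_, by simp⟩
    simp only [Pi.smul_apply, smul_eq_mul, mul_pow]
    rw [hp.1, hp.2.1, one_mul]
  · intro ζ hζ
    have h := ((mem_rootTuplesOn hd).mp hζ).1
    simp only [smul_smul]
    rw [mul_inv_cancel₀ (hne (h _)), one_smul]
  · rintro ⟨ω, η⟩ hp
    rw [Finset.mem_product, hω, mem_rootTuples hd] at hp
    simp only at hp
    have h1 : (ω • η) (Fin.last n) = ω := by
      rw [Pi.smul_apply, smul_eq_mul, hp.2.2, mul_one]
    simp only [h1, smul_smul]
    rw [inv_mul_cancel₀ (hne hp.1), one_smul]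
  · intro ζ hζ
    have h := ((mem_rootTuplesOn hd).mp hζ).1
    simp only [smul_smul]
    rw [mul_inv_cancel₀ (hne (h _)), one_smul]

/-- The restriction of a push-forward is a power of the push-forward of the restriction. -/
lemma associated_resH_pushForm {A : Matrix (Fin (n + 1)) (Fin (n + 1)) Qbar}
    {b : Fin (n + 1) → Qbar} {F : MvPolynomial (Fin (n + 1 + 1)) Qbar} (hd : 0 < d) (hn : 1 ≤ n)
    (hA : IsUnit A.det) (hF : F.IsHomogeneous e) :
    Associated (pushForm d A (resH (n + 1) F) ^ d)
      (resH (n + 1) (pushForm d (augMatrix A b) F)) := by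
  classical
  -- A scalar ω multiplies a form of degree e by ω^e; `c` collects these factors over the dⁿ
  -- conjugates and all ω.
  set c : Qbar := ∏ ω ∈ Polynomial.nthRootsFinset d (1 : Qbar), (ω ^ e) ^ d ^ n with hc
  have hc0 : c ≠ 0 := by
    refine Finset.prod_ne_zero_iff.mpr fun ω h => pow_ne_zero _ (pow_ne_zero _ ?_)
    rintro rfl
    rw [Polynomial.mem_nthRootsFinset hd, zero_pow hd.ne'] at h
    exact zero_ne_one h
  have hH := resH_isHomogeneous hF
  have key : resH (n + 1) (pushForm d (augMatrix A b) F) =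
      pushForm d A (resH (n + 1) F) ^ d * C c := by
    refine MvPolynomial.funext fun y => ?_
    obtain ⟨x, rfl⟩ := exists_mulVec_pow_eq hd hA y
    rw [eval_resH_pushForm hd (by omega) hA hF, prod_rootTuplesOn_empty hd, map_mul, map_pow,
      eval_pushForm hd hn hA hH, eval_C]
    have h1 : ∀ ω ∈ Polynomial.nthRootsFinset d (1 : Qbar),
        ∏ η ∈ rootTuples d n, eval (ω • η * x) (resH (n + 1) F) =
          (∏ η ∈ rootTuples d n, eval (η * x) (resH (n + 1) F)) * (ω ^ e) ^ d ^ n := by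
      intro ω _
      rw [← card_rootTuples (n := n) hd, ← Finset.prod_const, ← Finset.prod_mul_distrib]
      refine Finset.prod_congr rfl fun η _ => ?_
      rw [smul_mul_assoc, eval_smul_of_isHomogeneous hH, mul_comm]
    obtain ⟨ζ, hζ⟩ := exists_primitiveRoot_Qbar hd
    rw [Finset.prod_congr rfl h1, Finset.prod_mul_distrib, Finset.prod_const,
      hζ.card_nthRootsFinset]
  rw [key]
  exact associated_mul_unit_right _ _ ((isUnit_iff_ne_zero.mpr hc0).map C)

lemma pushForm_pow {M : Matrix (Fin (n + 1)) (Fin (n + 1)) Qbar}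
    {F : MvPolynomial (Fin (n + 1)) Qbar} (hd : 0 < d) (hn : 1 ≤ n) (hF : F.IsHomogeneous e)
    (k : ℕ) : pushForm d M (F ^ k) = pushForm d M F ^ k := by
  induction k with
  | zero => rw [pow_zero, pow_zero, pushForm_one hd hn]
  | succ k ih => rw [pow_succ, pushForm_mul hd hn (hF.pow k) hF, ih, pow_succ]

lemma associated_resH_iterate {A : Matrix (Fin (n + 1)) (Fin (n + 1)) Qbar}
    {b : Fin (n + 1) → Qbar} {F : MvPolynomial (Fin (n + 1 + 1)) Qbar} (hd : 0 < d) (hn : 1 ≤ n)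
    (hA : IsUnit A.det) (hF : F.IsHomogeneous e) (k : ℕ) :
    Associated ((pushForm d A)^[k] (resH (n + 1) F) ^ d ^ k)
      (resH (n + 1) ((pushForm d (augMatrix A b))^[k] F)) := by
  induction k with
  | zero => simp
  | succ k ih =>
    rw [Function.iterate_succ_apply', Function.iterate_succ_apply']
    have hQ := iterate_pushForm_isHomogeneous (M := A) hd hn (resH_isHomogeneous hF) k
    have h1 := pushForm_associated (M := A) hd hn (hQ.pow (d ^ k)) ih
    rw [pushForm_pow hd hn hQ] at h1
    have h2 := h1.pow_pow (n := d)
    rw [← pow_mul, ← pow_succ] at h2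
    exact h2.trans (associated_resH_pushForm hd hn hA
      (iterate_pushForm_isHomogeneous hd (by omega) hF k))

/-- Forms that do not vanish near the origin of the affine chart have large coefficients. -/
lemma lg_resH_add_le (hw : LocalPlace w ε) (hF : F.IsHomogeneous e)
    (hF0 : resH N F ≠ 0) {r : ℝ} (hr : 0 < r)
    (h : ∀ y : Fin N → Qbar, eval (Fin.snoc (α := fun _ => Qbar) y 1) F = 0 → ∃ i, r ≤ w (y i)) :
    lg w (resH N F) + e * Real.log r ≤ lg w F + ε * (2 * kap (N + 1) * (e + 1)) := by
  obtain ⟨y, hy, hy0, hlg⟩ := exists_lg_le_log_eval hw (resH_isHomogeneous hF) hF0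
  -- This is q(t) = F(ty, 1), where y lies in the unit polydisc and F|_H nearly attains its Gauss
  -- norm there. Its coefficient of degree e is F|_H(y), its constant term is F(0, 1), and its roots
  -- have absolute value at least r. Hence |F(0, 1)| ≥ |F|_H(y)| · r^e, while |F(0, 1)| is bounded
  -- by the Gauss norm of F.
  let q : Polynomial Qbar := ∑ s ∈ F.support,
    Polynomial.C (F.coeff s * ∏ i : Fin N, y i ^ s i.castSucc) *
      Polynomial.X ^ (∑ i : Fin N, s i.castSucc)
  have hqe : ∀ t, q.eval t = eval (Fin.snoc (α := fun _ => Qbar) (t • y) 1) F := by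
    intro t
    rw [eval_eq', Polynomial.eval_finsetSum]
    refine Finset.sum_congr rfl fun s _ => ?_
    rw [Fin.prod_univ_castSucc]
    simp only [Polynomial.eval_mul, Polynomial.eval_C, Polynomial.eval_pow, Polynomial.eval_X,
      Fin.snoc_castSucc, Fin.snoc_last, one_pow, mul_one, Pi.smul_apply, smul_eq_mul, mul_pow,
      Finset.prod_mul_distrib, Finset.prod_pow_eq_pow_sum]
    ring
  have hexp : ∀ s ∈ F.support, ∑ i : Fin N, s i.castSucc + s (Fin.last N) = e := fun s hs => by
    rw [← Fin.sum_univ_castSucc]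
    exact sum_exponent_of_isHomogeneous hF (mem_support_iff.mp hs)
  have hqc : q.coeff e = eval y (resH N F) := by
    rw [eval_resH, eval_eq', Polynomial.finsetSum_coeff]
    refine Finset.sum_congr rfl fun s hs => ?_
    rw [Fin.prod_univ_castSucc, Polynomial.coeff_C_mul, Polynomial.coeff_X_pow]
    simp only [Fin.snoc_castSucc, Fin.snoc_last]
    have := hexp s hs
    by_cases h0 : s (Fin.last N) = 0
    · rw [if_pos (by omega), h0]; ring
    · rw [if_neg (by omega), zero_pow h0]; ring
  have hqd : q.natDegree ≤ e := by
    refine Polynomial.natDegree_sum_le_of_forall_le _ _ fun s hs => ?_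
    refine (Polynomial.natDegree_C_mul_X_pow_le _ _).trans ?_
    have := hexp s hs
    omega
  have hqc0 : q.coeff e ≠ 0 := by rw [hqc]; exact hy0
  have hq0 : q ≠ 0 := by rintro h0; rw [h0] at hqc0; exact hqc0 rfl
  have hqd' : q.natDegree = e := le_antisymm hqd (Polynomial.le_natDegree_of_ne_zero hqc0)
  have hroots : ∀ t ∈ q.roots, r ≤ w t := by
    intro t ht
    have h1 := (Polynomial.mem_roots hq0).mp ht
    rw [Polynomial.IsRoot, hqe] at h1
    obtain ⟨i, hi⟩ := h _ h1
    rw [Pi.smul_apply, smul_eq_mul, map_mul] at hi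
    exact hi.trans (mul_le_of_le_one_right (w.nonneg t) (hy i))
  have hsplit := (IsAlgClosed.splits q).eq_prod_roots
  have hcard : q.roots.card = e := by
    rw [← hqd', (IsAlgClosed.splits q).natDegree_eq_card_roots]
  have hprod : ∀ S : Multiset Qbar, (∀ t ∈ S, r ≤ w t) →
      r ^ S.card ≤ w ((S.map fun t => Polynomial.X - Polynomial.C t).prod.eval 0) := by
    intro S
    induction S using Multiset.induction_on with
    | empty => simp
    | cons t S ih =>
      intro hS
      rw [Multiset.map_cons, Multiset.prod_cons, Multiset.card_cons, pow_succ', Polynomial.eval_mul,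
        map_mul]
      refine mul_le_mul ?_ (ih fun u hu => hS u (Multiset.mem_cons_of_mem hu)) (by positivity)
        (w.nonneg _)
      simpa using hS t (Multiset.mem_cons_self t S)
  have hF1 : eval (Fin.snoc (α := fun _ => Qbar) (0 : Fin N → Qbar) 1) F ≠ 0 := by
    intro h0
    obtain ⟨i, hi⟩ := h 0 h0
    rw [Pi.zero_apply, map_zero] at hi
    exact hr.not_ge hi
  have h1 : w (eval y (resH N F)) * r ^ e ≤
      w (eval (Fin.snoc (α := fun _ => Qbar) (0 : Fin N → Qbar) 1) F) := by
    have h2 := hqe 0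
    rw [zero_smul] at h2
    rw [← h2, hsplit, Polynomial.eval_mul, Polynomial.eval_C, map_mul, Polynomial.leadingCoeff,
      hqd', hqc]
    refine mul_le_mul_of_nonneg_left ?_ (w.nonneg _)
    rw [← hcard]
    exact hprod _ hroots
  have h2 := Real.log_le_log (mul_pos (w.pos hy0) (pow_pos hr e)) h1
  rw [Real.log_mul (w.pos hy0).ne' (pow_pos hr e).ne', Real.log_pow] at h2
  have h3 := log_eval_le hw hF hF1 one_pos (fun i => by
    refine Fin.lastCases ?_ (fun i => ?_) i <;> simp)
  rw [Real.log_one, mul_zero, add_zero] at h3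
  have hε : (0 : ℝ) ≤ ε := Nat.cast_nonneg ε
  have he : (0 : ℝ) ≤ e := Nat.cast_nonneg e
  have h4 : (ε : ℝ) * (kap N * (e + 1)) + ε * (kap (N + 1) * e) ≤
      ε * (2 * kap (N + 1) * (e + 1)) := by
    rw [← mul_add]
    refine mul_le_mul_of_nonneg_left ?_ hε
    have hk := kap_pos (N + 1)
    have hk' : kap N ≤ kap (N + 1) := by unfold kap; push_cast; linarith
    nlinarith
  linarith

end Restriction

/-! ### The lower bound -/

section Escape

open MvPolynomial

variable {N d e : ℕ} {w : AbsoluteValue Qbar ℝ} {ε : ℕ} {A : Matrix (Fin N) (Fin N) Qbar}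
  {b : Fin N → Qbar} {F : MvPolynomial (Fin (N + 1)) Qbar}

lemma exists_preimage (hd : 0 < d) (hN : 1 ≤ N) (hA : IsUnit A.det) (hF : F.IsHomogeneous e)
    {y : Fin N → Qbar}
    (hy : eval (Fin.snoc (α := fun _ => Qbar) y 1) (pushForm d (augMatrix A b) F) = 0) :
    ∃ x : Fin N → Qbar, y = A.mulVec (x ^ d) + b ∧
      eval (Fin.snoc (α := fun _ => Qbar) x 1) F = 0 := by
  obtain ⟨z, hz⟩ := exists_mulVec_pow_eq hd (isUnit_det_augMatrix (b := b) hA)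
    (Fin.snoc (α := fun _ => Qbar) y 1)
  have hzs : z = Fin.snoc (α := fun _ => Qbar) (Fin.init z) (z (Fin.last N)) :=
    (Fin.snoc_init_self z).symm
  rw [← hz, eval_pushForm hd hN (isUnit_det_augMatrix hA) hF, Finset.prod_eq_zero_iff] at hy
  obtain ⟨ζ, hζ, h⟩ := hy
  rw [mem_rootTuples hd] at hζ
  set t := z (Fin.last N) with ht
  rw [hzs, snoc_pow, augMatrix_mulVec] at hz
  have ht1 : t ^ d = 1 := by simpa using congrFun hz (Fin.last N)
  have ht0 : t ≠ 0 := by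
    rintro h0
    rw [h0, zero_pow hd.ne'] at ht1
    exact zero_ne_one ht1
  -- The last coordinate `t` of the preimage is a d-th root of unity; dividing by it returns to the
  -- affine chart without changing the image.
  refine ⟨fun i => t⁻¹ * (ζ i.castSucc * z i.castSucc), ?_, ?_⟩
  · have h1 : (fun i : Fin N => t⁻¹ * (ζ i.castSucc * z i.castSucc)) ^ d = Fin.init z ^ d := by
      ext i
      simp only [Pi.pow_apply, mul_pow, inv_pow, ht1, hζ.1, inv_one, one_mul, Fin.init]
    rw [h1]
    ext i
    have := congrFun hz i.castSucc
    simp only [Fin.snoc_castSucc, ht1, one_smul] at this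
    exact this.symm
  · have h2 : (Fin.snoc (α := fun _ => Qbar) (fun i => t⁻¹ * (ζ i.castSucc * z i.castSucc)) 1 :
        Fin (N + 1) → Qbar) = t⁻¹ • (ζ * z) := by
      ext i
      refine Fin.lastCases ?_ (fun i => ?_) i
      · simp [hζ.2, ← ht, ht0]
      · simp
    rw [h2, eval_smul_of_isHomogeneous hF, h, mul_zero]

lemma exists_le_mulVec (hw : LocalPlace w ε) (hA : IsUnit A.det)
    {v : Fin N → Qbar} {r : ℝ} {i : Fin N} (hr : r ≤ w (v i)) :
    ∃ j, r ≤ (N : ℝ) ^ ε * (matSup w A⁻¹ * w (A.mulVec v j)) := by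
  have : Nonempty (Fin N) := ⟨i⟩
  obtain ⟨j, hj⟩ := Finite.exists_max fun j => w (A.mulVec v j)
  refine ⟨j, hr.trans ?_⟩
  have := hw.mulVec_le A⁻¹ (w.nonneg _) hj i
  rwa [Matrix.mulVec_mulVec, Matrix.nonsing_inv_mul A hA, Matrix.one_mulVec] at this

/-- A translation dominated by the d-th power costs at most a factor 2, and nothing at ultrametric
places. -/
lemma exists_le_pow_add (hw : LocalPlace w ε) {x c : Fin N → Qbar} {ρ : ℝ} (hρ : 0 ≤ ρ)
    (hx : ∃ i, ρ ≤ w (x i)) (hc : ∀ j, (2 : ℝ) ^ ε * w (c j) < ρ ^ d) :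
    ∃ i, ρ ^ d ≤ (2 : ℝ) ^ ε * w ((x ^ d + c) i) := by
  obtain ⟨i, hi⟩ := hx
  refine ⟨i, ?_⟩
  have h1 : ρ ^ d ≤ w (x i ^ d) := by
    rw [map_pow]
    exact pow_le_pow_left₀ hρ hi d
  have h2 : x i ^ d = (x ^ d + c) i + -c i := by simp
  have h3 := hc i
  rcases hw with ⟨rfl, hw⟩ | ⟨rfl, -⟩
  · have h4 := hw ((x ^ d + c) i) (-c i)
    rw [← h2, AbsoluteValue.map_neg] at h4
    rw [pow_zero, one_mul] at h3 ⊢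
    rcases le_max_iff.mp h4 with h | h
    · exact h1.trans h
    · exact absurd (h1.trans h) h3.not_ge
  · have h4 := w.add_le ((x ^ d + c) i) (-c i)
    rw [← h2, AbsoluteValue.map_neg] at h4
    rw [pow_one] at h3 ⊢
    linarith

lemma mulVec_add_inv (hA : IsUnit A.det) (v : Fin N → Qbar) :
    A.mulVec v + b = A.mulVec (v + A⁻¹.mulVec b) := by
  rw [Matrix.mulVec_add, Matrix.mulVec_mulVec, Matrix.mul_nonsing_inv A hA, Matrix.one_mulVec]

/-- The iterated images of a coordinate hyperplane escape to infinity when `𝐛` is large. -/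
lemma escape (hw : LocalPlace w ε) (hd : 2 ≤ d) (hN : 1 ≤ N) (hA : IsUnit A.det) {i : Fin N}
    (hci : ∀ j, w (A⁻¹.mulVec b j) ≤ w (A⁻¹.mulVec b i)) (hc0 : A⁻¹.mulVec b i ≠ 0)
    (ha : 0 < matSup w A⁻¹) {l T : ℝ}
    (hl : ((d : ℝ) - 1) * l = ε * Real.log (2 * N) + Real.log (matSup w A⁻¹))
    (hT : l + T = Real.log (w (A⁻¹.mulVec b i)) - ε * Real.log N - Real.log (matSup w A⁻¹))
    (hT0 : 0 < T) (k : ℕ) (y : Fin N → Qbar)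
    (hy : eval (Fin.snoc (α := fun _ => Qbar) y 1)
      ((pushForm d (augMatrix A b))^[k + 1] (X i.castSucc ^ (d - 1))) = 0) :
    ∃ j, Real.exp (l + d ^ k * T) ≤ w (y j) := by
  have hd0 : 0 < d := by omega
  have hNpos : (0 : ℝ) < N := by exact_mod_cast hN
  set c := A⁻¹.mulVec b with hc
  have hcpos : 0 < w (c i) := w.pos hc0
  have hN2 : Real.log (2 * N) = Real.log 2 + Real.log N :=
    Real.log_mul two_ne_zero hNpos.ne'
  have e1 : (N : ℝ) ^ ε = Real.exp (ε * Real.log N) := by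
    rw [mul_comm, Real.exp_mul, Real.exp_log hNpos, Real.rpow_natCast]
  have e2 : (2 : ℝ) ^ ε = Real.exp (ε * Real.log 2) := by
    rw [mul_comm, Real.exp_mul, Real.exp_log two_pos, Real.rpow_natCast]
  have e3 : matSup w A⁻¹ = Real.exp (Real.log (matSup w A⁻¹)) := (Real.exp_log ha).symm
  have e4 : w (c i) = Real.exp (Real.log (w (c i))) := (Real.exp_log hcpos).symm
  have hhom : (X i.castSucc ^ (d - 1) : MvPolynomial (Fin (N + 1)) Qbar).IsHomogeneous (d - 1) := by
    simpa using (isHomogeneous_X Qbar i.castSucc).pow (d - 1)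
  -- One step sends a lower bound R for the logarithmic size to dR - ε log(2N) - log|A⁻¹|. The fixed
  -- point of this affine map is `l`, so the excess over `l` is multiplied by d each time. The first
  -- image of Xᵢ = 0 has excess at least `T`, because x^d + A⁻¹𝐛 has i-th coordinate (A⁻¹𝐛)ᵢ there.
  induction k generalizing y with
  | zero =>
    obtain ⟨x, rfl, hx⟩ := exists_preimage hd0 hN hA hhom hy
    rw [map_pow, eval_X, Fin.snoc_castSucc] at hx
    have hx0 : x i = 0 := eq_zero_of_pow_eq_zero hx
    rw [mulVec_add_inv hA]
    have h1 : w (c i) ≤ w ((x ^ d + A⁻¹.mulVec b) i) := by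
      rw [Pi.add_apply, Pi.pow_apply, hx0, zero_pow hd0.ne', zero_add]
    obtain ⟨j, hj⟩ := exists_le_mulVec hw hA h1
    refine ⟨j, ?_⟩
    rw [pow_zero, one_mul, hT]
    rw [← mul_assoc, e1, e3, e4, ← Real.exp_add, ← div_le_iff₀' (Real.exp_pos _),
      ← Real.exp_sub] at hj
    rwa [sub_sub]
  | succ k ih =>
    rw [Function.iterate_succ_apply'] at hy
    obtain ⟨x, rfl, hx⟩ := exists_preimage hd0 hN hA
      (iterate_pushForm_isHomogeneous hd0 hN hhom (k + 1)) hy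
    have h1 := ih x hx
    have hE : Real.exp (l + d ^ k * T) ^ d = Real.exp (d * l + d ^ (k + 1) * T) := by
      rw [← Real.exp_nat_mul]
      congr 1
      ring
    -- By the definitions of `l` and `T`, the logarithm of 2^ε |cᵢ| equals d·l + T, which is less
    -- than d·l + d^(k+1)·T because T > 0.
    obtain ⟨m, hm⟩ := exists_le_pow_add (d := d) (c := c) hw (Real.exp_pos _).le h1 (fun j => by
      refine (mul_le_mul_of_nonneg_left (hci j) (by positivity)).trans_lt ?_
      rw [hE, e2, e4, ← Real.exp_add, Real.exp_lt_exp]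
      have h2 : (1 : ℝ) < d ^ (k + 1) := one_lt_pow₀ (by exact_mod_cast hd) (Nat.succ_ne_zero k)
      rw [hN2] at hl
      nlinarith)
    rw [mulVec_add_inv hA]
    rw [← div_le_iff₀' (by positivity)] at hm
    obtain ⟨j, hj⟩ := exists_le_mulVec hw hA hm
    refine ⟨j, ?_⟩
    rw [← mul_assoc, e1, e2, e3, hE, ← Real.exp_add, ← Real.exp_sub,
      ← div_le_iff₀' (Real.exp_pos _), ← Real.exp_sub] at hj
    refine le_trans (le_of_eq ?_) hj
    congr 1
    rw [hN2] at hl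
    linarith

end Escape

/-! ### Local comparison with the restriction to infinity -/

section LowerBound

open MvPolynomial

variable {N d e : ℕ} {w : AbsoluteValue Qbar ℝ} {ε : ℕ} {A : Matrix (Fin N) (Fin N) Qbar}
  {b : Fin N → Qbar}

/-- The part of the critical divisor of an affine map not supported at infinity. -/
def affineCritForm (d N : ℕ) : MvPolynomial (Fin (N + 1)) Qbar := ∏ i : Fin N, X i.castSucc ^ (d - 1)

lemma isHomogeneous_prod_X_pow (s : Finset (Fin N)) :
    (∏ i ∈ s, X i.castSucc ^ (d - 1) : MvPolynomial (Fin (N + 1)) Qbar).IsHomogeneous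
      (s.card * (d - 1)) := by
  have := IsHomogeneous.prod s (fun i => (X i.castSucc ^ (d - 1) : MvPolynomial _ Qbar))
    (fun _ => d - 1) fun i _ => by simpa using (isHomogeneous_X Qbar i.castSucc).pow (d - 1)
  simpa using this

lemma affineCritForm_isHomogeneous (d N : ℕ) :
    (affineCritForm d N).IsHomogeneous (N * (d - 1)) := by
  simpa [affineCritForm] using isHomogeneous_prod_X_pow (d := d) (Finset.univ : Finset (Fin N))

lemma resH_prod_X_pow (s : Finset (Fin N)) :
    resH N (∏ i ∈ s, X i.castSucc ^ (d - 1)) = ∏ i ∈ s, X i ^ (d - 1) := by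
  simp [resH]

lemma resH_affineCritForm (d N : ℕ) : resH N (affineCritForm d N) = critForm d N :=
  resH_prod_X_pow _

lemma resH_prod_X_pow_ne_zero (s : Finset (Fin N)) :
    resH N (∏ i ∈ s, X i.castSucc ^ (d - 1)) ≠ 0 := by
  rw [resH_prod_X_pow]
  exact Finset.prod_ne_zero_iff.mpr fun i _ => pow_ne_zero _ (X_ne_zero i)

lemma ne_zero_of_resH {F : MvPolynomial (Fin (N + 1)) Qbar} (h : resH N F ≠ 0) : F ≠ 0 := by
  rintro rfl
  exact h (map_zero _)

/-- Split off the factor Xᵢ^(d-1). Its push-forward has degree d^((k+1)(N-1))·(d-1) and no zeros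
within the escape radius, so it gains its degree times the logarithmic radius. For the remaining
factors it suffices that restriction does not increase the Gauss norm. -/
lemma local_lower_of_escape (hw : LocalPlace w ε) (hd : 2 ≤ d) (hN : 1 ≤ N) (hA : IsUnit A.det)
    {i : Fin N} (hci : ∀ j, w (A⁻¹.mulVec b j) ≤ w (A⁻¹.mulVec b i)) (hc0 : A⁻¹.mulVec b i ≠ 0)
    (ha : 0 < matSup w A⁻¹) {l T : ℝ}
    (hl : ((d : ℝ) - 1) * l = ε * Real.log (2 * N) + Real.log (matSup w A⁻¹))
    (hT : l + T = Real.log (w (A⁻¹.mulVec b i)) - ε * Real.log N - Real.log (matSup w A⁻¹))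
    (hT0 : 0 < T) (k : ℕ) :
    lg w (resH N ((pushForm d (augMatrix A b))^[k + 1] (affineCritForm d N))) +
      d ^ ((k + 1) * (N - 1)) * (d - 1) * (l + d ^ k * T) ≤
    lg w ((pushForm d (augMatrix A b))^[k + 1] (affineCritForm d N)) +
      ε * (4 * kap (N + 1) * (d ^ ((k + 1) * (N - 1)) * (N * (d - 1)) + 1)) := by
  classical
  have hd0 : 0 < d := by omega
  have hL := isUnit_det_augMatrix (b := b) hA
  set φ := (pushForm d (augMatrix A b))^[k + 1] with hφ
  set D := d ^ ((k + 1) * (N - 1)) with hD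
  let f₁ : MvPolynomial (Fin (N + 1)) Qbar := ∏ j ∈ {i}, X j.castSucc ^ (d - 1)
  let f₂ : MvPolynomial (Fin (N + 1)) Qbar := ∏ j ∈ Finset.univ.erase i, X j.castSucc ^ (d - 1)
  have hf₁ : f₁.IsHomogeneous (d - 1) := by
    simpa [f₁] using isHomogeneous_prod_X_pow (d := d) ({i} : Finset (Fin N))
  have hf₂ : f₂.IsHomogeneous ((N - 1) * (d - 1)) := by
    have := isHomogeneous_prod_X_pow (d := d) (Finset.univ.erase i)
    rwa [Finset.card_erase_of_mem (Finset.mem_univ i), Finset.card_univ, Fintype.card_fin] at this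
  have hmul : affineCritForm d N = f₁ * f₂ := by
    rw [affineCritForm, ← Finset.mul_prod_erase _ _ (Finset.mem_univ i)]
    simp [f₁, f₂]
  have hφ₁ : (φ f₁).IsHomogeneous (D * (d - 1)) := iterate_pushForm_isHomogeneous hd0 hN hf₁ _
  have hφ₂ : (φ f₂).IsHomogeneous (D * ((N - 1) * (d - 1))) :=
    iterate_pushForm_isHomogeneous hd0 hN hf₂ _
  have hf₁' : f₁ = X i.castSucc ^ (d - 1) := by simp [f₁]
  have hr₁ : resH N (φ f₁) ≠ 0 :=
    resH_iterate_ne_zero hd0 hN hA hf₁ (resH_prod_X_pow_ne_zero _) _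
  have hr₂ : resH N (φ f₂) ≠ 0 :=
    resH_iterate_ne_zero hd0 hN hA hf₂ (resH_prod_X_pow_ne_zero _) _
  have hsplit : φ (affineCritForm d N) = φ f₁ * φ f₂ := by
    rw [hmul, hφ, iterate_pushForm_mul hd0 hN hf₁ hf₂]
  have h1 := le_lg_mul hw hφ₁ hφ₂ (ne_zero_of_resH hr₁) (ne_zero_of_resH hr₂)
  have h2 := lg_mul_le hw (resH_isHomogeneous hφ₁) hr₁ hr₂
  have h3 := lg_resH_le w hr₂
  have h4 := lg_resH_add_le hw hφ₁ hr₁ (Real.exp_pos (l + d ^ k * T))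
    (fun y hy => escape hw hd hN hA hci hc0 ha hl hT hT0 k y (by rw [← hf₁']; exact hy))
  rw [Real.log_exp] at h4
  rw [hsplit, map_mul]
  have hdc : ((d - 1 : ℕ) : ℝ) = d - 1 := by rw [Nat.cast_sub (by omega), Nat.cast_one]
  have hNc : ((N - 1 : ℕ) : ℝ) = N - 1 := by rw [Nat.cast_sub hN, Nat.cast_one]
  have hDc : (D : ℝ) = (d : ℝ) ^ ((k + 1) * (N - 1)) := by rw [hD]; push_cast; rfl
  push_cast [hdc, hNc] at h1 h2 h4
  rw [← hDc]
  have hDpos : (0 : ℝ) ≤ D := Nat.cast_nonneg D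
  have hε : (0 : ℝ) ≤ ε := Nat.cast_nonneg ε
  have hk := kap_pos (N + 1)
  have hk' : kap N ≤ kap (N + 1) := by unfold kap; push_cast; linarith
  have hd1 : (1 : ℝ) ≤ d := by exact_mod_cast hd0
  have hN1 : (1 : ℝ) ≤ N := by exact_mod_cast hN
  have hx : 0 ≤ (D : ℝ) * (d - 1) := mul_nonneg hDpos (by linarith)
  have hxN : (D : ℝ) * (d - 1) ≤ D * (N * (d - 1)) := by nlinarith
  have h5 : (ε : ℝ) * (kap (N + 1) * (D * (d - 1) + D * ((N - 1) * (d - 1)) + 1)) +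
      ε * (kap N * (D * (d - 1))) + ε * (2 * kap (N + 1) * (D * (d - 1) + 1)) ≤
      ε * (4 * kap (N + 1) * (D * (N * (d - 1)) + 1)) := by
    rw [← mul_add, ← mul_add]
    refine mul_le_mul_of_nonneg_left ?_ hε
    have h6 : kap N * (D * (d - 1)) ≤ kap (N + 1) * (D * (N * (d - 1))) :=
      mul_le_mul hk' hxN hx hk.le
    have h7 := mul_le_mul_of_nonneg_left hxN hk.le
    nlinarith
  linarith

/-- An error constant for the lower bound. -/
def lowerConst (N d : ℕ) : ℝ :=
  4 * kap (N + 1) * (N * d + 1) + (N + 2) * detConst N + 3 * N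

lemma le_lowerConst (N d : ℕ) : (N + 1) * detConst N + 3 * N ≤ lowerConst N d := by
  have h := detConst_nonneg N
  have hkap := kap_pos (N + 1)
  have : 0 ≤ 4 * kap (N + 1) * ((N : ℝ) * d + 1) := by positivity
  unfold lowerConst
  linarith

lemma escape_error_le (hd : 1 ≤ d) {D E : ℝ} (hDE : D ≤ E) (hE : 1 ≤ E) :
    4 * kap (N + 1) * (D * (N * ((d : ℝ) - 1)) + 1) + detConst N * E +
      E * (detConst N + 3 * N) ≤ lowerConst N d * E := by
  have h := detConst_nonneg N
  have hkap := kap_pos (N + 1)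
  have hd1 : (1 : ℝ) ≤ d := by exact_mod_cast hd
  have hN : (0 : ℝ) ≤ N := Nat.cast_nonneg N
  have h1 : D * (N * (d - 1)) ≤ E * (N * d) :=
    mul_le_mul hDE (mul_le_mul_of_nonneg_left (by linarith) hN)
      (mul_nonneg hN (by linarith)) (by linarith)
  have h2 := mul_le_mul_of_nonneg_left (add_le_add h1 hE) (by positivity : 0 ≤ 4 * kap (N + 1))
  have h3 : 0 ≤ (N : ℝ) * detConst N * E := by positivity
  unfold lowerConst
  linarith

/-- Comparison of the size of `𝐛` with the escape rate. -/
lemma main_term_le {lb a a' s l T : ℝ} (hd : 2 ≤ d) (hN : 1 ≤ N)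
    (h1 : a' ≤ (N - 1) * a + ε * detConst N) (h5 : lb ≤ ε * Real.log N + (a + s))
    (hl : ((d : ℝ) - 1) * l = ε * Real.log (2 * N) + a')
    (hT : T = s - ε * Real.log N - a' - l) :
    ((d : ℝ) - 1) / d * lb - (N - 1 / d) * a ≤
      ((d : ℝ) - 1) / d * T + ε * (detConst N + 3 * N) := by
  have hεn : (0 : ℝ) ≤ ε := Nat.cast_nonneg ε
  have hdR : (2 : ℝ) ≤ d := by exact_mod_cast hd
  have hNR : (1 : ℝ) ≤ N := by exact_mod_cast hN
  have hd' : (1 : ℝ) / d ≤ 1 := by rw [div_le_one (by linarith)]; linarith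
  have hd'' : (0 : ℝ) ≤ 1 / d := by positivity
  have hdd : ((d : ℝ) - 1) / d = 1 - 1 / d := by field_simp
  have hlogN : Real.log N ≤ N := Real.log_le_self (by linarith)
  have hlog2N : Real.log (2 * N) ≤ 2 * N := Real.log_le_self (by linarith)
  -- Inserting `l` makes the coefficient of `a'` exactly -1. Then `s` is at least `lb - a` and `a'`
  -- at most `(N - 1) * a`, up to errors, so the total coefficient of `a` is -(1 - 1/d) - (N - 1) =
  -- -(N - 1/d).
  have hTd : ((d : ℝ) - 1) / d * T =
      (1 - 1 / d) * s - a' - ε * ((1 - 1 / d) * Real.log N + 1 / d * Real.log (2 * N)) := by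
    have : ((d : ℝ) - 1) / d * T =
        (((d : ℝ) - 1) * (s - ε * Real.log N - a') - ((d : ℝ) - 1) * l) / d := by
      rw [hT]; ring
    rw [this, hl]
    field_simp
    ring
  rw [hTd, hdd]
  have h6 := mul_le_mul_of_nonneg_left h5 (by linarith : (0 : ℝ) ≤ 1 - 1 / d)
  have h7 : (1 - 1 / (d : ℝ)) * Real.log N + 1 / d * Real.log (2 * N) +
      (1 - 1 / d) * Real.log N ≤ 3 * N := by
    have h8 : (1 / (d : ℝ)) * Real.log (2 * N) ≤ 1 / d * (2 * N) :=
      mul_le_mul_of_nonneg_left hlog2N hd''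
    have h9 : (1 - 1 / (d : ℝ)) * Real.log N ≤ (1 - 1 / d) * N :=
      mul_le_mul_of_nonneg_left hlogN (by linarith)
    linarith
  have h10 := mul_le_mul_of_nonneg_left h7 hεn
  linarith

/-- Where 𝐛 is large enough compared with A for the escape argument, that argument applies. At the
other places the main term is at most the admissible error. The resulting inequality has the same
shape at every place and can be summed. -/
lemma local_lower (hw : LocalPlace w ε) (hd : 2 ≤ d) (hN : 1 ≤ N) (hA : A.det = 1) (k : ℕ) :
    lg w (resH N ((pushForm d (augMatrix A b))^[k + 1] (affineCritForm d N))) +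
      d ^ ((k + 1) * N) * (((d : ℝ) - 1) / d * Real.log (setSup w (pointSet b)) -
        (N - 1 / d) * Real.log (matSup w A)) ≤
    lg w ((pushForm d (augMatrix A b))^[k + 1] (affineCritForm d N)) +
      ε * (lowerConst N d * d ^ ((k + 1) * N)) := by
  have hd0 : 0 < d := by omega
  have hA' : IsUnit A.det := by rw [hA]; exact isUnit_one
  have hdR : (2 : ℝ) ≤ d := by exact_mod_cast hd
  have hNR : (1 : ℝ) ≤ N := by exact_mod_cast hN
  have hεn : (0 : ℝ) ≤ ε := Nat.cast_nonneg ε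
  have hdet := detConst_nonneg N
  set a := Real.log (matSup w A) with ha
  set a' := Real.log (matSup w A⁻¹) with ha'
  set E : ℝ := (d : ℝ) ^ ((k + 1) * N) with hE
  have hE1 : 1 ≤ E := one_le_pow_cast hd0 _
  have hr : resH N ((pushForm d (augMatrix A b))^[k + 1] (affineCritForm d N)) ≠ 0 :=
    resH_iterate_ne_zero hd0 hN hA' (affineCritForm_isHomogeneous d N)
      (resH_prod_X_pow_ne_zero _) _
  have hle := lg_resH_le w hr
  have h1 : a' ≤ (N - 1) * a + ε * detConst N := log_matSup_inv_le hw hN hA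
  have h2 : 0 ≤ a + ε * detConst N := le_log_matSup hw hN hA
  have h3 : 0 ≤ a' + ε * detConst N := le_log_matSup hw hN (inv_det_eq_one hA)
  have hapos : 0 < matSup w A := matSup_pos_of_det w hN (hA.trans_ne one_ne_zero)
  have hapos' : 0 < matSup w A⁻¹ := matSup_pos_of_det w hN ((inv_det_eq_one hA).trans_ne one_ne_zero)
  have hd' : (1 : ℝ) / d ≤ 1 := by rw [div_le_one (by linarith)]; linarith
  have hd'' : (0 : ℝ) ≤ 1 / d := by positivity
  have hdd : ((d : ℝ) - 1) / d = 1 - 1 / d := by field_simp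
  have hεδ : 0 ≤ ε * detConst N := mul_nonneg hεn hdet
  have hεN : 0 ≤ ε * (N : ℝ) := mul_nonneg hεn (by linarith)
  have hNεδ : 0 ≤ (N : ℝ) * (ε * detConst N) := mul_nonneg (by linarith) hεδ
  -- the trivial bound suffices when the main term is small
  have trivial_case : ((d : ℝ) - 1) / d * Real.log (setSup w (pointSet b)) - (N - 1 / d) * a ≤
      ε * ((N + 1) * detConst N + 3 * N) →
      lg w (resH N ((pushForm d (augMatrix A b))^[k + 1] (affineCritForm d N))) +
        E * (((d : ℝ) - 1) / d * Real.log (setSup w (pointSet b)) - (N - 1 / d) * a) ≤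
      lg w ((pushForm d (augMatrix A b))^[k + 1] (affineCritForm d N)) +
        ε * (lowerConst N d * E) := fun h => by
    have h4 := mul_le_mul_of_nonneg_left h (by linarith : (0 : ℝ) ≤ E)
    have h7 := mul_le_mul_of_nonneg_left (le_lowerConst N d)
      (mul_nonneg hεn (by linarith : (0 : ℝ) ≤ E))
    have h8 : E * (ε * ((N + 1) * detConst N + 3 * N)) =
      ε * E * ((N + 1) * detConst N + 3 * N) := by ring
    have h9 : ε * E * lowerConst N d = ε * (lowerConst N d * E) := by ring
    linarith
  obtain ⟨v, hv, hvs⟩ := exists_eq_setSup w ⟨1, one_mem_pointSet b⟩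
  rcases mem_pointSet_iff.mp hv with rfl | ⟨m, rfl⟩
  · refine trivial_case ?_
    rw [hvs, map_one, Real.log_one, mul_zero, zero_sub]
    have h4 := mul_nonneg (by linarith : (0 : ℝ) ≤ N - 1 / d) h2
    have h5 := mul_nonneg hd'' hεδ
    linarith
  · have hbm : 0 < w (b m) := by
      rw [← hvs]
      linarith [one_le_setSup_pointSet w b]
    have : Nonempty (Fin N) := ⟨m⟩
    -- The index depends on the place. This is allowed because the critical form contains every
    -- coordinate.
    obtain ⟨i, hci⟩ := Finite.exists_max fun j => w (A⁻¹.mulVec b j)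
    have hbc : A.mulVec (A⁻¹.mulVec b) = b := by
      rw [Matrix.mulVec_mulVec, Matrix.mul_nonsing_inv A hA', Matrix.one_mulVec]
    have hbm' := hw.mulVec_le A (w.nonneg _) hci m
    rw [hbc] at hbm'
    have hcpos : 0 < w (A⁻¹.mulVec b i) := by
      rcases (w.nonneg (A⁻¹.mulVec b i)).eq_or_lt with h | h
      · rw [← h, mul_zero, mul_zero] at hbm'
        exact absurd hbm' hbm.not_ge
      · exact h
    have hc0 : A⁻¹.mulVec b i ≠ 0 := (w.pos_iff).mp hcpos
    have h5 := Real.log_le_log hbm hbm'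
    rw [Real.log_mul (by positivity) (by positivity), Real.log_mul hapos.ne' hcpos.ne',
      Real.log_pow, ← hvs] at h5
    obtain ⟨l, hl⟩ : ∃ l : ℝ, ((d : ℝ) - 1) * l = ε * Real.log (2 * N) + a' :=
      ⟨(ε * Real.log (2 * N) + a') / ((d : ℝ) - 1), mul_div_cancel₀ _ (by linarith)⟩
    obtain ⟨T, hT⟩ : ∃ T, T = Real.log (w (A⁻¹.mulVec b i)) - ε * Real.log N - a' - l := ⟨_, rfl⟩
    have hmain := main_term_le hd hN h1 h5 hl hT
    by_cases hT0 : 0 < T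
    · have h6 := local_lower_of_escape hw hd hN hA' hci hc0 hapos' (l := l) (T := T) hl
        (by rw [hT]; ring) hT0 k
      have hEeq : E = d ^ ((k + 1) * (N - 1)) * (d ^ k * d) := by
        rw [hE, ← pow_succ, ← pow_add]
        congr 1
        obtain ⟨N', rfl⟩ : ∃ N', N = N' + 1 := ⟨N - 1, by omega⟩
        rw [Nat.add_sub_cancel]; ring
      set D : ℝ := (d : ℝ) ^ ((k + 1) * (N - 1)) with hD
      have hD1 : 1 ≤ D := one_le_pow_cast hd0 _
      have hDE : D ≤ E := by
        rw [hEeq]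
        exact le_mul_of_one_le_right (by linarith)
          (one_le_mul_of_one_le_of_one_le (one_le_pow_cast hd0 k) (by linarith))
      have h7 : D * (d - 1) * (l + d ^ k * T) = D * (((d : ℝ) - 1) * l) +
          E * (((d : ℝ) - 1) / d * T) := by
        rw [hEeq]; field_simp
      have h8 : -(ε * (detConst N * E)) ≤ D * (((d : ℝ) - 1) * l) := by
        rw [hl]
        have h9 : -(ε * detConst N) ≤ ε * Real.log (2 * N) + a' := by
          have := mul_nonneg hεn (Real.log_nonneg (by linarith : (1 : ℝ) ≤ 2 * N))
          linarith
        have h10 := mul_le_mul_of_nonneg_left h9 (by linarith : (0 : ℝ) ≤ D)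
        have h11 := mul_le_mul_of_nonneg_right hDE hεδ
        linarith
      have h9 := mul_le_mul_of_nonneg_left hmain (by linarith : (0 : ℝ) ≤ E)
      have h10 := mul_le_mul_of_nonneg_left (escape_error_le (N := N) hd0 hDE hE1) hεn
      rw [h7] at h6
      linarith
    · refine trivial_case (hmain.trans ?_)
      have h6 : ((d : ℝ) - 1) / d * T ≤ 0 :=
        mul_nonpos_of_nonneg_of_nonpos (by rw [hdd]; linarith) (not_lt.mp hT0)
      linarith

end LowerBound

/-! ### From local estimates to the bounds for critical heights -/

section Comparison

open MvPolynomial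

variable {N n d e : ℕ} {A : Matrix (Fin N) (Fin N) Qbar} {b : Fin N → Qbar}

lemma critForm_succ (d N : ℕ) :
    critForm d (N + 1) = X (Fin.last N) ^ (d - 1) * affineCritForm d N := by
  rw [critForm, Fin.prod_univ_castSucc, mul_comm, affineCritForm]

/-- The hyperplane at infinity is totally invariant, and all conjugates of its equation coincide. -/
lemma pushForm_X_last (hd : 0 < d) (hN : 1 ≤ N) (hA : IsUnit A.det) :
    pushForm d (augMatrix A b) (X (Fin.last N)) = X (Fin.last N) ^ d ^ (N - 1) := by
  refine MvPolynomial.funext fun y => ?_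
  obtain ⟨x, rfl⟩ := exists_mulVec_pow_eq hd (isUnit_det_augMatrix (b := b) hA) y
  have h1 : (augMatrix A b).mulVec (x ^ d) (Fin.last N) = x (Fin.last N) ^ d := by
    rw [← Fin.snoc_init_self x, snoc_pow, augMatrix_mulVec, Fin.snoc_last, Fin.snoc_last]
  rw [eval_pushForm hd hN (isUnit_det_augMatrix hA) (isHomogeneous_X _ _), map_pow, eval_X, h1,
    ← pow_mul, ← pow_succ', Nat.sub_add_cancel hN, ← card_rootTuples (n := N) hd,
    ← Finset.prod_const]
  refine Finset.prod_congr rfl fun ζ hζ => ?_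
  rw [eval_X, Pi.mul_apply, ((mem_rootTuples hd).mp hζ).2, one_mul]

lemma iterate_pushForm_X_last (hd : 0 < d) (hN : 1 ≤ N) (hA : IsUnit A.det) (a k : ℕ) :
    ∃ a', (pushForm d (augMatrix A b))^[k] (X (Fin.last N) ^ a) = X (Fin.last N) ^ a' := by
  induction k with
  | zero => exact ⟨a, rfl⟩
  | succ k ih =>
    obtain ⟨a', h⟩ := ih
    refine ⟨d ^ (N - 1) * a', ?_⟩
    rw [Function.iterate_succ_apply', h, pushForm_pow hd hN (isHomogeneous_X _ _),
      pushForm_X_last hd hN hA, ← pow_mul]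

/-- The component of the critical divisor at infinity contributes only a monomial. It is discarded
before restricting, since it would restrict to zero. -/
lemma coeffs_iterate_critForm (hd : 0 < d) (hN : 1 ≤ N) (hA : IsUnit A.det) (k : ℕ) :
    ((pushForm d (augMatrix A b))^[k] (critForm d (N + 1))).coeffs =
      ((pushForm d (augMatrix A b))^[k] (affineCritForm d N)).coeffs := by
  obtain ⟨a, ha⟩ := iterate_pushForm_X_last (b := b) hd hN hA (d - 1) k
  rw [critForm_succ, iterate_pushForm_mul hd hN ((isHomogeneous_X _ _).pow _)
    (affineCritForm_isHomogeneous d N), ha, X_pow_eq_monomial, coeffs_monomial_mul]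

lemma setHeight_resH_le (hd : 2 ≤ d) (hN : 1 ≤ N) (hA : A.det = 1) (k : ℕ) :
    setHeight (resH N ((pushForm d (augMatrix A b))^[k + 1] (affineCritForm d N))).coeffs +
      d ^ ((k + 1) * N) * (((d : ℝ) - 1) / d * vecHeight b - (N - 1 / d) * matHeight A) ≤
    setHeight ((pushForm d (augMatrix A b))^[k + 1] (affineCritForm d N)).coeffs +
      lowerConst N d * d ^ ((k + 1) * N) := by
  have hd0 : 0 < d := by omega
  have hA' : IsUnit A.det := by rw [hA]; exact isUnit_one
  have hA0 : A ≠ 0 := by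
    rintro rfl
    have : Nonempty (Fin N) := ⟨⟨0, hN⟩⟩
    rw [Matrix.det_zero] at hA
    exact zero_ne_one hA
  have hr : resH N ((pushForm d (augMatrix A b))^[k + 1] (affineCritForm d N)) ≠ 0 :=
    resH_iterate_ne_zero hd0 hN hA' (affineCritForm_isHomogeneous d N)
      (resH_prod_X_pow_ne_zero _) _
  have h := setHeight_sum_le ![(resH N ((pushForm d (augMatrix A b))^[k + 1]
      (affineCritForm d N))).coeffs, pointSet b, entries A,
      ((pushForm d (augMatrix A b))^[k + 1] (affineCritForm d N)).coeffs]
    (fun j => by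
      fin_cases j
      · exact exists_mem_coeffs_ne_zero hr
      · exact ⟨1, one_mem_pointSet b, one_ne_zero⟩
      · exact exists_entry_ne_zero hA0
      · exact exists_mem_coeffs_ne_zero (ne_zero_of_resH hr))
    ![1, d ^ ((k + 1) * N) * (((d : ℝ) - 1) / d), -(d ^ ((k + 1) * N) * (N - 1 / d)), -1]
    (lowerConst N d * d ^ ((k + 1) * N)) (fun w ε hw => by
      have h1 := local_lower (b := b) hw hd hN hA k
      rw [matSup_eq] at h1
      unfold lg gauss at h1
      simp only [Fin.sum_univ_four, Matrix.cons_val]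
      linarith)
  simp only [Fin.sum_univ_four, Matrix.cons_val] at h
  rw [matHeight_eq, vecHeight_eq]
  linarith

lemma le_setHeight_pow {m : ℕ} {F : MvPolynomial (Fin m) Qbar} (hF : F.IsHomogeneous e)
    (hF0 : F ≠ 0) (k : ℕ) :
    k * setHeight F.coeffs ≤ setHeight (F ^ k).coeffs + kap m * (2 * k * e + k + 1) := by
  have h := setHeight_sum_le ![F.coeffs, (F ^ k).coeffs]
    (fun j => by
      fin_cases j
      · exact exists_mem_coeffs_ne_zero hF0
      · exact exists_mem_coeffs_ne_zero (pow_ne_zero k hF0)) ![(k : ℝ), -1]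
    (kap m * (2 * k * e + k + 1)) (fun w ε hw => by
      have h1 := le_lg_pow hw hF hF0 k
      unfold lg gauss at h1
      simp only [Fin.sum_univ_two, Matrix.cons_val]
      linarith)
  simp only [Fin.sum_univ_two, Matrix.cons_val] at h
  linarith

/-- An error constant for the restriction to the hyperplane at infinity. -/
def restrictConst (N d : ℕ) : ℝ := kap N * (2 * N * d + 2)

/-- The restriction of the k-th push-forward is the dᵏ-th power of the k-th push-forward on H. This
power accounts for the difference between the normalisations d^(kN) on ℙᴺ and d^(k(N-1)) on H. For N
= 1 the left side is zero. -/
lemma canonicalSeq_restrict_le (hd : 2 ≤ d) (hN : 1 ≤ N) (hA : IsUnit A.det) (k : ℕ) :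
    canonicalSeq d (powerMap d A) (critDivisor (powerMap d A)) k * d ^ (k * N) ≤
      setHeight (resH N ((pushForm d (augMatrix A b))^[k] (affineCritForm d N))).coeffs +
        restrictConst N d * d ^ (k * N) := by
  have hd0 : 0 < d := by omega
  have hdR : (0 : ℝ) < d := by exact_mod_cast hd0
  have hkap := kap_pos N
  obtain ⟨n, rfl⟩ : ∃ n, N = n + 1 := ⟨N - 1, by omega⟩
  rcases Nat.eq_zero_or_pos n with rfl | hn
  · rw [canonicalSeq_fin_one, zero_mul]
    have := setHeight_nonneg
      (resH (0 + 1) ((pushForm d (augMatrix A b))^[k] (affineCritForm d (0 + 1)))).coeffs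
    have : 0 ≤ restrictConst (0 + 1) d * (d : ℝ) ^ (k * (0 + 1)) := by
      unfold restrictConst; positivity
    linarith
  · rw [canonicalSeq_powerMap hd0 hn hA (isFormOf_critDivisor hd0 hA)]
    have hQ := iterate_pushForm_isHomogeneous (M := A) hd0 hn (critForm_isHomogeneous d (n + 1)) k
    have hQ0 := iterate_pushForm_ne_zero hd0 hn hA (critForm_isHomogeneous d (n + 1))
      (critForm_ne_zero d (n + 1)) k
    have h1 := associated_resH_iterate (b := b) hd0 hn hA (affineCritForm_isHomogeneous d (n + 1)) k
    rw [resH_affineCritForm] at h1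
    rw [← setHeight_coeffs_of_associated h1 (pow_ne_zero _ hQ0)]
    have h2 := le_setHeight_pow hQ hQ0 (d ^ k)
    have h3 : (d : ℝ) ^ (k * (n + 1)) = d ^ (k * n) * d ^ k := by rw [← pow_add, Nat.mul_succ]
    have h4 : setHeight ((pushForm d A)^[k] (critForm d (n + 1))).coeffs / (d : ℝ) ^ (k * n) *
        d ^ (k * (n + 1)) =
        ((d ^ k : ℕ) : ℝ) * setHeight ((pushForm d A)^[k] (critForm d (n + 1))).coeffs := by
      rw [h3]; push_cast; field_simp
    rw [h4]
    refine h2.trans (add_le_add_right ?_ _)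
    rw [restrictConst, mul_assoc (kap (n + 1)) _ (_ ^ _)]
    refine mul_le_mul_of_nonneg_left ?_ hkap.le
    have h5 : (1 : ℝ) ≤ d ^ (k * n) := one_le_pow_cast hd0 _
    have h6 : (1 : ℝ) ≤ d ^ k := one_le_pow_cast hd0 _
    have h7 : (d : ℝ) ^ k * d ^ (k * (n - 1)) = d ^ (k * n) := by
      rw [← pow_add]
      congr 1
      obtain ⟨n, rfl⟩ : ∃ n', n = n' + 1 := ⟨n - 1, by omega⟩
      rw [Nat.add_sub_cancel]; ring
    have hdc : ((d - 1 : ℕ) : ℝ) = d - 1 := by rw [Nat.cast_sub (by omega), Nat.cast_one]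
    push_cast [hdc]
    have h8 : 2 * (d : ℝ) ^ k * (d ^ (k * (n - 1)) * ((n + 1) * (d - 1))) =
        d ^ (k * n) * (2 * (n + 1) * (d - 1)) := by rw [← h7]; ring
    rw [h8, h3]
    have h9 : (d : ℝ) ^ (k * n) ≤ d ^ (k * n) * d ^ k := le_mul_of_one_le_right (by positivity) h6
    have h10 : (d : ℝ) ^ k ≤ d ^ (k * n) * d ^ k := le_mul_of_one_le_left (by positivity) h5
    have h11 : (d : ℝ) ^ (k * n) * (2 * (n + 1) * (d - 1)) ≤
        d ^ (k * n) * d ^ k * (2 * (n + 1) * d) := by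
      refine mul_le_mul h9 (by nlinarith) ?_ (by positivity)
      have : (1 : ℝ) ≤ d := by exact_mod_cast hd0
      exact mul_nonneg (by positivity) (by linarith)
    linarith

lemma neg_le_critHeight_powerMap (hd : 2 ≤ d) (hN : 1 ≤ N) (hA : IsUnit A.det) :
    Tendsto (canonicalSeq d (powerMap d A) (critDivisor (powerMap d A))) atTop
      (𝓝 (critHeight d (powerMap d A))) ∧
      -(N * matHeight A + pushConst (N - 1) d * (N + 1)) ≤ critHeight d (powerMap d A) := by
  obtain ⟨n, rfl⟩ : ∃ n, N = n + 1 := ⟨N - 1, by omega⟩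
  rcases Nat.eq_zero_or_pos n with rfl | hn
  · have h0 : canonicalSeq d (powerMap d A) (critDivisor (powerMap d A)) = fun _ => 0 :=
      funext fun k => canonicalSeq_fin_one _ _ k
    have h3 : critHeight d (powerMap d A) = 0 := by
      rw [critHeight, canonicalHeight, h0]
      exact tendsto_const_nhds.limUnder_eq
    refine ⟨?_, ?_⟩
    · rw [h3, h0]
      exact tendsto_const_nhds
    · rw [h3]
      have := matHeight_nonneg A
      have := pushConst_nonneg (0 + 1 - 1) d
      have : 0 ≤ ((0 + 1 : ℕ) : ℝ) * matHeight A +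
        pushConst (0 + 1 - 1) d * (((0 + 1 : ℕ) : ℝ) + 1) := by positivity
      linarith
  · obtain ⟨h3, -, h4⟩ := canonicalSeq_bounds hd hn hA
    refine ⟨h3, le_trans (le_of_eq ?_) h4⟩
    rw [Nat.add_sub_cancel]
    push_cast
    ring

/-- The critical heights of `𝐗 ↦ A 𝐗ᵈ + 𝐛` and of its restriction to infinity. -/
theorem critHeight_bounds (hd : 2 ≤ d) (hN : 1 ≤ N) : ∃ C₁ C₂ : ℝ,
    ∀ (A : Matrix.SpecialLinearGroup (Fin N) Qbar) (b : Fin N → Qbar),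
      Tendsto (canonicalSeq d (affinePowerMap d A.1 b) (critDivisor (affinePowerMap d A.1 b))) atTop
          (𝓝 (critHeight d (affinePowerMap d A.1 b))) ∧
      Tendsto (canonicalSeq d (restrictH (affinePowerMap d A.1 b))
          (critDivisor (restrictH (affinePowerMap d A.1 b)))) atTop
          (𝓝 (critHeight d (restrictH (affinePowerMap d A.1 b)))) ∧
      ((d : ℝ) - 1) / d * vecHeight b - (N - 1 / d) * matHeight A.1 - C₁ ≤
        critHeight d (affinePowerMap d A.1 b) - critHeight d (restrictH (affinePowerMap d A.1 b)) ∧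
      critHeight d (affinePowerMap d A.1 b) - critHeight d (restrictH (affinePowerMap d A.1 b)) ≤
        (N + 1) * vecHeight b + (N * (N + 1) - 1) * matHeight A.1 + C₂ := by
  have hd0 : 0 < d := by omega
  have hdR : (0 : ℝ) < d := by exact_mod_cast hd0
  refine ⟨lowerConst N d + restrictConst N d,
    (N + 1) * (2 * detConst N + N) + pushConst N d * (N + 2) + pushConst (N - 1) d * (N + 1),
    fun A b => ?_⟩
  have hA := A.2
  have hA' : IsUnit A.1.det := by rw [hA]; exact isUnit_one
  rw [restrictH_affinePowerMap A.1 b hd0, affinePowerMap_eq]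
  obtain ⟨h1, h2, -⟩ := canonicalSeq_bounds hd hN (isUnit_det_augMatrix (b := b) hA')
  obtain ⟨h3, h4⟩ := neg_le_critHeight_powerMap hd hN hA'
  refine ⟨h1, h3, ?_, ?_⟩
  -- The escape estimate starts with the first push-forward, hence the shift by 1 before passing to
  -- the limit.
  · refine ge_of_tendsto ((h1.sub h3).comp (tendsto_add_atTop_nat 1)) (Eventually.of_forall fun k => ?_)
    simp only [Function.comp_apply]
    have h5 := canonicalSeq_restrict_le (b := b) hd hN hA' (k + 1)
    have h6 := setHeight_resH_le (b := b) hd hN hA k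
    rw [canonicalSeq_powerMap hd0 hN (isUnit_det_augMatrix hA')
      (isFormOf_critDivisor hd0 (isUnit_det_augMatrix hA')), coeffs_iterate_critForm hd0 hN hA']
    have hE : (0 : ℝ) < d ^ ((k + 1) * N) := by positivity
    rw [le_sub_iff_add_le, le_div_iff₀ hE]
    linarith
  -- The coefficient of h(A) is (N + 1)(N - 1) from the inverse matrix plus N from the lower bound
  -- on H.
  · have h5 := matHeight_augMatrix_inv_le hN hA b
    have h6 := mul_le_mul_of_nonneg_left h5 (by positivity : (0 : ℝ) ≤ N + 1)
    linarith

end Comparison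

/-! ### Conjugates -/

section Conjugates

open MvPolynomial

variable {m d : ℕ} {w : AbsoluteValue Qbar ℝ} {ε : ℕ}

/-- The coefficients of the forms of a tuple. -/
def tupleSet (Φ : FormTuple m) : Finset Qbar := by
  classical exact Finset.univ.biUnion fun i => (Φ i).coeffs

lemma mem_tupleSet {Φ : FormTuple m} {a : Qbar} : a ∈ tupleSet Φ ↔ ∃ i, a ∈ (Φ i).coeffs := by
  classical
  simp [tupleSet]

lemma tupleHeight_eq (Φ : FormTuple m) : tupleHeight Φ = setHeight (tupleSet Φ) := by
  classical
  rw [tupleHeight, absLogHeight_eq_setHeight]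
  congr 1
  ext a
  rw [mem_tupleSet]
  simp only [Finset.mem_image, Finset.mem_univ, true_and, Sigma.exists, Subtype.exists,
    mem_coeffs_iff, exists_prop, eq_comm]

lemma gauss_le_tupleSet (w : AbsoluteValue Qbar ℝ) (Φ : FormTuple m) (i : Fin m) :
    gauss w (Φ i) ≤ setSup w (tupleSet Φ) :=
  setSup_le w (setSup_nonneg _ _) fun _ ha => le_setSup w (mem_tupleSet.mpr ⟨i, ha⟩)

/-- The linear form given by a row of a matrix. -/
def rowForm (B : Matrix (Fin m) (Fin m) Qbar) (l : Fin m) : MvPolynomial (Fin m) Qbar :=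
  ∑ r, C (B l r) * X r

lemma rowForm_isHomogeneous (B : Matrix (Fin m) (Fin m) Qbar) (l : Fin m) :
    (rowForm B l).IsHomogeneous 1 := isHomogeneous_linearForm _

lemma eval_rowForm (B : Matrix (Fin m) (Fin m) Qbar) (l : Fin m) (x : Fin m → Qbar) :
    eval x (rowForm B l) = B.mulVec x l := by
  simp [rowForm, Matrix.mulVec, dotProduct]

lemma pderiv_rowForm (B : Matrix (Fin m) (Fin m) Qbar) (l j : Fin m) :
    pderiv j (rowForm B l) = C (B l j) := by
  rw [rowForm, map_sum, Finset.sum_eq_single j]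
  · rw [pderiv_C_mul, pderiv_X_self, mul_one]
  · intro r _ hr
    rw [pderiv_C_mul, pderiv_X_of_ne hr, mul_zero]
  · simp

lemma coeff_rowForm (B : Matrix (Fin m) (Fin m) Qbar) (l r : Fin m) :
    (rowForm B l).coeff (Finsupp.single r 1) = B l r := by
  classical
  rw [rowForm, coeff_sum, Finset.sum_eq_single r]
  · rw [coeff_C_mul, coeff_X, if_pos rfl, mul_one]
  · intro j _ hj
    rw [coeff_C_mul, coeff_X, if_neg, mul_zero]
    intro h
    exact hj (Finsupp.single_left_injective one_ne_zero h)
  · simp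

lemma LocalPlace.natCast_le (hw : LocalPlace w ε) (k : ℕ) : w (k : Qbar) ≤ (k : ℝ) ^ ε := by
  have := hw.sum_le (Finset.range k) (fun _ => (1 : Qbar)) zero_le_one (fun _ _ => by simp)
  simpa using this

lemma gauss_pderiv_le (hw : LocalPlace w ε) (hd : 1 ≤ d) {F : MvPolynomial (Fin m) Qbar}
    (hF : F.IsHomogeneous d) (j : Fin m) :
    gauss w (pderiv j F) ≤ (d : ℝ) ^ ε * gauss w F := by
  classical
  refine gauss_le (mul_nonneg (by positivity) (gauss_nonneg w F)) fun s => ?_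
  by_cases h0 : F.coeff (s + Finsupp.single j 1) = 0
  · rw [coeff_pderiv, h0]
    simpa using mul_nonneg (by positivity) (gauss_nonneg w F)
  · rw [coeff_pderiv, map_mul, mul_comm]
    refine mul_le_mul ?_ (le_gauss w F _) (w.nonneg _) (by positivity)
    have h1 := exponent_le_of_isHomogeneous hF h0 j
    simp only [Finsupp.add_apply, Finsupp.single_eq_same] at h1
    have h2 := hw.natCast_le (s j + 1)
    push_cast at h2
    refine h2.trans (pow_le_pow_eps (by positivity) ?_ ε)
    exact_mod_cast h1

variable {L : Matrix (Fin m) (Fin m) Qbar} (M : GL (Fin m) Qbar)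

lemma conjBy_powerMap (i : Fin m) : conjBy M (powerMap d L) i =
    ∑ k, C ((M⁻¹).1 i k) * ∑ l, C (L k l) * rowForm M.1 l ^ d := by
  simp [conjBy, powerMap, rowForm]

lemma conjBy_powerMap_isHomogeneous (i : Fin m) :
    (conjBy M (powerMap d L) i).IsHomogeneous d := by
  rw [conjBy_powerMap]
  refine IsHomogeneous.sum _ _ _ fun k _ => ?_
  have h1 : (∑ l, C (L k l) * rowForm M.1 l ^ d).IsHomogeneous d :=
    IsHomogeneous.sum _ _ _ fun l _ => by
      simpa using (isHomogeneous_C (Fin m) (L k l)).mul ((rowForm_isHomogeneous M.1 l).pow d)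
  simpa using (isHomogeneous_C (Fin m) ((M⁻¹).1 i k)).mul h1

lemma eval_conjBy_powerMap (x : Fin m → Qbar) (i : Fin m) :
    eval x (conjBy M (powerMap d L) i) =
      (M⁻¹).1.mulVec (L.mulVec ((M.1.mulVec x) ^ d)) i := by
  rw [conjBy_powerMap]
  simp [Matrix.mulVec, dotProduct, eval_rowForm]

/-- Chain rule: the determinants of M and M⁻¹ cancel, and the rows of M remain visible as the linear
factors of the critical divisor. -/
lemma det_pderiv_conjBy : (Matrix.of fun i j => pderiv j (conjBy M (powerMap d L) i)).det =
    C (L.det * (d : Qbar) ^ m) * (∏ l, rowForm M.1 l) ^ (d - 1) := by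
  have h : (Matrix.of fun i j => pderiv j (conjBy M (powerMap d L) i)) =
      C.mapMatrix (M⁻¹).1 * C.mapMatrix L *
        Matrix.diagonal (fun l => C (d : Qbar) * rowForm M.1 l ^ (d - 1)) * C.mapMatrix M.1 := by
    ext1 i j
    rw [Matrix.mul_assoc, Matrix.mul_assoc, Matrix.mul_apply, Matrix.of_apply, conjBy_powerMap,
      map_sum]
    refine Finset.sum_congr rfl fun k _ => ?_
    rw [pderiv_C_mul, map_sum, Matrix.mul_apply]
    simp only [RingHom.mapMatrix_apply, Matrix.map_apply]
    congr 1
    refine Finset.sum_congr rfl fun l _ => ?_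
    rw [pderiv_C_mul, pderiv_pow, pderiv_rowForm, Matrix.diagonal_mul]
    simp
  have hM : (M⁻¹).1.det * M.1.det = 1 := by
    rw [← Matrix.det_mul, ← Units.val_mul, inv_mul_cancel, Units.val_one, Matrix.det_one]
  rw [h, Matrix.det_mul, Matrix.det_mul, Matrix.det_mul, Matrix.det_diagonal,
    Finset.prod_mul_distrib, ← RingHom.map_det, ← RingHom.map_det, ← RingHom.map_det,
    Finset.prod_const, Finset.prod_pow, Finset.card_univ, Fintype.card_fin]
  have h2 : C (σ := Fin m) ((M⁻¹).1.det) * C M.1.det = 1 := by rw [← C_mul, hM, C_1]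
  simp only [C_mul, C_pow]
  linear_combination (C L.det * C (d : Qbar) ^ m * (∏ l, rowForm M.1 l) ^ (d - 1)) * h2

/-- Rows of an invertible matrix can be scaled to have an entry `1`. -/
lemma exists_normalized_rows : ∃ (D : Fin m → Qbar) (M' : Matrix (Fin m) (Fin m) Qbar),
    (∀ l, D l ≠ 0) ∧ M.1 = Matrix.diagonal D * M' ∧ ∀ l, ∃ r, M' l r = 1 := by
  have h : ∀ l, ∃ r, M.1 l r ≠ 0 := by
    intro l
    by_contra! h
    have h1 : IsUnit M.1.det := (Matrix.isUnit_iff_isUnit_det _).mp M.isUnit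
    exact h1.ne_zero (Matrix.det_eq_zero_of_row_eq_zero l h)
  choose r hr using h
  refine ⟨fun l => M.1 l (r l), Matrix.of fun l j => M.1 l j / M.1 l (r l), hr, ?_, fun l =>
    ⟨r l, div_self (hr l)⟩⟩
  ext l j
  rw [Matrix.diagonal_mul, Matrix.of_apply, mul_div_cancel₀ _ (hr l)]

/-- An error constant for the rows of a conjugating matrix. -/
def rowConst (m d : ℕ) : ℝ :=
  d * (kap m * (m ^ 2 * 2) + kap m * (m + 1)) + detConst m + m * (m * d + d)

/-- The Jacobian determinant of the conjugate is a constant times the (d-1)-th power of the product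
of the rows of M'. It is also an m × m determinant whose entries are controlled by the coefficients
of the conjugate. Normalised rows have Gauss norm at least 1, so each entry of M' is controlled by
the product of all rows. The constant containing D is kept exactly, to be removed by the product
formula. -/
lemma log_matSup_rows_le (hw : LocalPlace w ε) (hd : 2 ≤ d) (hm : 1 ≤ m) (hL : L.det ≠ 0)
    {D : Fin m → Qbar} {M' : Matrix (Fin m) (Fin m) Qbar} (hD : ∀ l, D l ≠ 0)
    (hM : M.1 = Matrix.diagonal D * M') (h1 : ∀ l, ∃ r, M' l r = 1) :
    ((d : ℝ) - 1) * Real.log (matSup w M') +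
        Real.log (w (L.det * (d : Qbar) ^ m * (∏ l, D l) ^ (d - 1))) ≤
      m * Real.log (setSup w (tupleSet (conjBy M (powerMap d L)))) + ε * rowConst m d := by
  classical
  set g := conjBy M (powerMap d L) with hg
  set G := setSup w (tupleSet g) with hG
  have hd0 : 0 < d := by omega
  have hεn : (0 : ℝ) ≤ ε := Nat.cast_nonneg ε
  have hkap := kap_pos m
  have hdc : ((d - 1 : ℕ) : ℝ) = d - 1 := by rw [Nat.cast_sub (by omega), Nat.cast_one]
  have hrow0 : ∀ l, rowForm M' l ≠ 0 := fun l h => by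
    obtain ⟨r, hr⟩ := h1 l
    have := coeff_rowForm M' l r
    rw [h, coeff_zero, hr] at this
    exact zero_ne_one this
  have hrow1 : ∀ l, 0 ≤ lg w (rowForm M' l) := fun l => by
    obtain ⟨r, hr⟩ := h1 l
    have := le_gauss w (rowForm M' l) (Finsupp.single r 1)
    rw [coeff_rowForm, hr, map_one] at this
    exact Real.log_nonneg this
  set P := ∏ l, rowForm M' l with hP
  have hP0 : P ≠ 0 := Finset.prod_ne_zero_iff.mpr fun l _ => hrow0 l
  have hPh : P.IsHomogeneous m := by
    have := IsHomogeneous.prod Finset.univ (fun l => rowForm M' l) (fun _ => 1)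
      fun l _ => rowForm_isHomogeneous M' l
    simpa using this
  have hrows : ∏ l, rowForm M.1 l = C (∏ l, D l) * P := by
    rw [hP, map_prod, ← Finset.prod_mul_distrib]
    refine Finset.prod_congr rfl fun l _ => ?_
    rw [rowForm, rowForm, Finset.mul_sum]
    refine Finset.sum_congr rfl fun r _ => ?_
    rw [hM, Matrix.diagonal_mul, C_mul, mul_assoc]
  -- the entries of the matrix and the linear forms
  have hsup : Real.log (matSup w M') ≤ ∑ l, lg w (rowForm M' l) := by
    have hne : (entries M').Nonempty := by
      refine ⟨M' ⟨0, hm⟩ ⟨0, hm⟩, ?_⟩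
      exact Finset.mem_image.mpr ⟨(⟨0, hm⟩, ⟨0, hm⟩), Finset.mem_univ _, rfl⟩
    obtain ⟨a, ha, has⟩ := exists_eq_setSup w hne
    obtain ⟨⟨l, r⟩, -, rfl⟩ := Finset.mem_image.mp ha
    obtain ⟨r', hr'⟩ := h1 l
    have hpos : 1 ≤ matSup w M' := by
      have := le_matSup w M' l r'
      rwa [hr', map_one] at this
    have h2 := le_gauss w (rowForm M' l) (Finsupp.single r 1)
    rw [coeff_rowForm] at h2
    have h3 : Real.log (matSup w M') ≤ lg w (rowForm M' l) :=
      Real.log_le_log (by linarith) (by rw [matSup_eq, has]; exact h2)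
    exact h3.trans (Finset.single_le_sum (f := fun l => lg w (rowForm M' l))
      (fun l _ => hrow1 l) (Finset.mem_univ l))
  have hprod := le_lg_prod hw Finset.univ (fun l => rowForm M' l)
    (fun l _ => rowForm_isHomogeneous M' l) fun l _ => hrow0 l
  rw [Finset.card_univ, Fintype.card_fin, ← hP, Nat.cast_one] at hprod
  obtain ⟨x, hx, hx0, hlg⟩ := exists_lg_le_log_eval hw hPh hP0
  -- the Jacobian determinant at `x`
  have hdet : (Matrix.of fun i j => eval x (pderiv j (g i))).det =
      L.det * (d : Qbar) ^ m * (∏ l, D l) ^ (d - 1) * eval x P ^ (d - 1) := by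
    have h2 := congrArg (eval x) (det_pderiv_conjBy (d := d) (L := L) M)
    rw [RingHom.map_det, hrows] at h2
    simp only [map_mul, map_pow, eval_C, mul_pow] at h2
    rw [mul_assoc _ _ (eval x P ^ (d - 1))]
    exact h2
  have hc0 : L.det * (d : Qbar) ^ m * (∏ l, D l) ^ (d - 1) ≠ 0 :=
    mul_ne_zero (mul_ne_zero hL (pow_ne_zero _ (Nat.cast_ne_zero.mpr hd0.ne')))
      (pow_ne_zero _ (Finset.prod_ne_zero_iff.mpr fun l _ => hD l))
  have hG0 : 0 ≤ G := setSup_nonneg _ _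
  set B : ℝ := ((d : ℝ) ^ m) ^ ε * ((d : ℝ) ^ ε * G) with hB
  have hB0 : 0 ≤ B := by positivity
  have hentry : ∀ i j, w (eval x (pderiv j (g i))) ≤ B := by
    intro i j
    have h2 := conjBy_powerMap_isHomogeneous (d := d) (L := L) M i
    have h3 := eval_le hw (h2.pderiv (i := j)) zero_le_one hx
    rw [one_pow, mul_one, Nat.sub_add_cancel hd0] at h3
    refine h3.trans (mul_le_mul_of_nonneg_left ?_ (by positivity))
    refine (gauss_pderiv_le hw hd0 h2 j).trans (mul_le_mul_of_nonneg_left ?_ (by positivity))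
    exact gauss_le_tupleSet w g i
  have hdet_le := hw.det_le (Matrix.of fun i j => eval x (pderiv j (g i))) (fun _ => hB0) hentry
  rw [hdet, map_mul, map_pow, Finset.prod_const, Finset.card_univ, Fintype.card_fin] at hdet_le
  have hwc := w.pos hc0
  have hwP := w.pos hx0
  have hGpos : 0 < G := by
    rcases hG0.eq_or_lt with h | h
    · rw [hB, ← h, mul_zero, mul_zero, zero_pow (by omega), mul_zero] at hdet_le
      exact absurd hdet_le (mul_pos hwc (pow_pos hwP _)).not_ge
    · exact h
  have hdR : (0 : ℝ) < d := by exact_mod_cast hd0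
  have hfac : (0 : ℝ) < m.factorial := by exact_mod_cast m.factorial_pos
  have hlog := Real.log_le_log (mul_pos hwc (pow_pos hwP _)) hdet_le
  rw [Real.log_mul hwc.ne' (pow_pos hwP _).ne', Real.log_pow, hdc,
    Real.log_mul (by positivity) (by positivity), Real.log_pow, Real.log_pow, hB,
    Real.log_mul (by positivity) (by positivity), Real.log_mul (by positivity) hGpos.ne',
    Real.log_pow, Real.log_pow, Real.log_pow] at hlog
  have hfac' : Real.log m.factorial = detConst m := rfl
  rw [hfac'] at hlog
  have hlogd : Real.log d ≤ d := Real.log_le_self hdR.le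
  have hmR : (0 : ℝ) ≤ m := Nat.cast_nonneg m
  have h2 : (m : ℝ) * (ε * (m * Real.log d) + (ε * Real.log d + Real.log G)) ≤
      ε * (m * (m * d + d)) + m * Real.log G := by
    have h3 : (m : ℝ) * (m * Real.log d + Real.log d) ≤ m * (m * d + d) :=
      mul_le_mul_of_nonneg_left (add_le_add (mul_le_mul_of_nonneg_left hlogd hmR) hlogd) hmR
    have h4 := mul_le_mul_of_nonneg_left h3 hεn
    linarith
  have hd1 : (0 : ℝ) ≤ d - 1 := by
    have : (2 : ℝ) ≤ d := by exact_mod_cast hd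
    linarith
  have h5 : Real.log (matSup w M') ≤ Real.log (w (eval x P)) +
      ε * (kap m * (m ^ 2 * 2) + kap m * (m + 1)) := by
    have : ε * (kap m * ((m : ℝ) ^ 2 * (1 + 1))) + ε * (kap m * (m + 1)) =
      ε * (kap m * (m ^ 2 * 2) + kap m * (m + 1)) := by ring
    linarith
  have h6 := mul_le_mul_of_nonneg_left h5 hd1
  have h7 : ((d : ℝ) - 1) * (ε * (kap m * (m ^ 2 * 2) + kap m * (m + 1))) ≤
      ε * (d * (kap m * (m ^ 2 * 2) + kap m * (m + 1))) := by
    have : 0 ≤ ε * (kap m * ((m : ℝ) ^ 2 * 2) + kap m * (m + 1)) := by positivity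
    linarith
  unfold rowConst
  linarith

lemma tupleSet_ne_zero (hd : 2 ≤ d) (hm : 1 ≤ m) (hL : L.det ≠ 0) :
    ∃ a ∈ tupleSet (conjBy M (powerMap d L)), a ≠ 0 := by
  by_contra! h
  have hzero : ∀ i, conjBy M (powerMap d L) i = 0 := by
    intro i
    by_contra h0
    obtain ⟨a, ha, ha0⟩ := exists_mem_coeffs_ne_zero h0
    exact ha0 (h a (mem_tupleSet.mpr ⟨i, ha⟩))
  have h1 := det_pderiv_conjBy (d := d) (L := L) M
  have : Nonempty (Fin m) := ⟨⟨0, hm⟩⟩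
  have h2 : (Matrix.of fun i j => pderiv j (conjBy M (powerMap d L) i)) = 0 := by
    ext1 i j
    rw [Matrix.of_apply, hzero, map_zero, Matrix.zero_apply]
  rw [h2, Matrix.det_zero] at h1
  refine mul_ne_zero (C_ne_zero.mpr (mul_ne_zero hL
    (pow_ne_zero _ (Nat.cast_ne_zero.mpr (by omega))))) (pow_ne_zero _
    (Finset.prod_ne_zero_iff.mpr fun l _ h3 => ?_)) h1.symm
  have h4 : IsUnit M.1.det := (Matrix.isUnit_iff_isUnit_det _).mp M.isUnit
  refine h4.ne_zero (Matrix.det_eq_zero_of_row_eq_zero l fun r => ?_)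
  rw [← coeff_rowForm M.1 l r, h3, coeff_zero]

lemma setSup_singleton (w : AbsoluteValue Qbar ℝ) (c : Qbar) : setSup w {c} = w c :=
  le_antisymm (setSup_le w (w.nonneg c) fun a ha => by
    rw [Finset.mem_singleton.mp ha]) (le_setSup w (Finset.mem_singleton_self c))

lemma setHeight_singleton (c : Qbar) : setHeight {c} = 0 :=
  setHeight_of_subsingleton fun a ha b hb => by
    rw [Finset.mem_singleton.mp ha, Finset.mem_singleton.mp hb]

lemma matHeight_rows_le (hd : 2 ≤ d) (hm : 1 ≤ m) (hL : L.det ≠ 0)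
    {D : Fin m → Qbar} {M' : Matrix (Fin m) (Fin m) Qbar} (hD : ∀ l, D l ≠ 0)
    (hM : M.1 = Matrix.diagonal D * M') (h1 : ∀ l, ∃ r, M' l r = 1) :
    matHeight M' ≤ m * tupleHeight (conjBy M (powerMap d L)) + rowConst m d := by
  have hM0 : M' ≠ 0 := by
    rintro rfl
    obtain ⟨r, hr⟩ := h1 ⟨0, hm⟩
    exact zero_ne_one hr
  have hc0 : L.det * (d : Qbar) ^ m * (∏ l, D l) ^ (d - 1) ≠ 0 :=
    mul_ne_zero (mul_ne_zero hL (pow_ne_zero _ (Nat.cast_ne_zero.mpr (by omega))))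
      (pow_ne_zero _ (Finset.prod_ne_zero_iff.mpr fun l _ => hD l))
  have h := setHeight_sum_le ![entries M', tupleSet (conjBy M (powerMap d L)),
      {L.det * (d : Qbar) ^ m * (∏ l, D l) ^ (d - 1)}]
    (fun j => by
      fin_cases j
      · exact exists_entry_ne_zero hM0
      · exact tupleSet_ne_zero M hd hm hL
      · exact ⟨_, Finset.mem_singleton_self _, hc0⟩)
    ![(d : ℝ) - 1, -(m : ℝ), 1] (rowConst m d) (fun w ε hw => by
      have h2 := log_matSup_rows_le M hw hd hm hL hD hM h1
      rw [matSup_eq] at h2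
      simp only [Fin.sum_univ_three, Matrix.cons_val]
      rw [setSup_singleton]
      linarith)
  simp only [Fin.sum_univ_three, Matrix.cons_val] at h
  rw [setHeight_singleton, ← matHeight_eq, ← tupleHeight_eq] at h
  have h2 := matHeight_nonneg M'
  have hd2 : (2 : ℝ) ≤ d := by exact_mod_cast hd
  nlinarith

end Conjugates

/-! ### Recovering the diagonal conjugate -/

section ScaledMatrix

open MvPolynomial

variable {m d : ℕ} {w : AbsoluteValue Qbar ℝ} {ε : ℕ}

/-- The matrix of the conjugate of `𝐗 ↦ L 𝐗ᵈ` by the diagonal matrix with entries `D`. -/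
def scaledMatrix (d : ℕ) (D : Fin m → Qbar) (L : Matrix (Fin m) (Fin m) Qbar) :
    Matrix (Fin m) (Fin m) Qbar := Matrix.of fun i j => (D i)⁻¹ * L i j * D j ^ d

variable {L : Matrix (Fin m) (Fin m) Qbar} {M : GL (Fin m) Qbar} {D : Fin m → Qbar}
  {M' : Matrix (Fin m) (Fin m) Qbar}

lemma det_ne_zero_of_eq_diagonal_mul (hM : M.1 = Matrix.diagonal D * M') : M'.det ≠ 0 := by
  intro h
  have h1 : IsUnit M.1.det := (Matrix.isUnit_iff_isUnit_det _).mp M.isUnit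
  rw [hM, Matrix.det_mul, h, mul_zero] at h1
  exact not_isUnit_zero h1

/-- M sends the j-th column of the adjugate of M' to a multiple of the j-th unit vector. The
conjugate evaluated there, followed by M', therefore reads off the j-th column of D⁻¹LDᵈ. With the
adjugate instead of the inverse, the determinant appears only as an explicit factor. -/
lemma mulVec_eval_conjBy (hd : 0 < d) (hD : ∀ l, D l ≠ 0) (hM : M.1 = Matrix.diagonal D * M')
    (i j : Fin m) :
    M'.mulVec (fun k => eval (M'.adjugate.mulVec (Pi.single j 1)) (conjBy M (powerMap d L) k)) i =
      M'.det ^ d * scaledMatrix d D L i j := by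
  have h1 : M.1.mulVec (M'.adjugate.mulVec (Pi.single j 1)) = Pi.single j (D j * M'.det) := by
    rw [Matrix.mulVec_mulVec, hM, Matrix.mul_assoc, Matrix.mul_adjugate]
    ext l
    rw [Matrix.mulVec_single_one, Matrix.col_apply, Matrix.diagonal_mul, Matrix.smul_apply,
      Matrix.one_apply, Pi.single_apply]
    split_ifs with h
    · rw [h, smul_eq_mul, mul_one]
    · rw [smul_zero, mul_zero]
  have h2 : (Pi.single j (D j * M'.det) : Fin m → Qbar) ^ d = Pi.single j ((D j * M'.det) ^ d) := by
    ext l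
    rw [Pi.pow_apply, Pi.single_apply, Pi.single_apply]
    split_ifs
    · rfl
    · exact zero_pow hd.ne'
  have h3 : (fun k => eval (M'.adjugate.mulVec (Pi.single j 1)) (conjBy M (powerMap d L) k)) =
      (M⁻¹).1.mulVec (L.mulVec (Pi.single j ((D j * M'.det) ^ d))) := by
    ext k
    rw [eval_conjBy_powerMap, h1, h2]
  have h4 : M.1.mulVec ((M⁻¹).1.mulVec (L.mulVec (Pi.single j ((D j * M'.det) ^ d)))) =
      L.mulVec (Pi.single j ((D j * M'.det) ^ d)) := by
    rw [Matrix.mulVec_mulVec, ← Units.val_mul, mul_inv_cancel, Units.val_one, Matrix.one_mulVec]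
  have h5 := congrFun h4 i
  rw [← h3] at h5
  rw [hM, ← Matrix.mulVec_mulVec, Matrix.mulVec_diagonal] at h5
  have h6 : L.mulVec (Pi.single j ((D j * M'.det) ^ d)) i = L i j * (D j * M'.det) ^ d := by
    simp [Matrix.mulVec_single]
  rw [h6] at h5
  refine mul_left_cancel₀ (hD i) (h5.trans ?_)
  rw [scaledMatrix, Matrix.of_apply, mul_pow]
  have := hD i
  field_simp

lemma scaledMatrix_ne_zero (hm : 1 ≤ m) (hL : L.det ≠ 0) (hD : ∀ l, D l ≠ 0) :
    scaledMatrix d D L ≠ 0 := by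
  intro h
  have : Nonempty (Fin m) := ⟨⟨0, hm⟩⟩
  refine hL ?_
  have hL0 : L = 0 := by
    ext i j
    have h1 := congrFun (congrFun h i) j
    rw [scaledMatrix, Matrix.of_apply, Matrix.zero_apply] at h1
    rcases mul_eq_zero.mp h1 with h2 | h2
    · exact (mul_eq_zero.mp h2).resolve_left (inv_ne_zero (hD i))
    · exact absurd h2 (pow_ne_zero _ (hD j))
  rw [hL0, Matrix.det_zero]

/-- An error constant for the matrix of a diagonal conjugate. -/
def scaledConst (m d : ℕ) : ℝ := m + m * (d + 1) + d * detConst m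

/-- The adjugate has degree m - 1 in M' and enters a form of degree d; the final multiplication by
M' adds 1. The term with det M' contributes nothing to the global inequality. -/
lemma log_matSup_scaledMatrix_le (hw : LocalPlace w ε) (hd : 0 < d) (hm : 1 ≤ m)
    (hL : L.det ≠ 0) (hD : ∀ l, D l ≠ 0) (hM : M.1 = Matrix.diagonal D * M') :
    Real.log (matSup w (scaledMatrix d D L)) + d * Real.log (w M'.det) ≤
      Real.log (setSup w (tupleSet (conjBy M (powerMap d L)))) +
        (1 + d * ((m : ℝ) - 1)) * Real.log (matSup w M') + ε * scaledConst m d := by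
  set g := conjBy M (powerMap d L) with hg
  set G := setSup w (tupleSet g) with hG
  have hdet := det_ne_zero_of_eq_diagonal_mul hM
  have hM'pos := matSup_pos_of_det w hm hdet
  have hwdet := w.pos hdet
  have hG0 : 0 ≤ G := setSup_nonneg _ _
  have hf : (0 : ℝ) < m.factorial := by exact_mod_cast m.factorial_pos
  have hmR : (0 : ℝ) < m := by exact_mod_cast hm
  set a := (m.factorial : ℝ) ^ ε * matSup w M' ^ (m - 1) with ha
  have ha0 : 0 < a := by positivity
  set Y := (((d + 1 : ℕ) : ℝ) ^ m) ^ ε * (G * a ^ d) with hY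
  have hY0 : 0 ≤ Y := by positivity
  have hentry : ∀ i j, w M'.det ^ d * w (scaledMatrix d D L i j) ≤
      (m : ℝ) ^ ε * (matSup w M' * Y) := by
    intro i j
    rw [← map_pow, ← map_mul, ← mulVec_eval_conjBy hd hD hM]
    refine hw.mulVec_le M' hY0 (fun k => ?_) i
    refine (eval_le hw (conjBy_powerMap_isHomogeneous M k) ha0.le fun l => ?_).trans ?_
    · rw [Matrix.mulVec_single_one, Matrix.col_apply]
      exact (le_matSup w _ l j).trans (matSup_adjugate_le hw M')
    · exact mul_le_mul_of_nonneg_left (mul_le_mul_of_nonneg_right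
        (gauss_le_tupleSet w g k) (by positivity)) (by positivity)
  have hE : w M'.det ^ d * matSup w (scaledMatrix d D L) ≤ (m : ℝ) ^ ε * (matSup w M' * Y) := by
    rw [← le_div_iff₀' (pow_pos hwdet d)]
    refine matSup_le (by positivity) fun i j => ?_
    rw [le_div_iff₀' (pow_pos hwdet d)]
    exact hentry i j
  have hEpos := matSup_pos w (scaledMatrix_ne_zero (d := d) hm hL hD)
  have hGpos : 0 < G := by
    rcases hG0.eq_or_lt with h | h
    · rw [hY, ← h, zero_mul, mul_zero, mul_zero, mul_zero] at hE
      exact absurd hE (mul_pos (pow_pos hwdet d) hEpos).not_ge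
    · exact h
  have hlog := Real.log_le_log (mul_pos (pow_pos hwdet d) hEpos) hE
  rw [Real.log_mul (by positivity) hEpos.ne', Real.log_pow, Real.log_mul (by positivity)
    (by positivity), Real.log_pow, Real.log_mul hM'pos.ne' (by positivity), hY,
    Real.log_mul (by positivity) (by positivity), Real.log_pow, Real.log_pow,
    Real.log_mul hGpos.ne' (by positivity), Real.log_pow, ha,
    Real.log_mul (by positivity) (by positivity), Real.log_pow, Real.log_pow,
    Nat.cast_sub hm, Nat.cast_one] at hlog
  have hεn : (0 : ℝ) ≤ ε := Nat.cast_nonneg ε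
  have h1 := mul_le_mul_of_nonneg_left (Real.log_le_self hmR.le) hεn
  have h2 := mul_le_mul_of_nonneg_left (mul_le_mul_of_nonneg_left
    (Real.log_le_self (x := ((d + 1 : ℕ) : ℝ)) (by positivity)) hmR.le) hεn
  push_cast at h2 hlog
  unfold scaledConst detConst
  linarith

lemma matHeight_scaledMatrix_le (hd : 2 ≤ d) (hm : 1 ≤ m) (hL : L.det ≠ 0) (hD : ∀ l, D l ≠ 0)
    (hM : M.1 = Matrix.diagonal D * M') :
    matHeight (scaledMatrix d D L) ≤ tupleHeight (conjBy M (powerMap d L)) +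
      (1 + d * ((m : ℝ) - 1)) * matHeight M' + scaledConst m d := by
  have hne : Nonempty (Fin m) := ⟨⟨0, hm⟩⟩
  have hdet := det_ne_zero_of_eq_diagonal_mul hM
  have hE0 := scaledMatrix_ne_zero (d := d) hm hL hD
  have hM0 : M' ≠ 0 := by
    rintro rfl
    exact hdet Matrix.det_zero
  have h := setHeight_sum_le ![entries (scaledMatrix d D L), {M'.det},
      tupleSet (conjBy M (powerMap d L)), entries M']
    (fun j => by
      fin_cases j
      · exact exists_entry_ne_zero hE0
      · exact ⟨_, Finset.mem_singleton_self _, hdet⟩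
      · exact tupleSet_ne_zero M hd hm hL
      · exact exists_entry_ne_zero hM0)
    ![1, (d : ℝ), -1, -(1 + d * ((m : ℝ) - 1))] (scaledConst m d) (fun w ε hw => by
      have h2 := log_matSup_scaledMatrix_le (d := d) hw (by omega) hm hL hD hM
      rw [matSup_eq, matSup_eq] at h2
      simp only [Fin.sum_univ_four, Matrix.cons_val]
      rw [setSup_singleton]
      linarith)
  simp only [Fin.sum_univ_four, Matrix.cons_val] at h
  rw [setHeight_singleton, ← matHeight_eq, ← matHeight_eq, ← tupleHeight_eq] at h
  linarith

end ScaledMatrix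

/-! ### Elimination of the diagonal matrix: the moduli height bounds h(𝐛) -/

section ModuliHeight

variable {N d : ℕ} {w : AbsoluteValue Qbar ℝ} {ε : ℕ} {A : Matrix (Fin N) (Fin N) Qbar}
  {b : Fin N → Qbar}

lemma exists_perm_ne_zero (hA : A.det ≠ 0) : ∃ σ : Equiv.Perm (Fin N), ∀ i, A (σ i) i ≠ 0 := by
  by_contra! h
  refine hA ?_
  rw [Matrix.det_apply]
  refine Finset.sum_eq_zero fun σ _ => ?_
  obtain ⟨i, hi⟩ := h σ
  have h1 : ∏ j, A (σ j) j = 0 := Finset.prod_eq_zero (Finset.mem_univ i) hi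
  rw [h1, smul_zero]

/-- Each nonzero entry of L bounds a combination of the logarithms of the diagonal entries of D. The
entries of A along the permutation σ say that d times the i-th logarithm is at most the σ(i)-th plus
controlled terms. After summing over i the permutation disappears and a factor d - 1 ≥ 1 is left, so
D is controlled relative to its last entry. The column 𝐛 then gives the claim. -/
lemma log_setSup_pointSet_le (hd : 2 ≤ d) {σ : Equiv.Perm (Fin N)} (hσ : ∀ i, A (σ i) i ≠ 0)
    {D : Fin (N + 1) → Qbar} (hD : ∀ l, D l ≠ 0) (w : AbsoluteValue Qbar ℝ) :
    Real.log (setSup w (pointSet b)) ≤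
      (N + 1) * (Real.log (matSup w (scaledMatrix d D (augMatrix A b))) -
        ((d : ℝ) - 1) * Real.log (w (D (Fin.last N)))) +
      N * Real.log (setSup w (pointSet fun i => (A (σ i) i)⁻¹)) := by
  set E := scaledMatrix d D (augMatrix A b) with hE
  set e := Real.log (matSup w E) with he
  set a := Real.log (setSup w (pointSet fun i => (A (σ i) i)⁻¹)) with ha
  set t : Fin (N + 1) → ℝ := fun i => Real.log (w (D i)) with ht
  set T := t (Fin.last N) with hT
  have hwD : ∀ i, 0 < w (D i) := fun i => w.pos (hD i)
  have hd2 : (2 : ℝ) ≤ d := by exact_mod_cast hd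
  have hd0 : d ≠ 0 := by omega
  have hentry : ∀ i j, augMatrix A b i j ≠ 0 →
      Real.log (w (augMatrix A b i j)) - t i + d * t j ≤ e := by
    intro i j hij
    have h1 := le_matSup w E i j
    have h2 : 0 < w (E i j) := w.pos (by
      rw [hE, scaledMatrix, Matrix.of_apply]
      exact mul_ne_zero (mul_ne_zero (inv_ne_zero (hD i)) hij) (pow_ne_zero _ (hD j)))
    have h3 := Real.log_le_log h2 h1
    have h4 : E i j = (D i)⁻¹ * augMatrix A b i j * D j ^ d := rfl
    rw [h4, map_mul, map_mul, map_inv₀, map_pow,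
      Real.log_mul (mul_pos (inv_pos.mpr (hwD i)) (w.pos hij)).ne' (pow_pos (hwD j) d).ne',
      Real.log_mul (inv_pos.mpr (hwD i)).ne' (w.pos hij).ne', Real.log_inv, Real.log_pow] at h3
    simp only [ht]
    linarith
  have ha0 : 0 ≤ a := Real.log_nonneg (one_le_setSup_pointSet w _)
  have he0 : 0 ≤ e - (d - 1) * T := by
    have := hentry (Fin.last N) (Fin.last N) (by simp)
    simp only [augMatrix_last_last, map_one, Real.log_one] at this
    linarith
  -- Positive parts are used because only upper bounds for the differences are available, and the
  -- sum must dominate each one of them.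
  have hs : ∀ i : Fin N, d * max (t i.castSucc - T) 0 ≤
      (e - (d - 1) * T) + max (t (σ i).castSucc - T) 0 + a := by
    intro i
    rcases le_total (t i.castSucc - T) 0 with h | h
    · rw [max_eq_right h, mul_zero]
      have := le_max_right (t (σ i).castSucc - T) 0
      linarith
    · rw [max_eq_left h]
      have h1 := hentry (σ i).castSucc i.castSucc (by simpa using hσ i)
      rw [augMatrix_castSucc_castSucc] at h1
      have h2 : -Real.log (w (A (σ i) i)) ≤ a := by
        rw [← Real.log_inv, ← map_inv₀]
        exact Real.log_le_log (w.pos (inv_ne_zero (hσ i)))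
          (le_setSup w (mem_pointSet (fun i => (A (σ i) i)⁻¹) i))
      have h3 := le_max_left (t (σ i).castSucc - T) 0
      linarith
  set S := ∑ i : Fin N, max (t i.castSucc - T) 0 with hS
  have hS0 : 0 ≤ S := Finset.sum_nonneg fun i _ => le_max_right _ _
  have hSle : S ≤ N * (e - (d - 1) * T + a) := by
    have h1 := Finset.sum_le_sum fun i (_ : i ∈ Finset.univ) => hs i
    rw [← Finset.mul_sum, Finset.sum_add_distrib, Finset.sum_add_distrib,
      Equiv.sum_comp σ (fun i => max (t i.castSucc - T) 0), ← hS, Finset.sum_const,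
      Finset.sum_const, Finset.card_univ, Fintype.card_fin, nsmul_eq_mul, nsmul_eq_mul] at h1
    nlinarith
  have hfin : Real.log (setSup w (pointSet b)) ≤ (e - (d - 1) * T) + S := by
    obtain ⟨c, hc, hcs⟩ := exists_eq_setSup w ⟨1, one_mem_pointSet b⟩
    rw [hcs]
    rcases mem_pointSet_iff.mp hc with rfl | ⟨i, rfl⟩
    · rw [map_one, Real.log_one]; positivity
    · by_cases hb : b i = 0
      · rw [hb, map_zero, Real.log_zero]; positivity
      · have h1 := hentry i.castSucc (Fin.last N) (by simpa using hb)
        rw [augMatrix_castSucc_last] at h1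
        have h2 : max (t i.castSucc - T) 0 ≤ S := Finset.single_le_sum
          (f := fun i : Fin N => max (t i.castSucc - T) 0) (fun i _ => le_max_right _ _)
          (Finset.mem_univ i)
        have h3 := le_max_left (t i.castSucc - T) 0
        linarith
  have hT' : Real.log (w (D (Fin.last N))) = T := rfl
  rw [hT']
  linarith

lemma vecHeight_le_matHeight_scaledMatrix (hd : 2 ≤ d) {σ : Equiv.Perm (Fin N)}
    (hσ : ∀ i, A (σ i) i ≠ 0) {D : Fin (N + 1) → Qbar} (hD : ∀ l, D l ≠ 0) :
    vecHeight b ≤ (N + 1) * matHeight (scaledMatrix d D (augMatrix A b)) +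
      N * vecHeight fun i => (A (σ i) i)⁻¹ := by
  have hE0 : scaledMatrix d D (augMatrix A b) ≠ 0 := fun h => by
    have h1 := congrFun (congrFun h (Fin.last N)) (Fin.last N)
    rw [scaledMatrix, Matrix.of_apply, Matrix.zero_apply, augMatrix_last_last, mul_one] at h1
    exact mul_ne_zero (inv_ne_zero (hD _)) (pow_ne_zero _ (hD _)) h1
  have h := setHeight_sum_le ![pointSet b, entries (scaledMatrix d D (augMatrix A b)),
      {D (Fin.last N)}, pointSet fun i => (A (σ i) i)⁻¹]
    (fun j => by
      fin_cases j
      · exact ⟨1, one_mem_pointSet b, one_ne_zero⟩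
      · exact exists_entry_ne_zero hE0
      · exact ⟨_, Finset.mem_singleton_self _, hD _⟩
      · exact ⟨1, one_mem_pointSet _, one_ne_zero⟩)
    ![1, -((N : ℝ) + 1), (N + 1) * ((d : ℝ) - 1), -(N : ℝ)] 0 (fun w ε hw => by
      have h2 := log_setSup_pointSet_le (b := b) hd hσ hD w
      rw [matSup_eq] at h2
      simp only [Fin.sum_univ_four, Matrix.cons_val]
      rw [setSup_singleton]
      linarith)
  simp only [Fin.sum_univ_four, Matrix.cons_val] at h
  rw [setHeight_singleton, ← matHeight_eq, ← vecHeight_eq, ← vecHeight_eq] at h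
  linarith

lemma tupleHeight_nonneg {m : ℕ} (Φ : FormTuple m) : 0 ≤ tupleHeight Φ := by
  rw [tupleHeight_eq]; exact setHeight_nonneg _

/-- The constants depend on A, through the permutation and the entries along it, but not on the
conjugating matrix, so the bound passes to the infimum. -/
lemma exists_vecHeight_le_moduliHeight (hd : 2 ≤ d) (hA : A.det ≠ 0) :
    ∃ K C : ℝ, 0 < K ∧ ∀ b : Fin N → Qbar,
      vecHeight b ≤ K * moduliHeight (affinePowerMap d A b) + C := by
  obtain ⟨σ, hσ⟩ := exists_perm_ne_zero hA
  have hN1 : (0 : ℝ) < N + 1 := by positivity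
  set k : ℝ := 1 + d * N with hk
  have hk0 : 0 < k := by positivity
  set K : ℝ := (N + 1) * (1 + k * (N + 1)) with hK
  have hK0 : 0 < K := by positivity
  set C : ℝ := (N + 1) * (k * rowConst (N + 1) d + scaledConst (N + 1) d) +
    N * vecHeight fun i => (A (σ i) i)⁻¹ with hC
  refine ⟨K, C, hK0, fun b => ?_⟩
  have hL : (augMatrix A b).det ≠ 0 := (isUnit_det_augMatrix (isUnit_iff_ne_zero.mpr hA)).ne_zero
  have key : ∀ M : GL (Fin (N + 1)) Qbar, (vecHeight b - C) / K ≤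
      tupleHeight (conjBy M (affinePowerMap d A b)) := by
    intro M
    obtain ⟨D, M', hD, hM, h1⟩ := exists_normalized_rows M
    rw [affinePowerMap_eq]
    have h2 := vecHeight_le_matHeight_scaledMatrix (b := b) hd hσ hD
    have h3 := matHeight_scaledMatrix_le hd (by omega) hL hD hM
    have h4 := matHeight_rows_le M hd (by omega) hL hD hM h1
    push_cast at h3 h4
    rw [add_sub_cancel_right] at h3
    have h5 := mul_le_mul_of_nonneg_left h4 hk0.le
    have h6 := mul_le_mul_of_nonneg_left (h3.trans (add_le_add_left (add_le_add_right h5 _) _))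
      hN1.le
    rw [div_le_iff₀' hK0, hK, hC]
    linarith
  have h := le_ciInf key
  rw [div_le_iff₀' hK0] at h
  unfold moduliHeight
  linarith

end ModuliHeight

/-! ### Upper bound for the moduli height and families with fixed A -/

section ModuliUpper

open MvPolynomial

variable {N m d : ℕ} {A : Matrix (Fin N) (Fin N) Qbar}

lemma tupleSet_powerMap_subset (hd : 0 < d) (B : Matrix (Fin m) (Fin m) Qbar) {a : Qbar}
    (ha : a ∈ tupleSet (powerMap d B)) : a ∈ entries B := by
  classical
  obtain ⟨i, hi⟩ := mem_tupleSet.mp ha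
  obtain ⟨s, hs, rfl⟩ := mem_coeffs_iff.mp hi
  have hcoeff : (powerMap d B i).coeff s = ∑ j, B i j * if Finsupp.single j d = s then 1 else 0 := by
    simp only [powerMap, coeff_sum, coeff_C_mul, coeff_X_pow]
  obtain ⟨j, -, hj⟩ := Finset.exists_ne_zero_of_sum_ne_zero (hcoeff ▸ mem_support_iff.mp hs)
  have hjs : Finsupp.single j d = s := by
    by_contra h
    rw [if_neg h, mul_zero] at hj
    exact hj rfl
  have h2 : (powerMap d B i).coeff s = B i j := by
    rw [hcoeff, Finset.sum_eq_single j, if_pos hjs, mul_one]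
    · intro l _ hl
      rw [if_neg, mul_zero]
      intro h
      exact hl (Finsupp.single_left_injective hd.ne' (h.trans hjs.symm))
    · simp
  rw [h2]
  exact Finset.mem_image.mpr ⟨(i, j), Finset.mem_univ _, rfl⟩

lemma conjBy_one (Φ : FormTuple m) : conjBy 1 Φ = Φ := by
  have h : (fun l : Fin m => ∑ r, C ((1 : GL (Fin m) Qbar).1 l r) * X r) =
      (X : Fin m → MvPolynomial (Fin m) Qbar) := by
    ext1 l
    simp [Matrix.one_apply]
  ext1 i
  unfold conjBy
  rw [h]
  simp [Matrix.one_apply]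

lemma moduliHeight_nonneg (Φ : FormTuple m) : 0 ≤ moduliHeight Φ :=
  Real.iInf_nonneg fun _ => tupleHeight_nonneg _

lemma moduliHeight_le_tupleHeight (Φ : FormTuple m) : moduliHeight Φ ≤ tupleHeight Φ := by
  have h : BddBelow (Set.range fun M : GL (Fin m) Qbar => tupleHeight (conjBy M Φ)) :=
    ⟨0, by rintro _ ⟨M, rfl⟩; exact tupleHeight_nonneg _⟩
  have h1 := ciInf_le h 1
  rwa [conjBy_one] at h1

lemma matSup_augMatrix_le (w : AbsoluteValue Qbar ℝ) (b : Fin N → Qbar) :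
    matSup w (augMatrix A b) ≤ setSup w (pointSet b) * matSup w (augMatrix A 0) := by
  have h1 := one_le_setSup_pointSet w b
  have h2 : 1 ≤ matSup w (augMatrix A 0) := by
    simpa using le_matSup w (augMatrix A 0) (Fin.last N) (Fin.last N)
  have h3 : 0 ≤ setSup w (pointSet b) * matSup w (augMatrix A 0) := by positivity
  refine matSup_le h3 fun i j => ?_
  refine Fin.lastCases ?_ (fun i => ?_) i <;> refine Fin.lastCases ?_ (fun j => ?_) j
  · rw [augMatrix_last_last, map_one]
    exact one_le_mul_of_one_le_of_one_le h1 h2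
  · rw [augMatrix_last_castSucc, map_zero]
    exact h3
  · rw [augMatrix_castSucc_last]
    exact (le_setSup w (mem_pointSet b i)).trans
      (le_mul_of_one_le_right (zero_le_one.trans h1) h2)
  · have h4 := le_matSup w (augMatrix A 0) i.castSucc j.castSucc
    rw [augMatrix_castSucc_castSucc] at h4 ⊢
    exact h4.trans (le_mul_of_one_le_left (zero_le_one.trans h2) h1)

lemma augMatrix_ne_zero (b : Fin N → Qbar) : augMatrix A b ≠ 0 := fun h => by
  have h1 := congrFun (congrFun h (Fin.last N)) (Fin.last N)
  rw [augMatrix_last_last] at h1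
  exact one_ne_zero h1

lemma tupleHeight_affinePowerMap_le (hd : 0 < d) (b : Fin N → Qbar) :
    tupleHeight (affinePowerMap d A b) ≤ vecHeight b + matHeight (augMatrix A 0) := by
  have hne : ∃ a ∈ tupleSet (affinePowerMap d A b), a ≠ 0 := by
    refine ⟨1, mem_tupleSet.mpr ⟨Fin.last N, ?_⟩, one_ne_zero⟩
    refine mem_coeffs_iff.mpr ⟨Finsupp.single (Fin.last N) d, ?_, ?_⟩ <;>
      simp [affinePowerMap, coeff_X_pow]
  have h := setHeight_sum_le ![tupleSet (affinePowerMap d A b), pointSet b,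
      entries (augMatrix A 0)]
    (fun j => by
      fin_cases j
      · exact hne
      · exact ⟨1, one_mem_pointSet b, one_ne_zero⟩
      · exact exists_entry_ne_zero (augMatrix_ne_zero 0)) ![1, -1, -1] 0
    (fun w ε hw => by
      simp only [Fin.sum_univ_three, Matrix.cons_val]
      have h1 : setSup w (tupleSet (affinePowerMap d A b)) ≤ matSup w (augMatrix A b) := by
        refine setSup_le w (matSup_nonneg w _) fun a ha => ?_
        rw [affinePowerMap_eq] at ha
        rw [matSup_eq]
        exact le_setSup w (tupleSet_powerMap_subset hd _ ha)
      have h2 := Real.log_le_log (setSup_pos w hne) (h1.trans (matSup_augMatrix_le w b))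
      have h3 := matSup_pos w (augMatrix_ne_zero (A := A) 0)
      rw [Real.log_mul (zero_lt_one.trans_le (one_le_setSup_pointSet w b)).ne' h3.ne',
        matSup_eq] at h2
      linarith)
  simp only [Fin.sum_univ_three, Matrix.cons_val] at h
  rw [← matHeight_eq, ← vecHeight_eq, ← tupleHeight_eq] at h
  linarith

/-- For fixed A the critical height of f|_H is independent of 𝐛 and goes into the constant. The
comparison with the moduli height then follows, since it is commensurate with h(𝐛). -/
lemma critHeight_commensurate (hd : 2 ≤ d) (hN : 1 ≤ N)
    (A : Matrix.SpecialLinearGroup (Fin N) Qbar) :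
    ∃ c₁ c₂ C : ℝ, 0 < c₁ ∧ 0 < c₂ ∧ ∀ b : Fin N → Qbar,
      c₁ * vecHeight b - C ≤ critHeight d (affinePowerMap d A.1 b) ∧
      critHeight d (affinePowerMap d A.1 b) ≤ c₂ * vecHeight b + C ∧
      c₁ * moduliHeight (affinePowerMap d A.1 b) - C ≤ critHeight d (affinePowerMap d A.1 b) ∧
      critHeight d (affinePowerMap d A.1 b) ≤
        c₂ * moduliHeight (affinePowerMap d A.1 b) + C := by
  have hd0 : 0 < d := by omega
  obtain ⟨C₁, C₂, hb⟩ := critHeight_bounds (d := d) hd hN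
  obtain ⟨K, C₃, hK, hK'⟩ := exists_vecHeight_le_moduliHeight hd (A.2.trans_ne one_ne_zero)
  set α : ℝ := ((d : ℝ) - 1) / d with hα
  have hdR : (2 : ℝ) ≤ d := by exact_mod_cast hd
  have hα0 : 0 < α := div_pos (by linarith) (by linarith)
  set B : ℝ := N + 1 with hB
  have hB0 : 0 < B := by positivity
  set h₀ := critHeight d (powerMap d A.1) with hh₀
  set a₁ : ℝ := (N - 1 / d) * matHeight A.1 + C₁ - h₀ with ha₁
  set a₂ : ℝ := (N * (N + 1) - 1) * matHeight A.1 + C₂ + h₀ with ha₂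
  set a₃ : ℝ := matHeight (augMatrix A.1 0) with ha₃
  have ha₃0 : 0 ≤ α * a₃ := mul_nonneg hα0.le (matHeight_nonneg _)
  -- The factor 1 + K serves both upper bounds: 1 for the one in h(𝐛) and K for the one in the
  -- moduli height.
  refine ⟨α, B * (1 + K), |a₁| + |a₂| + α * a₃ + B * |C₃|, hα0, by positivity, fun b => ?_⟩
  obtain ⟨-, -, h1, h2⟩ := hb A b
  rw [restrictH_affinePowerMap _ _ hd0] at h1 h2
  have hv := vecHeight_nonneg b
  have hμ := moduliHeight_nonneg (affinePowerMap d A.1 b)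
  have h3 := hK' b
  have h4 := (moduliHeight_le_tupleHeight _).trans (tupleHeight_affinePowerMap_le (A := A.1) hd0 b)
  set v := vecHeight b
  set μ := moduliHeight (affinePowerMap d A.1 b)
  have h5 := mul_le_mul_of_nonneg_left h3 hB0.le
  have h6 := mul_le_mul_of_nonneg_left h4 hα0.le
  have h7 := le_abs_self a₁
  have h8 := le_abs_self a₂
  have h9 := mul_le_mul_of_nonneg_left (le_abs_self C₃) hB0.le
  have h10 := abs_nonneg a₁
  have h11 := abs_nonneg a₂
  have h12 : 0 ≤ B * |C₃| := by positivity
  have h13 : 0 ≤ B * (K * v) := by positivity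
  have h14 : 0 ≤ B * μ := by positivity
  refine ⟨?_, ?_, ?_, ?_⟩ <;> linarith

end ModuliUpper

end CritHeight

end

/-! ### The bounds with the stated coefficients -/

theorem mainTheorem4 (N d : ℕ) (hN : 1 ≤ N) (hd : 2 ≤ d) :
    (∃ C₁ C₂ : ℝ, ∀ (A : Matrix.SpecialLinearGroup (Fin N) CritHeight.Qbar)
        (b : Fin N → CritHeight.Qbar),
      let f := CritHeight.affinePowerMap d A.1 b
      let fH := CritHeight.restrictH f
      -- the limits that define the two critical heights exist
      Filter.Tendsto (CritHeight.canonicalSeq d f (CritHeight.critDivisor f)) Filter.atTop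
          (nhds (CritHeight.critHeight d f)) ∧
      Filter.Tendsto (CritHeight.canonicalSeq d fH (CritHeight.critDivisor fH)) Filter.atTop
          (nhds (CritHeight.critHeight d fH)) ∧
      -- the lower bound
      CritHeight.critHeight d f - CritHeight.critHeight d fH ≥
        ((d : ℝ) - 1) / d * CritHeight.vecHeight b
          - ((N : ℝ) * (d * N + 1) - 1) / (N * d) * CritHeight.matHeight A.1 - C₁ ∧
      -- the upper bound
      CritHeight.critHeight d f - CritHeight.critHeight d fH ≤
        (N : ℝ) * (N + 2) * CritHeight.vecHeight b
          + (N : ℝ) * (N + 1) * CritHeight.matHeight A.1 + C₂) ∧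
    -- for fixed `A`, the critical height is commensurate to the height of the parameter `b` and
    -- to the moduli height
    (∀ A : Matrix.SpecialLinearGroup (Fin N) CritHeight.Qbar,
      ∃ c₁ c₂ C : ℝ, 0 < c₁ ∧ 0 < c₂ ∧ ∀ b : Fin N → CritHeight.Qbar,
        let f := CritHeight.affinePowerMap d A.1 b
        c₁ * CritHeight.vecHeight b - C ≤ CritHeight.critHeight d f ∧
        CritHeight.critHeight d f ≤ c₂ * CritHeight.vecHeight b + C ∧
        c₁ * CritHeight.moduliHeight f - C ≤ CritHeight.critHeight d f ∧
        CritHeight.critHeight d f ≤ c₂ * CritHeight.moduliHeight f + C) := by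
  refine ⟨?_, CritHeight.critHeight_commensurate hd hN⟩
  obtain ⟨C₁, C₂, h⟩ := CritHeight.critHeight_bounds (d := d) hd hN
  refine ⟨C₁, C₂, fun A b => ?_⟩
  obtain ⟨h1, h2, h3, h4⟩ := h A b
  have hv := CritHeight.vecHeight_nonneg b
  have hA := CritHeight.matHeight_nonneg A.1
  have hNR : (1 : ℝ) ≤ N := by exact_mod_cast hN
  have hdR : (2 : ℝ) ≤ d := by exact_mod_cast hd
  refine ⟨h1, h2, ge_iff_le.mpr (le_trans ?_ h3), h4.trans ?_⟩
  -- The right side equals N + 1/d - 1/(Nd), so the coefficient obtained is sharper than required.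
  · have h5 : (N : ℝ) - 1 / d ≤ ((N : ℝ) * (d * N + 1) - 1) / (N * d) := by
      rw [le_div_iff₀ (by positivity)]
      field_simp
      nlinarith
    have h6 := mul_le_mul_of_nonneg_right h5 hA
    linarith
  · have h5 : (N : ℝ) + 1 ≤ N * (N + 2) := by nlinarith
    have h6 := mul_le_mul_of_nonneg_right h5 hv
    linarith
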